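/- **Setting.** Consider general relativity with a minimally coupled scalar field $\varphi$ (smooth potential $V$, coupling $\lambda_\varphi\neq0$, $\kappa=16\pi G>0$; $V$ is twice the usual potential) on the extended ADM phase space with variables $(q_{ab},P^{ab})$, $(\varphi,\pi_\varphi)$, $(N,\Pi)$, $(N^a,\Pi_a)$ over $\mathbb R^3$, with brackets $\{q_{ab}(x),P^{cd}(y)\}=\kappa\,\delta^c_{(a}\delta^d_{b)}\delta(x,y)$, $\{\varphi(x),\pi_\varphi(y)\}=\delta(x,y)$, constraints $\Pi$, $\Pi_a$, $$C=\tfrac{1}{\sqrt q}\big(P_{ab}P^{ab}-\tfrac12P^2\big)-\sqrt q\,R+\kappa\Big(\tfrac{\lambda_\varphi\pi_\varphi^2}{2\sqrt q}+\tfrac{\sqrt q}{2\lambda_\varphi}\big(q^{ab}\partial_a\varphi\,\partial_b\varphi+V(\varphi)\big)\Big),\qquad C_a=-2q_{ac}D_bP^{bc}+\kappa\pi_\varphi\partial_a\varphi ,$$ and dynamics generated by $\int(NC+N^aC_a+\lambda\Pi+\lambda^a\Pi_a)$, normalized so that $q_{ab},P^{ab},\varphi,\pi_\varphi$ obey the ADM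 evolution equations with lapse $N$ and shift $N^a$, and $\dot N=\lambda$, $\dot N^a=\lambda^a$, $\dot\Pi=-C$, $\dot\Pi_a=-C_a$. On an open set $I$ of times let $q_{ab}=A\delta_{ab}$, $P^{ab}=\tilde P\delta^{ab}$, $N=\bar N$, $N^a=0$, $\varphi=\bar\varphi$, $\pi_\varphi=\bar\pi_\varphi$, $\Pi=\Pi_a=0$ (functions of $t$ only) be a smooth solution of these equations and constraints with $A>0$, $\bar N>0$, $\dot A\ne0$. Put $\tilde{\mathcal H}=\dot A/(2A)$ and $p=\frac12\big(\lambda_\varphi\bar\pi_\varphi^2/A^3-V(\bar\varphi)/\lambda_\varphi\big)$. Write perturbations as $$\delta q_{ab}=2A\big(\psi\delta_{ab}+E_{,<ab>}+F_{(a,b)}+\tfrac12h^{TT}_{ab}\big),\quad \delta P^{ab}=2\tilde P\big(p_\psi\delta^{ab}+p_E^{,<ab>}+p_F^{(a,b)}+\tfrac12p_{h}^{ab}\big),$$ $$\delta N=\bar N\phi,\quad \delta N^a=B^{,a}+S^a,\quad\delta\Pi=\bar Np_\phi,\quad \delta\Pi_a=p_{B,a}+p_{S\,a},$$ together with $\delta\varphi,\delta\pi_\varphi$,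 where $E_{,<ab>}=E_{,ab}-\frac13\delta_{ab}\Delta E$, $\Delta$ is the Laplacian of $\delta_{ab}$, $F,p_F,S,p_S$ are divergence-free, $h^{TT},p_h$ are symmetric, trace-free and divergence-free, and all components are smooth in $(t,x)$ and decay at spatial infinity together with their first time derivatives (in each case with all spatial derivatives). Let $G^\mu=-T^\mu$ with the linearized geometrical clocks of the longitudinal gauge $$\delta T^0=2\tilde P\sqrt A\,(E+p_E),\qquad \delta T^a=\delta^{ab}(E_{,b}+F_b),$$ let $\mathcal B$ be the inverse of $\mathcal A^\mu_\nu=\{T^\mu,C_\nu\}$ at the background, and let the linearized Dirac observable of a phase space function $f$ be $$\mathcal O_f=\delta f+\overline{\{f,C_\nu\}}\,(\mathcal B\,\delta G)^\nu+\overline{\{f,\Pi_\nu\}}\,\Big(\mathcal B\big(\delta\dot G-\overline{\{\dot T,C_\rho\}}\,(\mathcal B\,\delta G)^\rho\big)\Big)^\nu ,$$ where $C_\nu=(C,C_a)$, $\Pi_\nu=(\Pi,\Pi_a)$, sums and spatial integrals are understood, the brackets with $C_\nu$ and $\Pi_\nu$ are normalized so that smearing them with $(n,v^a)$ gives, respectively,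 the ADM evolution with lapse $n$ and shift $v^a$, and the displacement $(\delta N,\delta N^a)=(n,v^a)$. Let $\approx$ mean equality along every solution of the linearized canonical equations (with arbitrary multipliers $\delta\lambda,\delta\lambda^a$) that satisfies all linearized constraints. Set $$\Psi=\psi+\tfrac{4\tilde{\mathcal H}^2A}{\bar N^2}(E+p_E)-\tfrac13\Delta E,\qquad \Upsilon=p_\psi+\tfrac12\Delta E+\tfrac23\Delta p_E-\Big(\tfrac{\tilde{\mathcal H}^2A}{\bar N^2}+\tfrac{\kappa A}{2}p\Big)(E+p_E),$$ $$\nu^a=p_F^a+\delta^{ab}F_b,\qquad \digamma=\frac{10\tilde{\mathcal H}^2+\kappa\bar N^2p}{4\tilde{\mathcal H}},\qquad \delta\varphi^{(gi)}=\mathcal O_{\delta\varphi},\quad\delta\pi_\varphi^{(gi)}=\mathcal O_{\delta\pi_\varphi},$$ $$\delta\tilde T^{(gi)}=-3\lambda_\varphi\tfrac{\bar\pi_\varphi^2}{A^3}\Psi+\lambda_\varphi\tfrac{\bar\pi_\varphi}{A^3}\delta\pi_\varphi^{(gi)}-\tfrac1{2\lambda_\varphi}V'(\bar\varphi)\,\delta\varphi^{(gi)}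 .$$ **Claim.** For all $t\in I$: (i) $\mathcal O_\psi\approx\Psi$, $\mathcal O_\phi\approx-\Psi$, $\mathcal O_{p_\psi}\approx\Upsilon$, $\mathcal O_{p_F^a}\approx\nu^a$, $\mathcal O_{S^a}\approx4\tilde{\mathcal H}\nu^a$, $\mathcal O_E,\mathcal O_{p_E},\mathcal O_{F_a},\mathcal O_B\approx0$, and $\mathcal O_{p_\phi}\approx p_\phi$, $\mathcal O_{p_B}\approx p_B$, $\mathcal O_{p_S^a}\approx p_S^a$. (ii) The observables obey the gauge-invariant Hamilton equations $$\dot{\mathcal O}_\psi\approx2\tilde{\mathcal H}(\Upsilon-\Psi),\qquad \dot{\mathcal O}_{\phi}\approx2\tilde{\mathcal H}(\Psi-\Upsilon),$$ $$\dot{\mathcal O}_{p_\psi}\approx\Big(-\tfrac{\tilde{\mathcal H}}2+\tfrac\kappa4\tfrac{\bar N^2p}{\tilde{\mathcal H}}\Big)\Upsilon+\tfrac{\tilde{\mathcal H}}2\Psi-\tfrac\kappa8\tfrac{\bar N^2}{\tilde{\mathcal H}}\delta\tilde T^{(gi)},$$ $$\dot{\mathcal O}_{p_F^a}\approx(\digamma-4\tilde{\mathcal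 H})\nu^a,\qquad \dot{\mathcal O}_{S^a}\approx(4\dot{\tilde{\mathcal H}}-16\tilde{\mathcal H}^2+4\digamma\tilde{\mathcal H})\nu^a,$$ $$\dot{\mathcal O}_{\delta\varphi}\approx\bar N\tfrac{\lambda_\varphi}{A^{3/2}}\big(-4\bar\pi_\varphi\Psi+\delta\pi_\varphi^{(gi)}\big),$$ $$\dot{\mathcal O}_{\delta\pi_\varphi}\approx-\bar N\tfrac{A^{3/2}}{\lambda_\varphi}\Big(V'(\bar\varphi)\Psi-\tfrac1A\Delta\delta\varphi^{(gi)}+\tfrac12V''(\bar\varphi)\,\delta\varphi^{(gi)}\Big),$$ and the time derivatives of $\mathcal O_E,\mathcal O_{p_E},\mathcal O_{F_a},\mathcal O_B,\mathcal O_{p_\phi},\mathcal O_{p_B},\mathcal O_{p_S^a}$ vanish weakly. (iii) Wherever $\dot{\bar\varphi}\neq0$, the Bardeen potential obeys the closed equation $$\ddot\Psi\approx\frac{\bar N^2}{A}\Delta\Psi+\Big(\frac\kappa2\bar N^2p-\frac{\bar N^2\tilde{\mathcal H}}{\dot{\bar\varphi}}V'(\bar\varphi)-3\tilde{\mathcal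 H}^2\Big)\Psi+\Big(\frac{\dot{\bar N}}{\bar N}-7\tilde{\mathcal H}-\frac{\bar N^2}{\dot{\bar\varphi}}V'(\bar\varphi)\Big)\dot\Psi .$$ (iv) If $\bar N=\sqrt A$ on $I$ (conformal time), then wherever $\dot{\bar\varphi}\neq0$ this is the Lagrangian equation $$\ddot\Psi+2\Big(\tilde{\mathcal H}-\frac{\ddot{\bar\varphi}}{\dot{\bar\varphi}}\Big)\dot\Psi-\Delta\Psi+2\Big(\dot{\tilde{\mathcal H}}-\tilde{\mathcal H}\frac{\ddot{\bar\varphi}}{\dot{\bar\varphi}}\Big)\Psi\approx0 .$$ -/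

import Mathlib

open Filter Topology
open scoped ContDiff

noncomputable section

namespace Cosmo

/-- Coordinate space `ℝ³`. -/
abbrev E3 := EuclideanSpace ℝ (Fin 3)

abbrev Mat3 := Matrix (Fin 3) (Fin 3) ℝ

/-- Partial derivative `∂_i f`. -/
def pd (i : Fin 3) (f : E3 → ℝ) : E3 → ℝ :=
  fun x => fderiv ℝ f x (EuclideanSpace.single i 1)

/-- Laplacian with respect to the flat metric `δ_ab`. -/
def lap (f : E3 → ℝ) : E3 → ℝ := fun x => ∑ i, pd i (pd i f) x

/-- Flat divergence of a vector field. -/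
def divergence (v : E3 → Fin 3 → ℝ) : E3 → ℝ := fun x => ∑ i, pd i (fun y => v y i) x

/-- Smooth functions that tend to zero at infinity together with all their partial derivatives. -/
def Decays (f : E3 → ℝ) : Prop :=
  ContDiff ℝ ∞ f ∧
    ∀ l : List (Fin 3), Tendsto (l.foldr pd f) (cocompact E3) (𝓝 0)

/-- Kronecker delta. -/
def kron (a b : Fin 3) : ℝ := if a = b then 1 else 0

/-! ### The extended ADM phase space of gravity with a minimally coupled scalar field -/

/-- The coupling constants `κ`, `λ_φ` and the potential `V`. -/
structure Model where
  kappa : ℝ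
  lam : ℝ
  V : ℝ → ℝ

/-- A point of the extended ADM phase space (or a tangent vector to it, i.e. a perturbation):
spatial metric `q_ab` and its momentum `P^{ab}`, scalar field and its momentum, lapse, shift and
their momenta `Π`, `Π_a`.  The momenta are densities, written in Cartesian coordinates. -/
structure ADM where
  q : E3 → Mat3
  P : E3 → Mat3
  field : E3 → ℝ
  mom : E3 → ℝ
  N : E3 → ℝ
  Nv : E3 → Fin 3 → ℝ
  Pi : E3 → ℝ
  Piv : E3 → Fin 3 → ℝ

instance : Add ADM where
  add X Y :=
    { q := X.q + Y.q, P := X.P + Y.P, field := X.field + Y.field, mom := X.mom + Y.mom,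
      N := X.N + Y.N, Nv := X.Nv + Y.Nv, Pi := X.Pi + Y.Pi, Piv := X.Piv + Y.Piv }

instance : SMul ℝ ADM where
  smul c X :=
    { q := c • X.q, P := c • X.P, field := c • X.field, mom := c • X.mom,
      N := c • X.N, Nv := c • X.Nv, Pi := c • X.Pi, Piv := c • X.Piv }

/-- A lapse-type function and a shift-type vector field: smearing functions of the constraints
(descriptors), values of the four clocks, or Lagrange multipliers. -/
structure Descriptor where
  n : E3 → ℝ
  v : E3 → Fin 3 → ℝ

instance : Add Descriptor where
  add c d := { n := c.n + d.n, v := c.v + d.v }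

instance : SMul ℝ Descriptor where
  smul r d := { n := r • d.n, v := r • d.v }

instance : Inhabited Descriptor where
  default := { n := 0, v := 0 }

/-- Square root of the determinant of the metric. -/
def sqrtDet (q : E3 → Mat3) (x : E3) : ℝ := Real.sqrt (q x).det

/-- Christoffel symbols `Γ^c_{ab}`. -/
def christoffel (q : E3 → Mat3) (c a b : Fin 3) (x : E3) : ℝ :=
  (1 / 2) * ∑ d, (q x)⁻¹ c d *
    (pd a (fun y => q y b d) x + pd b (fun y => q y a d) x - pd d (fun y => q y a b) x)

/-- Ricci tensor `R_{ab}`. -/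
def ricci (q : E3 → Mat3) (x : E3) : Mat3 :=
  Matrix.of fun a b =>
    (∑ c, pd c (christoffel q c a b) x) - (∑ c, pd b (christoffel q c a c) x)
      + ∑ c, ∑ d, (christoffel q c c d x * christoffel q d a b x
          - christoffel q c b d x * christoffel q d a c x)

/-- Scalar curvature. -/
def scalarCurv (q : E3 → Mat3) (x : E3) : ℝ := ((q x)⁻¹ * ricci q x).trace

/-- Covariant Hessian `D_a D_b n`. -/
def covHess (q : E3 → Mat3) (n : E3 → ℝ) (x : E3) : Mat3 :=
  Matrix.of fun a b => pd a (pd b n) x - ∑ c, christoffel q c a b x * pd c n x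

/-- `q^{ab} ∂_b f`. -/
def gradUp (q : E3 → Mat3) (f : E3 → ℝ) (x : E3) (a : Fin 3) : ℝ :=
  ∑ b, (q x)⁻¹ a b * pd b f x

/-- `q^{ab} ∂_a f ∂_b f`. -/
def gradSq (q : E3 → Mat3) (f : E3 → ℝ) (x : E3) : ℝ := ∑ a, pd a f x * gradUp q f x a

/-- The trace `P = q_ab P^{ab}`. -/
def trP (X : ADM) (x : E3) : ℝ := (X.q x * X.P x).trace

/-- `P_{ab} P^{ab} - P²/2`. -/
def kinP (X : ADM) (x : E3) : ℝ :=
  (X.q x * X.P x * X.q x * X.P x).trace - (1 / 2) * trP X x ^ 2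

/-- The total Hamiltonian constraint
`(P_{ab}P^{ab} - P²/2)/√q - √q R + κ (λ_φ π²/(2√q) + √q (q^{ab}∂_aφ∂_bφ + V(φ))/(2λ_φ))`. -/
def hamC (M : Model) (X : ADM) (x : E3) : ℝ :=
  kinP X x / sqrtDet X.q x - sqrtDet X.q x * scalarCurv X.q x
    + M.kappa * (M.lam * X.mom x ^ 2 / (2 * sqrtDet X.q x)
        + sqrtDet X.q x * (gradSq X.q X.field x + M.V (X.field x)) / (2 * M.lam))

/-- The total spatial diffeomorphism constraint `-2 q_{ac} D_b P^{bc} + κ π ∂_a φ`, written out as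
`-2 ∂_b (q_{ac} P^{bc}) + P^{bc} ∂_a q_{bc} + κ π ∂_a φ`. -/
def diffC (M : Model) (X : ADM) (x : E3) (a : Fin 3) : ℝ :=
  -2 * (∑ b, pd b (fun y => ∑ c, X.q y a c * X.P y b c) x)
    + (∑ b, ∑ c, X.P x b c * pd a (fun y => X.q y b c) x)
    + M.kappa * X.mom x * pd a X.field x

/-- The Hamiltonian vector field of the smeared secondary constraints
`C[d] = κ⁻¹ ∫ (n C + v^a C_a)`, i.e. the Poisson brackets `{· , C[d]}` of the phase space
coordinates, where `{q_ab(x), P^{cd}(y)} = κ δ^c_(a δ^d_b) δ(x,y)` and `{φ(x), π(y)} = δ(x,y)`.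
These are the ADM evolution equations with lapse `n` and shift `v`:
* `{q_ab, C[d]} = (2n/√q)(P_ab - q_ab P/2) + (L_v q)_ab`,
* `{P^ab, C[d]} = (n/(2√q)) q^{ab} (P_cd P^cd - P²/2) - (2n/√q)(P^{ac}P_c^b - P P^{ab}/2)
    - n√q (R^{ab} - q^{ab}R/2) + √q (D^aD^b n - q^{ab} D²n)
    + κ n (q^{ab} λ_φ π²/(4√q) - √q q^{ab} ((∂φ)² + V)/(4λ_φ) + √q ∂^aφ ∂^bφ/(2λ_φ))
    + (L_v P)^{ab}`,
* `{φ, C[d]} = n λ_φ π/√q + v^a ∂_a φ`,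
* `{π, C[d]} = ∂_a (n √q q^{ab} ∂_b φ/λ_φ) - n √q V'(φ)/(2λ_φ) + ∂_a (v^a π)`. -/
def secVF (M : Model) (d : Descriptor) (X : ADM) : ADM where
  q x := Matrix.of fun a b =>
    2 * d.n x / sqrtDet X.q x * ((X.q x * X.P x * X.q x) a b - (1 / 2) * trP X x * X.q x a b)
      + ∑ c, (d.v x c * pd c (fun y => X.q y a b) x
          + X.q x c b * pd a (fun y => d.v y c) x + X.q x a c * pd b (fun y => d.v y c) x)
  P x := Matrix.of fun a b =>
    d.n x / (2 * sqrtDet X.q x) * kinP X x * (X.q x)⁻¹ a b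
      - 2 * d.n x / sqrtDet X.q x
          * ((X.P x * X.q x * X.P x) a b - (1 / 2) * trP X x * X.P x a b)
      - d.n x * sqrtDet X.q x
          * (((X.q x)⁻¹ * ricci X.q x * (X.q x)⁻¹) a b
              - (1 / 2) * scalarCurv X.q x * (X.q x)⁻¹ a b)
      + sqrtDet X.q x
          * (((X.q x)⁻¹ * covHess X.q d.n x * (X.q x)⁻¹) a b
              - ((X.q x)⁻¹ * covHess X.q d.n x).trace * (X.q x)⁻¹ a b)
      + M.kappa * d.n x
          * (M.lam * X.mom x ^ 2 / (4 * sqrtDet X.q x) * (X.q x)⁻¹ a b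
              - sqrtDet X.q x * (gradSq X.q X.field x + M.V (X.field x)) / (4 * M.lam)
                  * (X.q x)⁻¹ a b
              + sqrtDet X.q x / (2 * M.lam) * gradUp X.q X.field x a * gradUp X.q X.field x b)
      + ∑ c, (pd c (fun y => d.v y c * X.P y a b) x
          - X.P x c b * pd c (fun y => d.v y a) x - X.P x a c * pd c (fun y => d.v y b) x)
  field x := d.n x * M.lam * X.mom x / sqrtDet X.q x + ∑ a, d.v x a * pd a X.field x
  mom x :=
    (∑ a, pd a (fun y => d.n y * sqrtDet X.q y * gradUp X.q X.field y a / M.lam) x)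
      - d.n x * sqrtDet X.q x * deriv M.V (X.field x) / (2 * M.lam)
      + ∑ a, pd a (fun y => d.v y a * X.mom y) x
  N := 0
  Nv := 0
  Pi := 0
  Piv := 0

/-- The Hamiltonian vector field of the smeared primary constraints: it shifts lapse and shift. -/
def primVF (m : Descriptor) : ADM where
  q := 0
  P := 0
  field := 0
  mom := 0
  N := m.n
  Nv := m.v
  Pi := 0
  Piv := 0

/-- The Hamiltonian vector field of the canonical Hamiltonian
`∫ (N C + N^a C_a + λ Π + λ^a Π_a)`, with Lagrange multipliers `m = (λ, λ^a)`: lapse and shift are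
phase space variables with `Ṅ = λ`, `Ṅ^a = λ^a`, `Π̇ = -C`, `Π̇_a = -C_a`. -/
def canVF (M : Model) (m : Descriptor) (X : ADM) : ADM :=
  { secVF M ⟨X.N, X.Nv⟩ X with
    N := m.n
    Nv := m.v
    Pi := fun x => - hamC M X x
    Piv := fun x a => - diffC M X x a }

/-- `Y` has, at every point of space and in every component, time derivative `Y'` at `t`. -/
def HasTimeDeriv (Y : ℝ → ADM) (Y' : ADM) (t : ℝ) : Prop :=
  ∀ x : E3,
    (∀ a b, HasDerivAt (fun s => (Y s).q x a b) (Y'.q x a b) t) ∧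
    (∀ a b, HasDerivAt (fun s => (Y s).P x a b) (Y'.P x a b) t) ∧
    HasDerivAt (fun s => (Y s).field x) (Y'.field x) t ∧
    HasDerivAt (fun s => (Y s).mom x) (Y'.mom x) t ∧
    HasDerivAt (fun s => (Y s).N x) (Y'.N x) t ∧
    (∀ a, HasDerivAt (fun s => (Y s).Nv x a) (Y'.Nv x a) t) ∧
    HasDerivAt (fun s => (Y s).Pi x) (Y'.Pi x) t ∧
    (∀ a, HasDerivAt (fun s => (Y s).Piv x a) (Y'.Piv x a) t)

/-- Componentwise derivative at `0` of a one-parameter family. -/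
def derivZero (Y : ℝ → ADM) : ADM where
  q x := Matrix.of fun a b => deriv (fun r => (Y r).q x a b) 0
  P x := Matrix.of fun a b => deriv (fun r => (Y r).P x a b) 0
  field x := deriv (fun r => (Y r).field x) 0
  mom x := deriv (fun r => (Y r).mom x) 0
  N x := deriv (fun r => (Y r).N x) 0
  Nv x a := deriv (fun r => (Y r).Nv x a) 0
  Pi x := deriv (fun r => (Y r).Pi x) 0
  Piv x a := deriv (fun r => (Y r).Piv x a) 0

/-! ### The spatially flat FLRW background -/

/-- The background functions of time: `A = a²`, `P̃`, the lapse `N̄`, the scalar field and its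
momentum. -/
structure Background where
  A : ℝ → ℝ
  P : ℝ → ℝ
  N : ℝ → ℝ
  field : ℝ → ℝ
  mom : ℝ → ℝ

/-- The homogeneous, isotropic, spatially flat point of the extended phase space:
`q_ab = A δ_ab`, `P^{ab} = P̃ δ^{ab}`, lapse `N̄`, and vanishing shift, `Π`, `Π_a`. -/
def Background.adm (b : Background) (t : ℝ) : ADM where
  q _ := b.A t • (1 : Mat3)
  P _ := b.P t • (1 : Mat3)
  field _ := b.field t
  mom _ := b.mom t
  N _ := b.N t
  Nv := 0
  Pi := 0
  Piv := 0

/-- The background multiplier `λ̄ = dN̄/dt`, with vanishing spatial part. -/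
def Background.mult (b : Background) (t : ℝ) : Descriptor where
  n _ := deriv b.N t
  v := 0

/-- The background is a smooth exact solution, on the time domain `I`, of the canonical equations
and of all constraints, with nondegenerate metric, positive lapse and `dA/dt ≠ 0`. -/
structure Background.IsSolution (M : Model) (I : Set ℝ) (b : Background) : Prop where
  smooth_A : ContDiffOn ℝ ∞ b.A I
  smooth_P : ContDiffOn ℝ ∞ b.P I
  smooth_N : ContDiffOn ℝ ∞ b.N I
  smooth_field : ContDiffOn ℝ ∞ b.field I
  smooth_mom : ContDiffOn ℝ ∞ b.mom I
  A_pos : ∀ t ∈ I, 0 < b.A t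
  N_pos : ∀ t ∈ I, 0 < b.N t
  A_deriv_ne : ∀ t ∈ I, deriv b.A t ≠ 0
  evolution : ∀ t ∈ I, HasTimeDeriv b.adm (canVF M (b.mult t) (b.adm t)) t
  ham : ∀ t ∈ I, ∀ x, hamC M (b.adm t) x = 0
  diff : ∀ t ∈ I, ∀ x a, diffC M (b.adm t) x a = 0

/-- `H̃ = (1/2) Ȧ / A`. -/
def Background.hubble (b : Background) (t : ℝ) : ℝ := (1 / 2) * (deriv b.A t / b.A t)

/-- Pressure of the background scalar field. -/
def Background.pressure (M : Model) (b : Background) (t : ℝ) : ℝ :=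
  (1 / 2) * (M.lam / b.A t ^ 3 * b.mom t ^ 2 - 1 / M.lam * M.V (b.field t))

/-! ### Linearized theory -/

/-- The linearization of the canonical vector field at the background, applied to the perturbation
`Z` of the phase space point and the perturbation `m` of the multipliers. -/
def linVF (M : Model) (b : Background) (t : ℝ) (m : Descriptor) (Z : ADM) : ADM :=
  derivZero fun r => canVF M (b.mult t + r • m) (b.adm t + r • Z)

/-- The linearized Hamiltonian constraint `δC`. -/
def linHamC (M : Model) (b : Background) (t : ℝ) (Z : ADM) (x : E3) : ℝ :=
  deriv (fun r : ℝ => hamC M (b.adm t + r • Z) x) 0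

/-- The linearized diffeomorphism constraint `δC_a`. -/
def linDiffC (M : Model) (b : Background) (t : ℝ) (Z : ADM) (x : E3) (a : Fin 3) : ℝ :=
  deriv (fun r : ℝ => diffC M (b.adm t + r • Z) x a) 0

/-- A curve `Z` of perturbations solves, on `I`, the linearized canonical equations with
multipliers `m` and lies on the linearized constraint surface. -/
structure IsLinearSolution (M : Model) (b : Background) (I : Set ℝ) (m : ℝ → Descriptor)
    (Z : ℝ → ADM) : Prop where
  evolution : ∀ t ∈ I, HasTimeDeriv Z (linVF M b t (m t) (Z t)) t
  ham : ∀ t ∈ I, ∀ x, linHamC M b t (Z t) x = 0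
  diff : ∀ t ∈ I, ∀ x a, linDiffC M b t (Z t) x a = 0
  prim : ∀ t ∈ I, ∀ x, (Z t).Pi x = 0
  primv : ∀ t ∈ I, ∀ x a, (Z t).Piv x a = 0

/-! ### Scalar-vector-tensor decomposition -/

/-- The scalar, vector and tensor components of a perturbation at an instant of time;
`dfield`, `dmom` are the perturbations of the scalar field and of its momentum. -/
@[ext]
structure SVT where
  psi : E3 → ℝ
  E : E3 → ℝ
  F : E3 → Fin 3 → ℝ
  h : E3 → Mat3
  p_psi : E3 → ℝ
  p_E : E3 → ℝ
  p_F : E3 → Fin 3 → ℝ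
  p_h : E3 → Mat3
  phi : E3 → ℝ
  B : E3 → ℝ
  S : E3 → Fin 3 → ℝ
  p_phi : E3 → ℝ
  p_B : E3 → ℝ
  p_S : E3 → Fin 3 → ℝ
  dfield : E3 → ℝ
  dmom : E3 → ℝ

instance : Inhabited SVT where
  default := ⟨0, 0, 0, 0, 0, 0, 0, 0, 0, 0, 0, 0, 0, 0, 0, 0⟩

/-- A property holds for all real component functions. -/
def SVT.ForallComponents (R : (SVT → E3 → ℝ) → Prop) : Prop :=
  (R SVT.psi ∧ R SVT.E ∧ (∀ a, R fun X x => X.F x a) ∧ (∀ a b, R fun X x => X.h x a b)) ∧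
  (R SVT.p_psi ∧ R SVT.p_E ∧ (∀ a, R fun X x => X.p_F x a) ∧
    (∀ a b, R fun X x => X.p_h x a b)) ∧
  (R SVT.phi ∧ R SVT.B ∧ (∀ a, R fun X x => X.S x a)) ∧
  (R SVT.p_phi ∧ R SVT.p_B ∧ (∀ a, R fun X x => X.p_S x a)) ∧
  (R SVT.dfield ∧ R SVT.dmom)

/-- Symmetric, trace-free, divergence-free tensor fields. -/
def IsTT (h : E3 → Mat3) : Prop :=
  (∀ x, (h x).IsSymm) ∧ (∀ x, (h x).trace = 0) ∧ (∀ x a, ∑ c, pd c (fun y => h y c a) x = 0)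

/-- The vector components are divergence-free and the tensor components are TT. -/
def SVT.IsTransverse (X : SVT) : Prop :=
  (∀ x, divergence X.F x = 0) ∧ (∀ x, divergence X.p_F x = 0) ∧
  (∀ x, divergence X.S x = 0) ∧ (∀ x, divergence X.p_S x = 0) ∧ IsTT X.h ∧ IsTT X.p_h

/-- Transverse components, all of them smooth and decaying at infinity. -/
def SVT.IsAdmissible (X : SVT) : Prop :=
  X.IsTransverse ∧ SVT.ForallComponents fun c => Decays (c X)

/-- A curve of components that is transverse, smooth in time and space, and decays at spatial
infinity together with its time derivative. -/
def SVT.IsRegularCurve (I : Set ℝ) (X : ℝ → SVT) : Prop :=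
  (∀ t ∈ I, (X t).IsTransverse) ∧
  SVT.ForallComponents fun c =>
    ContDiffOn ℝ ∞ (fun p : ℝ × E3 => c (X p.1) p.2) (I ×ˢ Set.univ) ∧
    ∀ t ∈ I, Decays (c (X t)) ∧ Decays (fun x => deriv (fun s => c (X s) x) t)

/-- `ψ δ_ab + (∂_a∂_b - δ_ab Δ/3) E + ∂_(a F_b) + h_ab / 2`. -/
def svtTensor (psi E : E3 → ℝ) (F : E3 → Fin 3 → ℝ) (h : E3 → Mat3) (x : E3) : Mat3 :=
  Matrix.of fun a b =>
    psi x * kron a b + (pd a (pd b E) x - (1 / 3) * kron a b * lap E x)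
      + (1 / 2) * (pd b (fun y => F y a) x + pd a (fun y => F y b) x) + (1 / 2) * h x a b

/-- The perturbation with the given components:
`δq_ab = 2A(ψ δ_ab + E_{,<ab>} + F_{(a,b)} + h_ab/2)`,
`δP^{ab} = 2P̃(p_ψ δ^{ab} + p_E^{,<ab>} + p_F^{(a,b)} + p_h^{ab}/2)`,
`δN = N̄ φ`, `δN^a = B^{,a} + S^a`, `δΠ = N̄ p_φ`, `δΠ_a = p_{B,a} + p_{S a}`. -/
def assemble (b : Background) (t : ℝ) (X : SVT) : ADM where
  q x := (2 * b.A t) • svtTensor X.psi X.E X.F X.h x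
  P x := (2 * b.P t) • svtTensor X.p_psi X.p_E X.p_F X.p_h x
  field := X.dfield
  mom := X.dmom
  N x := b.N t * X.phi x
  Nv x a := pd a X.B x + X.S x a
  Pi x := b.N t * X.p_phi x
  Piv x a := pd a X.p_B x + X.p_S x a

/-- The (unique, where it exists) decomposition of a perturbation with decaying components. -/
def svt (b : Background) (t : ℝ) (Z : ADM) : SVT :=
  Classical.epsilon fun X : SVT => X.IsAdmissible ∧ assemble b t X = Z

/-! ### Geometrical clocks of the longitudinal gauge and the observable map -/

/-- The linearized clocks, as explicitly time dependent functions on the linearized phase space: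
`δT⁰ = 2 P̃ √A (E + p_E)`, `δT^a = δ^{ab}(E_{,b} + F_b)`. -/
def clock (b : Background) (t : ℝ) (Z : ADM) : Descriptor where
  n x := 2 * b.P t * Real.sqrt (b.A t) * ((svt b t Z).E x + (svt b t Z).p_E x)
  v x a := pd a (svt b t Z).E x + (svt b t Z).F x a

/-- `δṪ^μ = ∂_t δT^μ + {δT^μ, H_can}` to linear order, as a function on the linearized phase space.
The clocks do not involve lapse and shift, so the multipliers do not contribute. -/
def clockDot (M : Model) (b : Background) (t : ℝ) (Z : ADM) : Descriptor where
  n x := deriv (fun s => (clock b s Z).n x) t + (clock b t (linVF M b t default Z)).n x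
  v x a := deriv (fun s => (clock b s Z).v x a) t + (clock b t (linVF M b t default Z)).v x a

/-- Smooth decaying descriptors whose vector part has a decomposition into a gradient and a
divergence-free field, both decaying. -/
def Descriptor.IsAdmissible (d : Descriptor) : Prop :=
  Decays d.n ∧ ∃ (u : E3 → ℝ) (w : E3 → Fin 3 → ℝ),
    Decays u ∧ (∀ a, Decays fun x => w x a) ∧ (∀ x, divergence w x = 0) ∧
      ∀ x a, d.v x a = pd a u x + w x a

/-- The operator with kernel `A^μ_ν(x,y) = {T^μ(x), C_ν(y)}` at the background:
`β ↦ ∫ A^μ_ν(x,y) β^ν(y) d³y`, the bracket of the clocks with the smeared constraints. -/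
def clockMatrix (M : Model) (b : Background) (t : ℝ) (β : Descriptor) : Descriptor :=
  clock b t (secVF M β (b.adm t))

/-- The inverse `B` of the operator `A`. -/
def clockMatrixInv (M : Model) (b : Background) (t : ℝ) (d : Descriptor) : Descriptor :=
  Classical.epsilon fun β : Descriptor => β.IsAdmissible ∧ clockMatrix M b t β = d

/-- The linearized observable map for the gauge fixing conditions `G^μ = -T^μ`, applied to all
phase space variables at once:
`δO_f = δf + {f, C_ν}(B δG)^ν + {f, Π_ν} (B (δĠ - {Ṫ, C_ρ} (B δG)^ρ))^ν`,
with brackets evaluated at the background (products stand for sums and integrals). -/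
def observable (M : Model) (b : Background) (t : ℝ) (Z : ADM) : ADM :=
  let β := clockMatrixInv M b t ((-1 : ℝ) • clock b t Z)
  let Y := secVF M β (b.adm t)
  let μ := clockMatrixInv M b t
    ((-1 : ℝ) • clockDot M b t Z + (-1 : ℝ) • clockDot M b t Y)
  Z + Y + primVF μ

/-- The observables of all scalar, vector and tensor components along a curve of perturbations. -/
def obs (M : Model) (b : Background) (X : ℝ → SVT) (t : ℝ) : SVT :=
  svt b t (observable M b t (assemble b t (X t)))

/-! ### Gauge invariant variables -/

/-- The Bardeen potential `Ψ = ψ + (4H̃²A/N̄²)(E + p_E) - ΔE/3`. -/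
def bardeen (b : Background) (X : ℝ → SVT) (t : ℝ) (x : E3) : ℝ :=
  (X t).psi x + 4 * b.hubble t ^ 2 * b.A t / b.N t ^ 2 * ((X t).E x + (X t).p_E x)
    - (1 / 3) * lap (X t).E x

/-- `Υ = p_ψ + ΔE/2 + (2/3)Δp_E - (H̃²A/N̄² + κAp/2)(E + p_E)`. -/
def upsilon (M : Model) (b : Background) (X : ℝ → SVT) (t : ℝ) (x : E3) : ℝ :=
  (X t).p_psi x + (1 / 2) * lap (X t).E x + (2 / 3) * lap (X t).p_E x
    - (b.hubble t ^ 2 * b.A t / b.N t ^ 2 + M.kappa * b.A t / 2 * b.pressure M t)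
        * ((X t).E x + (X t).p_E x)

/-- `ν^a = p_F^a + δ^{ab} F_b`. -/
def nu (X : ℝ → SVT) (t : ℝ) (x : E3) (a : Fin 3) : ℝ := (X t).p_F x a + (X t).F x a

/-- `ϝ = (10 H̃² + κ N̄² p) / (4 H̃)`. -/
def digamma (M : Model) (b : Background) (t : ℝ) : ℝ :=
  (10 * b.hubble t ^ 2 + M.kappa * b.N t ^ 2 * b.pressure M t) / (4 * b.hubble t)

/-- The linear function
`δT̃ = -3 λ_φ π̄²/A³ ψ + λ_φ π̄/A³ δπ - V'(φ̄)/(2λ_φ) δφ` of the components. -/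
def deltaT (M : Model) (b : Background) (t : ℝ) (Y : SVT) (x : E3) : ℝ :=
  -3 * M.lam * b.mom t ^ 2 / b.A t ^ 3 * Y.psi x + M.lam * b.mom t / b.A t ^ 3 * Y.dmom x
    - 1 / (2 * M.lam) * deriv M.V (b.field t) * Y.dfield x

/-- The observables of the longitudinal clocks, component by component, at time `t`. -/
structure LongitudinalObservables (M : Model) (b : Background) (X : ℝ → SVT) (t : ℝ) :
    Prop where
  psi : ∀ x, (obs M b X t).psi x = bardeen b X t x
  E : ∀ x, (obs M b X t).E x = 0
  F : ∀ x a, (obs M b X t).F x a = 0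
  p_psi : ∀ x, (obs M b X t).p_psi x = upsilon M b X t x
  p_E : ∀ x, (obs M b X t).p_E x = 0
  p_F : ∀ x a, (obs M b X t).p_F x a = nu X t x a
  phi : ∀ x, (obs M b X t).phi x = - bardeen b X t x
  B : ∀ x, (obs M b X t).B x = 0
  S : ∀ x a, (obs M b X t).S x a = 4 * b.hubble t * nu X t x a
  p_phi : ∀ x, (obs M b X t).p_phi x = (X t).p_phi x
  p_B : ∀ x, (obs M b X t).p_B x = (X t).p_B x
  p_S : ∀ x a, (obs M b X t).p_S x a = (X t).p_S x a

/-- Hamilton's equations for the observables of the longitudinal gauge at time `t`. -/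
structure LongitudinalHamilton (M : Model) (b : Background) (X : ℝ → SVT) (t : ℝ) : Prop where
  psi : ∀ x, HasDerivAt (fun s => (obs M b X s).psi x)
    (2 * b.hubble t * (upsilon M b X t x - bardeen b X t x)) t
  E : ∀ x, HasDerivAt (fun s => (obs M b X s).E x) 0 t
  p_psi : ∀ x, HasDerivAt (fun s => (obs M b X s).p_psi x)
    ((- b.hubble t / 2 + M.kappa / 4 * (b.N t ^ 2 * b.pressure M t / b.hubble t))
        * upsilon M b X t x
      + b.hubble t / 2 * bardeen b X t x
      - M.kappa / 8 * (b.N t ^ 2 / b.hubble t) * deltaT M b t (obs M b X t) x) t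
  p_E : ∀ x, HasDerivAt (fun s => (obs M b X s).p_E x) 0 t
  F : ∀ x a, HasDerivAt (fun s => (obs M b X s).F x a) 0 t
  p_F : ∀ x a, HasDerivAt (fun s => (obs M b X s).p_F x a)
    ((digamma M b t - 4 * b.hubble t) * nu X t x a) t
  phi : ∀ x, HasDerivAt (fun s => (obs M b X s).phi x)
    (2 * b.hubble t * (bardeen b X t x - upsilon M b X t x)) t
  B : ∀ x, HasDerivAt (fun s => (obs M b X s).B x) 0 t
  S : ∀ x a, HasDerivAt (fun s => (obs M b X s).S x a)
    ((4 * deriv b.hubble t - 16 * b.hubble t ^ 2 + 4 * digamma M b t * b.hubble t)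
      * nu X t x a) t
  p_phi : ∀ x, HasDerivAt (fun s => (obs M b X s).p_phi x) 0 t
  p_B : ∀ x, HasDerivAt (fun s => (obs M b X s).p_B x) 0 t
  p_S : ∀ x a, HasDerivAt (fun s => (obs M b X s).p_S x a) 0 t
  dfield : ∀ x, HasDerivAt (fun s => (obs M b X s).dfield x)
    (b.N t * (M.lam / Real.sqrt (b.A t) ^ 3)
      * (-4 * b.mom t * bardeen b X t x + (obs M b X t).dmom x)) t
  dmom : ∀ x, HasDerivAt (fun s => (obs M b X s).dmom x)
    (- (b.N t * (Real.sqrt (b.A t) ^ 3 / M.lam))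
      * (deriv M.V (b.field t) * bardeen b X t x
          - 1 / b.A t * lap (obs M b X t).dfield x
          + (1 / 2) * deriv (deriv M.V) (b.field t) * (obs M b X t).dfield x)) t

end Cosmo

end

noncomputable section

namespace Cosmo

/-! ### Calculus of functions that are jointly smooth in a parameter and in space -/

/-! Everything reduces to computations with decaying modes. On smooth functions vanishing at
infinity with all derivatives the Laplacian is injective, by the maximum principle
(`nonpos_of_Lap_eq_zero`). Hence the scalar, vector and tensor parts of a decaying tensor field are
unique (`TensorModes.tensor_injective`), the value picked by `Classical.epsilon` in `svt` is the
given decomposition (`Modes.svt_assemble`), and an identity between tensor fields can be read mode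
by mode.

The constraints and the canonical vector field are expanded to first order around the flat
background (`hasDerivAt_hamC`, `hasDerivAt_diffC`, `linVF_assemble`). Homogeneity and isotropy keep
the modes decoupled, and the scalar curvature sees only ψ - ΔE/3.

The constraints smeared with (n, ∂u + w) shift E by u, F by w and E + p_E by n/(2√A P̃). The clocks
are exactly the combinations for which this shift reads (n, ∂u + w), so 𝒜 and its inverse ℬ act as
the identity (`clockMatrix_descriptor`). The observable map is thus explicit (`obsModes`,
`observable_assemble`): a gauge transformation sets E, p_E and F to zero, then lapse and shift are
changed so that the rates of the clocks vanish as well. In the longitudinal gauge the rate of δT⁰ is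
N̄(Ψ + φ), which forces φ = -Ψ; the rate of δT^a is B^{,a} + S^a + (2N̄P̃/√A)ν^a, which forces B = 0
and S = 4H̃ν because H̃ = -N̄P̃/(2√A). This gives (i) without any linearized equation.

For (ii) the explicit formulas are differentiated along a linear solution. The gauge dependent φ, B,
S cancel, and the background equations supply the derivatives of the coefficients. Only the momenta
of lapse and shift need constraints, namely the primary ones.

For (iii), Ψ̇ = 2H̃(Υ - Ψ) is differentiated again, and the matter observables in Υ̇ are eliminated
by the linearized constraints. These hold for the observables too, since a gauge transformation
changes them by multiples of the background Hamiltonian constraint (`diffScalar_obsModes`,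
`hamModes_obsModes`). The Hamiltonian constraint brings in ΔΨ; solving the diffeomorphism constraint
for δφ divides by π̄, which is where φ̄' ≠ 0 enters. Claim (iv) is then substitution of N̄ = √A and
the background equations. -/

theorem two_le_infty : (2 : WithTop ℕ∞) ≤ ∞ := by
  exact WithTop.coe_le_coe.2 (le_top : (2 : ℕ∞) ≤ ⊤)

/-- `G` is jointly smooth in the parameter and in space near `(t, x)`. -/
def JointSmoothAt (t : ℝ) (x : E3) (G : ℝ → E3 → ℝ) : Prop :=
  ContDiffAt ℝ ∞ (fun p : ℝ × E3 => G p.1 p.2) (t, x)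

namespace JointSmoothAt

variable {t : ℝ} {x : E3} {G H : ℝ → E3 → ℝ}

theorem const (c : ℝ) : JointSmoothAt t x fun _ _ => c := contDiffAt_const

theorem param {f : ℝ → ℝ} (hf : ContDiffAt ℝ ∞ f t) : JointSmoothAt t x fun s _ => f s :=
  ContDiffAt.comp (f := Prod.fst) (t, x) hf contDiffAt_fst

theorem space {f : E3 → ℝ} (hf : ContDiff ℝ ∞ f) : JointSmoothAt t x fun _ y => f y :=
  (hf.comp contDiff_snd).contDiffAt

theorem add (hG : JointSmoothAt t x G) (hH : JointSmoothAt t x H) :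
    JointSmoothAt t x fun s y => G s y + H s y := ContDiffAt.add hG hH

theorem sub (hG : JointSmoothAt t x G) (hH : JointSmoothAt t x H) :
    JointSmoothAt t x fun s y => G s y - H s y := ContDiffAt.sub hG hH

theorem mul (hG : JointSmoothAt t x G) (hH : JointSmoothAt t x H) :
    JointSmoothAt t x fun s y => G s y * H s y := ContDiffAt.mul hG hH

theorem inv (hG : JointSmoothAt t x G) (h0 : G t x ≠ 0) :
    JointSmoothAt t x fun s y => (G s y)⁻¹ := ContDiffAt.inv hG h0

theorem div_const (hG : JointSmoothAt t x G) (c : ℝ) :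
    JointSmoothAt t x fun s y => G s y / c := ContDiffAt.div_const hG c

theorem sqrt (hG : JointSmoothAt t x G) (h0 : G t x ≠ 0) :
    JointSmoothAt t x fun s y => Real.sqrt (G s y) := ContDiffAt.sqrt hG h0

theorem sum {ι : Type*} {s : Finset ι} {G : ι → ℝ → E3 → ℝ}
    (hG : ∀ i ∈ s, JointSmoothAt t x (G i)) :
    JointSmoothAt t x fun r y => ∑ i ∈ s, G i r y := ContDiffAt.sum hG

theorem eventually_contDiffAt (hG : JointSmoothAt t x G) :
    ∀ᶠ p in 𝓝 (t, x), ContDiffAt ℝ 1 (fun p : ℝ × E3 => G p.1 p.2) p :=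
  (ContDiffAt.of_le (n := ∞) hG (by exact_mod_cast le_top)).eventually (by simp)

theorem pd_eq {p : ℝ × E3} (h : ContDiffAt ℝ 1 (fun p : ℝ × E3 => G p.1 p.2) p) (e : Fin 3) :
    pd e (G p.1) p.2
      = fderiv ℝ (fun p : ℝ × E3 => G p.1 p.2) p (0, EuclideanSpace.single e 1) := by
  have h1 : HasFDerivAt (fun p : ℝ × E3 => G p.1 p.2) _ (p.1, p.2) :=
    (h.differentiableAt (by simp)).hasFDerivAt
  have h2 := h1.comp p.2 (hasFDerivAt_prodMk_right (𝕜 := ℝ) p.1 p.2)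
  have h3 : HasFDerivAt (G p.1) _ p.2 := h2
  simp [Cosmo.pd, h3.fderiv]

theorem hasDerivAt_of_contDiffAt {p : ℝ × E3}
    (h : ContDiffAt ℝ 1 (fun p : ℝ × E3 => G p.1 p.2) p) :
    HasDerivAt (fun s => G s p.2)
      (fderiv ℝ (fun p : ℝ × E3 => G p.1 p.2) p (1, 0)) p.1 := by
  have h1 : HasFDerivAt (fun p : ℝ × E3 => G p.1 p.2) _ (p.1, p.2) :=
    (h.differentiableAt (by simp)).hasFDerivAt
  have h2 := h1.comp p.1 (hasFDerivAt_prodMk_left (𝕜 := ℝ) p.1 p.2)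
  have h3 : HasFDerivAt (fun s => G s p.2) _ p.1 := h2
  simpa using h3.hasDerivAt

theorem differentiableAt (hG : JointSmoothAt t x G) : DifferentiableAt ℝ (fun s => G s x) t :=
  (hasDerivAt_of_contDiffAt hG.eventually_contDiffAt.self_of_nhds).differentiableAt

theorem hasDerivAt (hG : JointSmoothAt t x G) :
    HasDerivAt (fun s => G s x) (deriv (fun s => G s x) t) t := hG.differentiableAt.hasDerivAt

theorem pd (hG : JointSmoothAt t x G) (e : Fin 3) :
    JointSmoothAt t x fun s => Cosmo.pd e (G s) := by
  have h1 : ContDiffAt ℝ ∞ (fun p : ℝ × E3 =>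
      fderiv ℝ (fun p : ℝ × E3 => G p.1 p.2) p (0, EuclideanSpace.single e 1)) (t, x) :=
    (ContDiffAt.fderiv_right (n := ∞) hG (by simp)).clm_apply contDiffAt_const
  refine h1.congr_of_eventuallyEq ?_
  filter_upwards [hG.eventually_contDiffAt] with p hp using pd_eq hp e

/-- Space derivatives commute with the derivative along the parameter. -/
theorem hasDerivAt_pd (hG : JointSmoothAt t x G) (e : Fin 3) :
    HasDerivAt (fun s => Cosmo.pd e (G s) x)
      (Cosmo.pd e (fun y => deriv (fun s => G s y) t) x) t := by
  set g : ℝ × E3 → ℝ := fun p => G p.1 p.2 with hg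
  have hd : DifferentiableAt ℝ (fderiv ℝ g) (t, x) :=
    (ContDiffAt.fderiv_right (m := ∞) (n := ∞) hG (by simp)).differentiableAt (by simp)
  -- Symmetry of the second derivative of `g` on parameter times space is what exchanges ∂_e with
  -- the parameter derivative.
  have hsymm : IsSymmSndFDerivAt ℝ g (t, x) :=
    ContDiffAt.isSymmSndFDerivAt (n := ∞) hG (by simpa using two_le_infty)
  have h1 : HasDerivAt (fun s => fderiv ℝ g (s, x) (0, EuclideanSpace.single e 1))
      (fderiv ℝ (fderiv ℝ g) (t, x) (1, 0) (0, EuclideanSpace.single e 1)) t := by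
    have h2 := hd.hasFDerivAt.comp t (hasFDerivAt_prodMk_left (𝕜 := ℝ) t x)
    have h3 := h2.clm_apply (hasFDerivAt_const
      ((0, EuclideanSpace.single e 1) : ℝ × E3) t)
    simpa using h3.hasDerivAt
  have h4 : Cosmo.pd e (fun y => deriv (fun s => G s y) t) x
      = fderiv ℝ (fderiv ℝ g) (t, x) (0, EuclideanSpace.single e 1) (1, 0) := by
    have h5 : HasFDerivAt (fun y => fderiv ℝ g (t, y) (1, 0)) _ x :=
      (hd.hasFDerivAt.comp x (hasFDerivAt_prodMk_right (𝕜 := ℝ) t x)).clm_apply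
        (hasFDerivAt_const ((1, 0) : ℝ × E3) x)
    have h6 : (fun y => deriv (fun s => G s y) t) =ᶠ[𝓝 x] fun y => fderiv ℝ g (t, y) (1, 0) := by
      have : Tendsto (fun y : E3 => (t, y)) (𝓝 x) (𝓝 (t, x)) :=
        (Continuous.prodMk_right t).tendsto x
      filter_upwards [this.eventually hG.eventually_contDiffAt] with y hy
      exact (hasDerivAt_of_contDiffAt hy).deriv
    rw [Cosmo.pd, h6.fderiv_eq, h5.fderiv]
    simp
  rw [h4, hsymm.eq]
  refine h1.congr_of_eventuallyEq ?_
  have : Tendsto (fun s : ℝ => (s, x)) (𝓝 t) (𝓝 (t, x)) :=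
    (Continuous.prodMk_left x).tendsto t
  filter_upwards [this.eventually hG.eventually_contDiffAt] with s hs
  exact pd_eq hs e

end JointSmoothAt

/-! ### Partial derivatives of smooth functions -/

theorem contDiff_pd {f : E3 → ℝ} (hf : ContDiff ℝ ∞ f) (i : Fin 3) : ContDiff ℝ ∞ (pd i f) :=
  (hf.fderiv_right (m := ∞) (by simp)).clm_apply contDiff_const

theorem pd_comm {f : E3 → ℝ} (hf : ContDiff ℝ ∞ f) (i j : Fin 3) :
    pd i (pd j f) = pd j (pd i f) := by
  have key : ∀ (i j : Fin 3) (x : E3), pd i (pd j f) x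
      = fderiv ℝ (fderiv ℝ f) x (EuclideanSpace.single i 1) (EuclideanSpace.single j 1) := by
    intro i j x
    have hd : DifferentiableAt ℝ (fderiv ℝ f) x :=
      (hf.fderiv_right (m := ∞) (by simp)).contDiffAt.differentiableAt (by simp)
    have h := hd.hasFDerivAt.clm_apply (hasFDerivAt_const (EuclideanSpace.single j (1 : ℝ)) x)
    have h' : HasFDerivAt (pd j f) _ x := h
    rw [pd, h'.fderiv]
    simp
  funext x
  rw [key, key, (hf.contDiffAt.isSymmSndFDerivAt (n := ∞) (by simpa using two_le_infty)).eq]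

theorem pd_const (i : Fin 3) (c : ℝ) : pd i (fun _ => c) = 0 := by
  funext x; simp [pd]

theorem pd_add {f g : E3 → ℝ} (hf : ContDiff ℝ ∞ f) (hg : ContDiff ℝ ∞ g) (i : Fin 3) :
    pd i (f + g) = pd i f + pd i g := by
  funext x
  simp [pd, fderiv_add (hf.differentiable (by simp) x) (hg.differentiable (by simp) x)]

theorem pd_smul {f : E3 → ℝ} (hf : ContDiff ℝ ∞ f) (c : ℝ) (i : Fin 3) :
    pd i (c • f) = c • pd i f := by
  funext x
  simp [pd, fderiv_const_smul (hf.differentiable (by simp) x)]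

theorem hasDerivAt_line {f : E3 → ℝ} (hf : ContDiff ℝ ∞ f) (y : E3) (i : Fin 3) (s : ℝ) :
    HasDerivAt (fun s : ℝ => f (y + s • EuclideanSpace.single i 1))
      (pd i f (y + s • EuclideanSpace.single i 1)) s := by
  have h1 : HasDerivAt (fun s : ℝ => y + s • (EuclideanSpace.single i 1 : E3))
      (EuclideanSpace.single i 1) s := by
    simpa using ((hasDerivAt_id s).smul_const (EuclideanSpace.single i 1 : E3)).const_add y
  exact ((hf.differentiable (by simp) _).hasFDerivAt).comp_hasDerivAt s h1

/-- A positive second derivative along the line would make the point a local minimum as well, hence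
the restriction locally constant and its second derivative zero. -/
theorem pd_pd_nonpos_of_isLocalMax {g : E3 → ℝ} (hg : ContDiff ℝ ∞ g) {y : E3}
    (hy : IsLocalMax g y) (i : Fin 3) : pd i (pd i g) y ≤ 0 := by
  by_contra! hpos
  set c : ℝ → E3 := fun s => y + s • EuclideanSpace.single i 1 with hc
  have hcc : Continuous c := by fun_prop
  have hc0 : c 0 = y := by simp [hc]
  have hd : deriv (fun s => g (c s)) = fun s => pd i g (c s) :=
    funext fun s => (hasDerivAt_line hg y i s).deriv
  have hdd : deriv (deriv fun s => g (c s)) 0 = pd i (pd i g) y := by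
    rw [hd, (hasDerivAt_line (contDiff_pd hg i) y i 0).deriv]
    simp
  have hmax : IsLocalMax (fun s => g (c s)) 0 := by
    have := (hcc.tendsto 0)
    rw [hc0] at this
    have h := this.eventually hy
    simpa [IsLocalMax, IsMaxFilter, hc0] using h
  have hmin : IsLocalMin (fun s => g (c s)) 0 :=
    isLocalMin_of_deriv_deriv_pos (by rw [hdd]; exact hpos) hmax.deriv_eq_zero
      (hg.continuous.comp hcc).continuousAt
  have hconst : (fun s => g (c s)) =ᶠ[𝓝 0] fun _ => g (c 0) := by
    filter_upwards [hmax, hmin] with s h1 h2 using le_antisymm h1 h2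
  have : deriv (deriv fun s => g (c s)) 0 = 0 := by
    rw [hconst.deriv.deriv_eq]
    simp
  linarith

/-! ### Smooth decaying functions -/

theorem Decays.pd {f : E3 → ℝ} (hf : Decays f) (i : Fin 3) : Decays (pd i f) :=
  ⟨contDiff_pd hf.1 i, fun l => by simpa using hf.2 (l ++ [i])⟩

theorem Decays.add {f g : E3 → ℝ} (hf : Decays f) (hg : Decays g) : Decays (f + g) := by
  refine ⟨hf.1.add hg.1, fun l => ?_⟩
  have key : ContDiff ℝ ∞ (l.foldr Cosmo.pd f) ∧ ContDiff ℝ ∞ (l.foldr Cosmo.pd g) ∧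
      l.foldr Cosmo.pd (f + g) = l.foldr Cosmo.pd f + l.foldr Cosmo.pd g := by
    induction l with
    | nil => exact ⟨hf.1, hg.1, rfl⟩
    | cons i l ih =>
      simp only [List.foldr_cons]
      exact ⟨contDiff_pd ih.1 i, contDiff_pd ih.2.1 i, by rw [ih.2.2, pd_add ih.1 ih.2.1]⟩
  rw [key.2.2]
  have := (hf.2 l).add (hg.2 l)
  rwa [add_zero] at this

theorem Decays.smul {f : E3 → ℝ} (hf : Decays f) (c : ℝ) : Decays (c • f) := by
  refine ⟨contDiff_const.smul hf.1, fun l => ?_⟩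
  have key : ContDiff ℝ ∞ (l.foldr Cosmo.pd f) ∧
      l.foldr Cosmo.pd (c • f) = c • l.foldr Cosmo.pd f := by
    induction l with
    | nil => exact ⟨hf.1, rfl⟩
    | cons i l ih =>
      simp only [List.foldr_cons]
      exact ⟨contDiff_pd ih.1 i, by rw [ih.2, pd_smul ih.1]⟩
  rw [key.2]
  have := (hf.2 l).const_smul c
  rwa [smul_zero] at this

theorem Decays.zero : Decays 0 := by
  refine ⟨contDiff_const, fun l => ?_⟩
  have : l.foldr Cosmo.pd (0 : E3 → ℝ) = 0 := by
    induction l with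
    | nil => rfl
    | cons i l ih => rw [List.foldr_cons, ih]; exact pd_const i 0
  rw [this]
  exact tendsto_const_nhds

/-- The space of smooth functions that decay with all their derivatives. -/
def DecaySpace : Submodule ℝ (E3 → ℝ) where
  carrier := {f | Decays f}
  add_mem' := Decays.add
  zero_mem' := Decays.zero
  smul_mem' c _ hf := Decays.smul hf c

instance : CoeFun DecaySpace fun _ => E3 → ℝ := ⟨fun f => f.1⟩

namespace DecaySpace

theorem contDiff (f : DecaySpace) : ContDiff ℝ ∞ f.1 := f.2.1

@[simp] theorem coe_add_apply (f g : DecaySpace) (x : E3) : (f + g).1 x = f x + g x := rfl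
@[simp] theorem coe_sub_apply (f g : DecaySpace) (x : E3) : (f - g).1 x = f x - g x := rfl
@[simp] theorem coe_neg_apply (f : DecaySpace) (x : E3) : (-f).1 x = - f x := rfl
@[simp] theorem coe_smul_apply (c : ℝ) (f : DecaySpace) (x : E3) : (c • f).1 x = c * f x := rfl
@[simp] theorem coe_zero_apply (x : E3) : (0 : DecaySpace).1 x = 0 := rfl

theorem ext_apply {f g : DecaySpace} (h : ∀ x, f x = g x) : f = g := Subtype.ext (funext h)

/-- The partial derivative as a linear operator. -/
def D (i : Fin 3) : DecaySpace →ₗ[ℝ] DecaySpace where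
  toFun f := ⟨pd i f, f.2.pd i⟩
  map_add' f g := Subtype.ext (pd_add f.2.1 g.2.1 i)
  map_smul' c f := Subtype.ext (pd_smul f.2.1 c i)

theorem pd_coe (i : Fin 3) (f : DecaySpace) : pd i f.1 = (D i f).1 := rfl

theorem D_comm (i j : Fin 3) (f : DecaySpace) : D i (D j f) = D j (D i f) :=
  Subtype.ext (pd_comm f.2.1 i j)

/-- The Laplacian as a linear operator. -/
def Lap : DecaySpace →ₗ[ℝ] DecaySpace := ∑ i, D i ∘ₗ D i

theorem Lap_eq (f : DecaySpace) : Lap f = D 0 (D 0 f) + D 1 (D 1 f) + D 2 (D 2 f) := by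
  simp [Lap, Fin.sum_univ_three]

theorem lap_coe (f : DecaySpace) : lap f.1 = (Lap f).1 := by
  funext x
  simp [lap, Lap_eq, Fin.sum_univ_three, pd_coe]

theorem D_Lap (i : Fin 3) (f : DecaySpace) : D i (Lap f) = Lap (D i f) := by
  simp only [Lap_eq, map_add, D_comm i]

/-- Maximum principle: a positive value of a decaying harmonic function survives, after adding a
small multiple of |y|², as an interior maximum at which the Laplacian is strictly positive. -/
theorem nonpos_of_Lap_eq_zero {f : DecaySpace} (hf : Lap f = 0) (x : E3) : f x ≤ 0 := by
  by_contra! hx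
  set c := f x with hc
  have hev : ∀ᶠ y in cocompact E3, f y < c / 2 := by
    have := f.2.2 []
    exact this.eventually (gt_mem_nhds (by simpa using half_pos hx))
  obtain ⟨K, hK, hKf⟩ := Filter.mem_cocompact.1 hev
  obtain ⟨R, hR⟩ := (hK.isBounded.insert x).subset_ball_lt 0 0
  obtain ⟨hR0, hR⟩ := hR
  have hxR : x ∈ Metric.ball (0 : E3) R := hR (Set.mem_insert _ _)
  -- Chosen so that ε|y|² ≤ c/4 on the ball. Outside `K` the perturbed function then stays below c/2
  -- + c/4 < c, so its maximum lies inside the ball.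
  set ε := c / (4 * R ^ 2) with hε
  have hεpos : 0 < ε := by positivity
  set n : E3 → ℝ := fun y => ∑ i, y i ^ 2 with hn
  have hproj : ∀ i : Fin 3, ContDiff ℝ ∞ fun y : E3 => y i := fun i => by fun_prop
  have hnsm : ContDiff ℝ ∞ n := by
    simp only [hn]; exact ContDiff.sum fun i _ => (hproj i).pow 2
  set g : E3 → ℝ := f.1 + ε • n with hg
  have hgsm : ContDiff ℝ ∞ g := (contDiff f).add (contDiff_const.smul hnsm)
  obtain ⟨y, hyB, hymax⟩ := (isCompact_closedBall (0 : E3) R).exists_isMaxOn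
    ⟨0, by simp [hR0.le]⟩ hgsm.continuous.continuousOn
  have hnn : ∀ z : E3, n z = ‖z‖ ^ 2 := fun z => (EuclideanSpace.real_norm_sq_eq z).symm
  have hgy : c ≤ g y := by
    have h1 : g x ≤ g y := hymax (Metric.ball_subset_closedBall hxR)
    have h2 : c ≤ g x := by
      have : 0 ≤ ε * n x := by rw [hnn]; positivity
      simp only [hg, Pi.add_apply, Pi.smul_apply, smul_eq_mul]
      linarith
    linarith
  have hyR : y ∈ Metric.ball (0 : E3) R := by
    by_contra hy
    have hyK : y ∉ K := fun h => hy (hR (Set.mem_insert_of_mem _ h))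
    have h1 : f y < c / 2 := hKf hyK
    have h2 : n y ≤ R ^ 2 := by
      rw [hnn]
      have : ‖y‖ ≤ R := by simpa using hyB
      gcongr
    have h3 : ε * n y ≤ c / 4 := by
      calc ε * n y ≤ ε * R ^ 2 := by gcongr
        _ = c / 4 := by rw [hε]; field_simp
    have h4 : g y = f y + ε * n y := rfl
    linarith
  have hloc : IsLocalMax g y := by
    filter_upwards [Metric.isOpen_ball.mem_nhds hyR] with z hz
    exact hymax (Metric.ball_subset_closedBall hz)
  have hpn : ∀ i : Fin 3, pd i n = fun y => 2 * y i := by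
    intro i
    funext z
    have h := (hasDerivAt_line hnsm z i 0).deriv
    simp only [zero_smul, add_zero] at h
    rw [← h]
    have : (fun s : ℝ => n (z + s • EuclideanSpace.single i 1))
        = fun s => n z + 2 * s * z i + s ^ 2 := by
      funext s
      fin_cases i <;> simp [hn, Fin.sum_univ_three] <;> ring
    rw [this]
    have h' : HasDerivAt (fun s : ℝ => n z + 2 * s * z i + s ^ 2) (2 * z i) 0 := by
      have := ((((hasDerivAt_id (0 : ℝ)).const_mul 2).mul_const (z i)).const_add (n z)).fun_add
        ((hasDerivAt_id (0 : ℝ)).fun_pow 2)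
      simpa using this
    exact h'.deriv
  have hppn : ∀ i : Fin 3, pd i (pd i n) = fun _ => 2 := by
    intro i
    funext z
    rw [hpn i]
    have h := (hasDerivAt_line (contDiff_const.mul (hproj i) : ContDiff ℝ ∞ fun y : E3 => 2 * y i)
      z i 0).deriv
    simp only [zero_smul, add_zero] at h
    rw [← h]
    have h' : HasDerivAt (fun s : ℝ => 2 * (z + s • EuclideanSpace.single i (1 : ℝ) : E3) i)
        2 0 := by
      have := ((hasDerivAt_id (0 : ℝ)).const_add (z i)).const_mul 2
      simpa using this
    exact h'.deriv
  have hppg : ∀ i, pd i (pd i g) y = pd i (pd i f) y + ε * 2 := by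
    intro i
    have h1 : ContDiff ℝ ∞ (ε • n) := contDiff_const.smul hnsm
    have h2 : ContDiff ℝ ∞ (ε • pd i n) := contDiff_const.smul (contDiff_pd hnsm i)
    rw [hg, pd_add (contDiff f) h1, pd_smul hnsm, pd_add (contDiff_pd (contDiff f) i) h2,
      pd_smul (contDiff_pd hnsm i), hppn]
    simp
  have hsum : ∑ i, pd i (pd i f) y = 0 := by
    have := congrArg (fun h : DecaySpace => h y) hf
    simpa [← lap_coe, lap] using this
  -- The sum of second derivatives is 0 + 6ε, which cannot be nonpositive.
  have hle : ∑ i, pd i (pd i g) y ≤ 0 :=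
    Finset.sum_nonpos fun i _ => pd_pd_nonpos_of_isLocalMax hgsm hloc i
  simp only [hppg, Finset.sum_add_distrib, hsum] at hle
  simp at hle
  linarith

/-- A decaying harmonic function vanishes. -/
theorem eq_zero_of_Lap_eq_zero {f : DecaySpace} (hf : Lap f = 0) : f = 0 :=
  ext_apply fun x => le_antisymm (nonpos_of_Lap_eq_zero hf x) (by
    have := nonpos_of_Lap_eq_zero (f := -f) (by rw [map_neg, hf, neg_zero]) x
    simpa using this)

end DecaySpace

open DecaySpace

/-! ### Decaying scalar, vector and tensor modes -/

/-- Decaying components `ψ, E, F, h` of a symmetric tensor field. -/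
@[ext]
structure TensorModes where
  psi : DecaySpace
  E : DecaySpace
  F : Fin 3 → DecaySpace
  h : Fin 3 → Fin 3 → DecaySpace

namespace TensorModes

/-- `F` is divergence-free and `h` is symmetric, trace-free and divergence-free. -/
structure Transverse (T : TensorModes) : Prop where
  div_F : D 0 (T.F 0) + D 1 (T.F 1) + D 2 (T.F 2) = 0
  symm_h : ∀ a b, T.h a b = T.h b a
  trace_h : T.h 0 0 + T.h 1 1 + T.h 2 2 = 0
  div_h : ∀ a, D 0 (T.h 0 a) + D 1 (T.h 1 a) + D 2 (T.h 2 a) = 0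

/-- The tensor field `ψ δ_ab + (∂_a∂_b - δ_ab Δ/3) E + ∂_(a F_b) + h_ab / 2`. -/
def tensor (T : TensorModes) (a b : Fin 3) : DecaySpace :=
  kron a b • T.psi + (D a (D b T.E) - ((1 / 3) * kron a b) • Lap T.E)
    + (1 / 2 : ℝ) • (D b (T.F a) + D a (T.F b)) + (1 / 2 : ℝ) • T.h a b

theorem svtTensor_apply (T : TensorModes) (x : E3) (a b : Fin 3) :
    svtTensor T.psi T.E (fun y c => T.F c y) (fun y => Matrix.of fun c d => T.h c d y) x a b
      = T.tensor a b x := by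
  simp only [svtTensor, tensor, Matrix.of_apply, lap_coe, pd_coe, coe_add_apply, coe_sub_apply,
    coe_smul_apply]
  ring

theorem tensor_symm {T : TensorModes} (hT : T.Transverse) (a b : Fin 3) :
    T.tensor a b = T.tensor b a := by
  have hk : kron a b = kron b a := by simp [kron, eq_comm]
  simp only [tensor, hk, D_comm a b, hT.symm_h a b, add_comm (D b (T.F a))]

theorem tensor_trace {T : TensorModes} (hT : T.Transverse) :
    T.tensor 0 0 + T.tensor 1 1 + T.tensor 2 2 = (3 : ℝ) • T.psi := by
  have h1 := hT.div_F
  have h2 := hT.trace_h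
  simp only [tensor, kron, if_true, Lap_eq]
  linear_combination (norm := module) h1 + (1 / 2 : ℝ) • h2

/-- The divergence kills h and separates into a gradient and a divergence-free part. It serves both
for uniqueness of the modes and for the diffeomorphism constraint. -/
theorem tensor_div {T : TensorModes} (hT : T.Transverse) (a : Fin 3) :
    D 0 (T.tensor a 0) + D 1 (T.tensor a 1) + D 2 (T.tensor a 2)
      = D a (T.psi + (2 / 3 : ℝ) • Lap T.E) + (1 / 2 : ℝ) • Lap (T.F a) := by
  have h1 := congrArg (D a) hT.div_F
  have h2 := hT.div_h a
  rw [hT.symm_h 0 a, hT.symm_h 1 a, hT.symm_h 2 a] at h2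
  fin_cases a <;>
  · simp [tensor, kron, Lap_eq, D_comm 1 0, D_comm 2 0, D_comm 2 1] at h1 h2 ⊢
    linear_combination (norm := module) (1 / 2 : ℝ) • h1 + (1 / 2 : ℝ) • h2

end TensorModes

/-- The decomposition of a decaying vector field into a gradient and a divergence-free field is
unique. -/
theorem eq_zero_of_grad_add {u : DecaySpace} {w : Fin 3 → DecaySpace}
    (hw : D 0 (w 0) + D 1 (w 1) + D 2 (w 2) = 0) (h : ∀ a, D a u + w a = 0) :
    u = 0 ∧ w = 0 := by
  have hu : u = 0 := by
    refine eq_zero_of_Lap_eq_zero ?_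
    have h0 := congrArg (D 0) (h 0)
    have h1 := congrArg (D 1) (h 1)
    have h2 := congrArg (D 2) (h 2)
    simp only [map_add, map_zero] at h0 h1 h2
    rw [Lap_eq]
    linear_combination (norm := module) h0 + h1 + h2 - hw
  subst hu
  exact ⟨rfl, funext fun a => by simpa using h a⟩

namespace TensorModes

/-- The trace isolates ψ. The divergence then splits into ∂ΔE and ΔF, which vanish separately;
injectivity of the Laplacian on decaying functions removes E and F, and h is all that is left. -/
theorem eq_zero_of_tensor_eq_zero {T : TensorModes} (hT : T.Transverse)
    (h : ∀ a b, T.tensor a b = 0) : T.psi = 0 ∧ T.E = 0 ∧ T.F = 0 ∧ T.h = 0 := by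
  have hpsi : T.psi = 0 := by
    have := tensor_trace hT
    simpa [h] using this.symm
  have hdiv : ∀ a, D a ((2 / 3 : ℝ) • Lap T.E) + (1 / 2 : ℝ) • Lap (T.F a) = 0 := by
    intro a
    have := tensor_div hT a
    simpa [h, hpsi] using this.symm
  have hw : D 0 ((1 / 2 : ℝ) • Lap (T.F 0)) + D 1 ((1 / 2 : ℝ) • Lap (T.F 1))
      + D 2 ((1 / 2 : ℝ) • Lap (T.F 2)) = 0 := by
    have := congrArg Lap hT.div_F
    simp only [map_smul, D_Lap, map_add, map_zero] at this ⊢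
    linear_combination (norm := module) (1 / 2 : ℝ) • this
  obtain ⟨h1, h2⟩ := eq_zero_of_grad_add (w := fun a => (1 / 2 : ℝ) • Lap (T.F a)) hw hdiv
  have hE : T.E = 0 := eq_zero_of_Lap_eq_zero (by simpa using h1)
  have hF : T.F = 0 := funext fun a => eq_zero_of_Lap_eq_zero (by simpa using congrFun h2 a)
  refine ⟨hpsi, hE, hF, ?_⟩
  funext a b
  simpa [tensor, hpsi, hE, hF] using h a b

theorem tensor_injective {T T' : TensorModes} (hT : T.Transverse) (hT' : T'.Transverse)
    (h : ∀ a b, T.tensor a b = T'.tensor a b) : T = T' := by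
  let U : TensorModes := ⟨T.psi - T'.psi, T.E - T'.E, T.F - T'.F, T.h - T'.h⟩
  have hU : U.Transverse := by
    refine ⟨?_, fun a b => ?_, ?_, fun a => ?_⟩
    · simp only [U, Pi.sub_apply, map_sub]
      linear_combination (norm := module) hT.div_F - hT'.div_F
    · simp only [U, Pi.sub_apply, hT.symm_h a b, hT'.symm_h a b]
    · simp only [U, Pi.sub_apply]
      linear_combination (norm := module) hT.trace_h - hT'.trace_h
    · simp only [U, Pi.sub_apply, map_sub]
      linear_combination (norm := module) hT.div_h a - hT'.div_h a
  obtain ⟨h1, h2, h3, h4⟩ := eq_zero_of_tensor_eq_zero hU fun a b => by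
    have := h a b
    simp only [tensor, U, Pi.sub_apply, map_sub] at this ⊢
    linear_combination (norm := module) this
  exact TensorModes.ext (sub_eq_zero.1 h1) (sub_eq_zero.1 h2) (sub_eq_zero.1 h3)
    (sub_eq_zero.1 h4)

end TensorModes

/-- Decaying components of a perturbation. -/
@[ext]
structure Modes where
  q : TensorModes
  p : TensorModes
  phi : DecaySpace
  B : DecaySpace
  S : Fin 3 → DecaySpace
  p_phi : DecaySpace
  p_B : DecaySpace
  p_S : Fin 3 → DecaySpace
  dfield : DecaySpace
  dmom : DecaySpace

namespace Modes

/-- Transversality of the vector and tensor components. -/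
structure Transverse (c : Modes) : Prop where
  q : c.q.Transverse
  p : c.p.Transverse
  div_S : D 0 (c.S 0) + D 1 (c.S 1) + D 2 (c.S 2) = 0
  div_p_S : D 0 (c.p_S 0) + D 1 (c.p_S 1) + D 2 (c.p_S 2) = 0

/-- The underlying component functions. -/
def toSVT (c : Modes) : SVT where
  psi := c.q.psi
  E := c.q.E
  F y a := c.q.F a y
  h y := Matrix.of fun a b => c.q.h a b y
  p_psi := c.p.psi
  p_E := c.p.E
  p_F y a := c.p.F a y
  p_h y := Matrix.of fun a b => c.p.h a b y
  phi := c.phi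
  B := c.B
  S y a := c.S a y
  p_phi := c.p_phi
  p_B := c.p_B
  p_S y a := c.p_S a y
  dfield := c.dfield
  dmom := c.dmom

theorem div_apply {F : Fin 3 → DecaySpace} :
    (∀ x, divergence (fun y a => F a y) x = 0) ↔ D 0 (F 0) + D 1 (F 1) + D 2 (F 2) = 0 := by
  constructor
  · intro h
    refine ext_apply fun x => ?_
    simpa [divergence, Fin.sum_univ_three, pd_coe] using h x
  · intro h x
    simpa [divergence, Fin.sum_univ_three, pd_coe] using congrArg (fun f : DecaySpace => f x) h

theorem isTT_iff {T : TensorModes} :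
    IsTT (fun y => Matrix.of fun a b => T.h a b y) ↔ (∀ a b, T.h a b = T.h b a) ∧
      T.h 0 0 + T.h 1 1 + T.h 2 2 = 0 ∧
      ∀ a, D 0 (T.h 0 a) + D 1 (T.h 1 a) + D 2 (T.h 2 a) = 0 := by
  constructor
  · rintro ⟨h1, h2, h3⟩
    refine ⟨fun a b => ext_apply fun x => ?_, ext_apply fun x => ?_,
      fun a => ext_apply fun x => ?_⟩
    · simpa using (h1 x).apply b a
    · simpa [Matrix.trace_fin_three] using h2 x
    · simpa [Fin.sum_univ_three, pd_coe] using h3 x a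
  · rintro ⟨h1, h2, h3⟩
    refine ⟨fun x => Matrix.IsSymm.ext fun a b => ?_, fun x => ?_, fun x a => ?_⟩
    · simp [h1 a b]
    · simpa [Matrix.trace_fin_three] using congrArg (fun f : DecaySpace => f x) h2
    · simpa [Fin.sum_univ_three, pd_coe] using congrArg (fun f : DecaySpace => f x) (h3 a)

theorem isTransverse_toSVT {c : Modes} : c.toSVT.IsTransverse ↔ c.Transverse := by
  simp only [SVT.IsTransverse, toSVT, div_apply, isTT_iff]
  constructor
  · rintro ⟨h1, h2, h3, h4, h5, h6⟩
    exact ⟨⟨h1, h5.1, h5.2.1, h5.2.2⟩, ⟨h2, h6.1, h6.2.1, h6.2.2⟩, h3, h4⟩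
  · rintro ⟨h1, h2, h3, h4⟩
    exact ⟨h1.1, h2.1, h3, h4, ⟨h1.2, h1.3, h1.4⟩, ⟨h2.2, h2.3, h2.4⟩⟩

theorem exists_toSVT {X : SVT} (hX : SVT.ForallComponents fun c => Decays (c X)) :
    ∃ c : Modes, c.toSVT = X := by
  obtain ⟨⟨h1, h2, h3, h4⟩, ⟨h5, h6, h7, h8⟩, ⟨h9, h10, h11⟩, ⟨h12, h13, h14⟩, h15, h16⟩ := hX
  exact ⟨⟨⟨⟨_, h1⟩, ⟨_, h2⟩, fun a => ⟨_, h3 a⟩, fun a b => ⟨_, h4 a b⟩⟩,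
    ⟨⟨_, h5⟩, ⟨_, h6⟩, fun a => ⟨_, h7 a⟩, fun a b => ⟨_, h8 a b⟩⟩,
    ⟨_, h9⟩, ⟨_, h10⟩, fun a => ⟨_, h11 a⟩, ⟨_, h12⟩, ⟨_, h13⟩, fun a => ⟨_, h14 a⟩,
    ⟨_, h15⟩, ⟨_, h16⟩⟩, rfl⟩

/-- Bundling the decay into `DecaySpace` turns the component identities into linear algebra over
commuting operators, where `module` applies. -/
theorem isAdmissible_iff {X : SVT} :
    X.IsAdmissible ↔ ∃ c : Modes, c.Transverse ∧ c.toSVT = X := by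
  constructor
  · rintro ⟨hT, hX⟩
    obtain ⟨c, rfl⟩ := exists_toSVT hX
    exact ⟨c, isTransverse_toSVT.1 hT, rfl⟩
  · rintro ⟨c, hc, rfl⟩
    exact ⟨isTransverse_toSVT.2 hc,
      ⟨c.q.psi.2, c.q.E.2, fun a => (c.q.F a).2, fun a b => (c.q.h a b).2⟩,
      ⟨c.p.psi.2, c.p.E.2, fun a => (c.p.F a).2, fun a b => (c.p.h a b).2⟩,
      ⟨c.phi.2, c.B.2, fun a => (c.S a).2⟩, ⟨c.p_phi.2, c.p_B.2, fun a => (c.p_S a).2⟩,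
      c.dfield.2, c.dmom.2⟩

/-! ### Uniqueness of the decomposition of a full perturbation -/

theorem grad_add_injective {u u' : DecaySpace} {w w' : Fin 3 → DecaySpace}
    (hw : D 0 (w 0) + D 1 (w 1) + D 2 (w 2) = 0) (hw' : D 0 (w' 0) + D 1 (w' 1) + D 2 (w' 2) = 0)
    (h : ∀ a, D a u + w a = D a u' + w' a) : u = u' ∧ w = w' := by
  have := eq_zero_of_grad_add (u := u - u') (w := w - w')
    (by
      simp only [Pi.sub_apply, map_sub]
      linear_combination (norm := module) hw - hw')
    (fun a => by
      simp only [Pi.sub_apply, map_sub]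
      linear_combination (norm := module) h a)
  exact ⟨sub_eq_zero.1 this.1, sub_eq_zero.1 this.2⟩

theorem assemble_q (b : Background) (t : ℝ) (c : Modes) (x : E3) (i j : Fin 3) :
    (assemble b t c.toSVT).q x i j = 2 * b.A t * c.q.tensor i j x := by
  rw [← TensorModes.svtTensor_apply]; rfl

theorem assemble_P (b : Background) (t : ℝ) (c : Modes) (x : E3) (i j : Fin 3) :
    (assemble b t c.toSVT).P x i j = 2 * b.P t * c.p.tensor i j x := by
  rw [← TensorModes.svtTensor_apply]; rfl

/-- The prefactors 2A, 2P̃ and N̄ must be divided out, hence the three nonvanishing conditions; for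
P̃ this comes from Ȧ ≠ 0 (`P_ne`). -/
theorem assemble_injective {b : Background} {t : ℝ} (hA : b.A t ≠ 0) (hP : b.P t ≠ 0)
    (hN : b.N t ≠ 0) {c c' : Modes} (hc : c.Transverse) (hc' : c'.Transverse)
    (h : assemble b t c.toSVT = assemble b t c'.toSVT) : c = c' := by
  have hq : c.q = c'.q := TensorModes.tensor_injective hc.q hc'.q fun i j => ext_apply fun x => by
    have := congrFun (congrFun (congrFun (congrArg ADM.q h) x) i) j
    simpa [assemble_q, hA] using this
  have hp : c.p = c'.p := TensorModes.tensor_injective hc.p hc'.p fun i j => ext_apply fun x => by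
    have := congrFun (congrFun (congrFun (congrArg ADM.P h) x) i) j
    simpa [assemble_P, hP] using this
  have hBS := grad_add_injective hc.div_S hc'.div_S fun a => ext_apply fun x =>
    congrFun (congrFun (congrArg ADM.Nv h) x) a
  have hpBS := grad_add_injective hc.div_p_S hc'.div_p_S fun a => ext_apply fun x =>
    congrFun (congrFun (congrArg ADM.Piv h) x) a
  have hphi : c.phi = c'.phi := ext_apply fun x => by
    have : b.N t * c.phi x = b.N t * c'.phi x := congrFun (congrArg ADM.N h) x
    simpa [hN] using this
  have hpphi : c.p_phi = c'.p_phi := ext_apply fun x => by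
    have : b.N t * c.p_phi x = b.N t * c'.p_phi x := congrFun (congrArg ADM.Pi h) x
    simpa [hN] using this
  exact Modes.ext hq hp hphi hBS.1 hBS.2 hpphi hpBS.1 hpBS.2
    (ext_apply fun x => congrFun (congrArg ADM.field h) x)
    (ext_apply fun x => congrFun (congrArg ADM.mom h) x)

/-- `svt` is an arbitrary choice; uniqueness of admissible modes makes it the expected one. -/
theorem svt_assemble {b : Background} {t : ℝ} (hA : b.A t ≠ 0) (hP : b.P t ≠ 0)
    (hN : b.N t ≠ 0) {c : Modes} (hc : c.Transverse) :
    svt b t (assemble b t c.toSVT) = c.toSVT := by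
  have h := Classical.epsilon_spec
    (p := fun X : SVT => X.IsAdmissible ∧ assemble b t X = assemble b t c.toSVT)
    ⟨c.toSVT, isAdmissible_iff.2 ⟨c, hc, rfl⟩, rfl⟩
  obtain ⟨h1, h2⟩ := h
  obtain ⟨c', hc', h3⟩ := isAdmissible_iff.1 h1
  rw [← h3] at h2
  rw [svt, ← h3, assemble_injective hA hP hN hc' hc h2]

end Modes

/-! ### First-order perturbation of a flat metric -/

theorem one_apply_eq_kron (i j : Fin 3) : (1 : Mat3) i j = kron i j := by
  simp [Matrix.one_apply, kron]

@[simp] theorem kron_self (i : Fin 3) : kron i i = 1 := by simp [kron]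

theorem kron_comm (i j : Fin 3) : kron i j = kron j i := by simp [kron, eq_comm]

/-- The family of matrices `A (δ_ij + 2 r T_ij)`. -/
def pertMatrix (A : ℝ) (T : Fin 3 → Fin 3 → DecaySpace) (r : ℝ) (x : E3) : Mat3 :=
  Matrix.of fun i j => A * kron i j + r * (2 * A * T i j x)

/-- Entrywise derivative at `0` of a family of matrices. -/
def MatDeriv (F : ℝ → Mat3) (F' : Mat3) : Prop :=
  ∀ i j, HasDerivAt (fun r => F r i j) (F' i j) 0

theorem MatDeriv.mul {F G : ℝ → Mat3} {F' G' : Mat3} (hF : MatDeriv F F') (hG : MatDeriv G G') :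
    MatDeriv (fun r => F r * G r) (F' * G 0 + F 0 * G') := by
  intro i j
  simp only [Matrix.mul_apply, Matrix.add_apply]
  rw [← Finset.sum_add_distrib]
  exact HasDerivAt.fun_sum fun k _ => (hF i k).fun_mul (hG k j)

theorem MatDeriv.trace {F : ℝ → Mat3} {F' : Mat3} (hF : MatDeriv F F') :
    HasDerivAt (fun r => (F r).trace) F'.trace 0 := by
  simp only [Matrix.trace, Matrix.diag]
  exact HasDerivAt.fun_sum fun k _ => hF k k

section

variable (A : ℝ) (T : Fin 3 → Fin 3 → DecaySpace)

/-- The trace of a tensor field. -/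
def trT : DecaySpace := T 0 0 + T 1 1 + T 2 2

/-- The tensor at a point, as a matrix. -/
def matT (x : E3) : Mat3 := Matrix.of fun i j => T i j x

theorem trace_matT (x : E3) : (matT T x).trace = trT T x := by
  simp [matT, trT, Matrix.trace_fin_three]

theorem pertMatrix_zero (x : E3) : pertMatrix A T 0 x = A • 1 := by
  ext i j; simp [pertMatrix, one_apply_eq_kron]

theorem matDeriv_pertMatrix (x : E3) :
    MatDeriv (fun r => pertMatrix A T r x) ((2 * A) • matT T x) := by
  intro i j
  simpa [pertMatrix, matT] using
    ((hasDerivAt_id (0 : ℝ)).mul_const (2 * A * T i j x)).const_add (A * kron i j)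

theorem jointSmooth_pertMatrix (t : ℝ) (x : E3) (i j : Fin 3) :
    JointSmoothAt t x fun r y => pertMatrix A T r y i j :=
  (JointSmoothAt.const _).add ((JointSmoothAt.param contDiffAt_id).mul
    ((JointSmoothAt.const _).mul (JointSmoothAt.space (T i j).2.1)))

theorem pd_pertMatrix (e i j : Fin 3) (r : ℝ) :
    pd e (fun y => pertMatrix A T r y i j) = fun y => r * (2 * A * D e (T i j) y) := by
  have h : (fun y => pertMatrix A T r y i j)
      = (fun _ => A * kron i j) + ((r * (2 * A)) • T i j : DecaySpace).1 := by
    funext y; simp [pertMatrix]; ring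
  rw [h, pd_add contDiff_const (DecaySpace.contDiff _), pd_const, pd_coe]
  funext y
  simp [mul_assoc]

theorem jointSmooth_det (t : ℝ) (x : E3) :
    JointSmoothAt t x fun r y => (pertMatrix A T r y).det := by
  simp only [Matrix.det_fin_three]
  have h := jointSmooth_pertMatrix A T t x
  exact ((((((h 0 0).mul (h 1 1)).mul (h 2 2)).sub (((h 0 0).mul (h 1 2)).mul (h 2 1))).sub
    (((h 0 1).mul (h 1 0)).mul (h 2 2))).add (((h 0 1).mul (h 1 2)).mul (h 2 0))).add
    (((h 0 2).mul (h 1 0)).mul (h 2 1)) |>.sub (((h 0 2).mul (h 1 1)).mul (h 2 0))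

theorem det_smul_one : (A • (1 : Mat3)).det = A ^ 3 := by simp

theorem hasDerivAt_det (x : E3) :
    HasDerivAt (fun r => (pertMatrix A T r x).det) (2 * A ^ 3 * trT T x) 0 := by
  have h := matDeriv_pertMatrix A T x
  simp only [Matrix.det_fin_three]
  have := ((((((h 0 0).fun_mul (h 1 1)).fun_mul (h 2 2)).fun_sub
    (((h 0 0).fun_mul (h 1 2)).fun_mul (h 2 1))).fun_sub
    (((h 0 1).fun_mul (h 1 0)).fun_mul (h 2 2))).fun_add
    (((h 0 1).fun_mul (h 1 2)).fun_mul (h 2 0))).fun_add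
    (((h 0 2).fun_mul (h 1 0)).fun_mul (h 2 1)) |>.fun_sub
    (((h 0 2).fun_mul (h 1 1)).fun_mul (h 2 0))
  refine this.congr_deriv (Eq.symm ?_)
  simp [pertMatrix_zero, matT, trT]
  ring

variable {A}

theorem sqrt_pow_three (hA : 0 < A) : Real.sqrt (A ^ 3) = Real.sqrt A ^ 3 := by
  rw [Real.sqrt_eq_iff_mul_self_eq (by positivity) (by positivity)]
  have := Real.sq_sqrt hA.le
  calc A ^ 3 = (Real.sqrt A ^ 2) ^ 3 := by rw [this]
    _ = Real.sqrt A ^ 3 * Real.sqrt A ^ 3 := by ring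

theorem jointSmooth_sqrtDet (hA : 0 < A) (x : E3) :
    JointSmoothAt 0 x fun r y => sqrtDet (pertMatrix A T r) y :=
  (jointSmooth_det A T 0 x).sqrt (by
    simp only [pertMatrix_zero, det_smul_one]; positivity)

theorem sqrtDet_zero (hA : 0 < A) (x : E3) : sqrtDet (pertMatrix A T 0) x = Real.sqrt A ^ 3 := by
  simp only [sqrtDet, pertMatrix_zero, det_smul_one, sqrt_pow_three hA]

theorem hasDerivAt_sqrtDet (hA : 0 < A) (x : E3) :
    HasDerivAt (fun r => sqrtDet (pertMatrix A T r) x) (Real.sqrt A ^ 3 * trT T x) 0 := by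
  have h := (hasDerivAt_det A T x).sqrt (by
    simp only [pertMatrix_zero, det_smul_one]; positivity)
  have ha : 0 < Real.sqrt A := Real.sqrt_pos.2 hA
  refine h.congr_deriv (Eq.symm ?_)
  simp only [pertMatrix_zero, det_smul_one, sqrt_pow_three hA]
  nth_rewrite 2 [← Real.sq_sqrt hA.le]
  field_simp

/-- By Cramer's rule each entry is a polynomial in the metric divided by the determinant, which is
A³ ≠ 0 at r = 0. -/
theorem jointSmooth_inv (hA : 0 < A) (x : E3) (i j : Fin 3) :
    JointSmoothAt 0 x fun r y => (pertMatrix A T r y)⁻¹ i j := by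
  have h := jointSmooth_pertMatrix A T 0 x
  have hd := (jointSmooth_det A T 0 x).inv (by
    simp only [pertMatrix_zero, det_smul_one]; positivity)
  simp only [Matrix.inv_def, Ring.inverse_eq_inv', Matrix.smul_apply, smul_eq_mul,
    Matrix.adjugate_fin_three]
  refine hd.mul ?_
  fin_cases i <;> fin_cases j <;> simp only [Matrix.of_apply, Matrix.cons_val', Matrix.cons_val,
    Matrix.cons_val_zero, Matrix.cons_val_one, Fin.isValue, Fin.mk_one, Fin.zero_eta,
    Fin.reduceFinMk, ← sub_eq_neg_add] <;>
  exact (JointSmoothAt.mul (h _ _) (h _ _)).sub ((h _ _).mul (h _ _))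

theorem inv_smul_one (hA : 0 < A) : (A • (1 : Mat3))⁻¹ = A⁻¹ • 1 := by
  refine Matrix.inv_eq_right_inv ?_
  rw [smul_mul_smul_comm, one_mul, mul_inv_cancel₀ hA.ne', one_smul]

theorem inv_pertMatrix_zero (hA : 0 < A) (x : E3) : (pertMatrix A T 0 x)⁻¹ = A⁻¹ • 1 := by
  rw [pertMatrix_zero, inv_smul_one hA]

/-- Differentiability is already known, so the value follows by differentiating q q⁻¹ = 1 and
solving. -/
theorem matDeriv_inv (hA : 0 < A) (x : E3) :
    MatDeriv (fun r => (pertMatrix A T r x)⁻¹) (-(2 / A) • matT T x) := by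
  set D' : Mat3 := Matrix.of fun i j => deriv (fun r => (pertMatrix A T r x)⁻¹ i j) 0 with hD'
  have h1 : MatDeriv (fun r => (pertMatrix A T r x)⁻¹) D' := fun i j =>
    (jointSmooth_inv T hA x i j).hasDerivAt
  have hev : ∀ᶠ r in 𝓝 (0 : ℝ), (pertMatrix A T r x).det ≠ 0 :=
    (hasDerivAt_det A T x).continuousAt.eventually_ne (by
      simp only [pertMatrix_zero, det_smul_one]; positivity)
  have h2 := (matDeriv_pertMatrix A T x).mul h1
  have h3 : (2 * A) • matT T x * (pertMatrix A T 0 x)⁻¹ + pertMatrix A T 0 x * D' = 0 := by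
    ext i j
    refine (h2 i j).unique ?_
    refine (hasDerivAt_const (0 : ℝ) ((1 : Mat3) i j)).congr_of_eventuallyEq ?_
    filter_upwards [hev] with r hr
    rw [Matrix.mul_nonsing_inv _ (isUnit_iff_ne_zero.2 hr)]
  have h4 : D' = -(2 / A) • matT T x := by
    rw [inv_pertMatrix_zero T hA, pertMatrix_zero] at h3
    ext i j
    have := congrFun (congrFun h3 i) j
    simp at this ⊢
    field_simp at this ⊢
    linarith
  rwa [h4] at h1

/-- The linearized Christoffel symbols. -/
def linGamma (T : Fin 3 → Fin 3 → DecaySpace) (c a b : Fin 3) : DecaySpace :=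
  D a (T b c) + D b (T a c) - D c (T a b)

/-- The background is flat and constant in space, so an overall factor r comes out. The terms ΓΓ of
the curvature are therefore of second order. -/
theorem christoffel_pertMatrix (c a b : Fin 3) (r : ℝ) (x : E3) :
    christoffel (pertMatrix A T r) c a b x
      = r * (A * ∑ d, (pertMatrix A T r x)⁻¹ c d * linGamma T d a b x) := by
  simp only [christoffel, pd_pertMatrix, Finset.mul_sum, linGamma, coe_add_apply, coe_sub_apply]
  refine Finset.sum_congr rfl fun d _ => ?_
  ring

theorem jointSmooth_christoffel (hA : 0 < A) (c a b : Fin 3) (x : E3) :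
    JointSmoothAt 0 x fun r y => christoffel (pertMatrix A T r) c a b y := by
  simp only [christoffel_pertMatrix]
  exact (JointSmoothAt.param contDiffAt_id).mul ((JointSmoothAt.const _).mul
    (JointSmoothAt.sum fun d _ => (jointSmooth_inv T hA x c d).mul
      (JointSmoothAt.space (linGamma T d a b).2.1)))

theorem christoffel_zero (c a b : Fin 3) (x : E3) :
    christoffel (pertMatrix A T 0) c a b x = 0 := by
  simp [christoffel_pertMatrix]

theorem sum_kron_mul (c : Fin 3) (f : Fin 3 → ℝ) : ∑ d, kron c d * f d = f c := by
  simp [kron]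

theorem hasDerivAt_christoffel (hA : 0 < A) (c a b : Fin 3) (x : E3) :
    HasDerivAt (fun r => christoffel (pertMatrix A T r) c a b x) (linGamma T c a b x) 0 := by
  simp only [christoffel_pertMatrix]
  have h := (hasDerivAt_id (0 : ℝ)).fun_mul ((HasDerivAt.fun_sum (u := Finset.univ)
    fun d _ => (matDeriv_inv T hA x c d).mul_const (linGamma T d a b x)).const_mul A)
  refine h.congr_deriv (Eq.symm ?_)
  simp only [id, one_mul, zero_mul, add_zero, inv_pertMatrix_zero T hA, Matrix.smul_apply,
    smul_eq_mul, one_apply_eq_kron, mul_assoc, ← Finset.mul_sum, sum_kron_mul]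
  field_simp

/-- The linearized Ricci tensor. -/
def linRicci (T : Fin 3 → Fin 3 → DecaySpace) (a b : Fin 3) : DecaySpace :=
  ∑ c, D c (linGamma T c a b) - ∑ c, D b (linGamma T c a c)

theorem ricci_zero (x : E3) : ricci (pertMatrix A T 0) x = 0 := by
  ext a b
  have h : ∀ c a b, christoffel (pertMatrix A T 0) c a b = fun _ => 0 := fun c a b =>
    funext fun y => christoffel_zero T c a b y
  simp [ricci, h, pd_const]

theorem matDeriv_ricci (hA : 0 < A) (x : E3) :
    MatDeriv (fun r => ricci (pertMatrix A T r) x) (matT (linRicci T) x) := by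
  intro a b
  have h1 : ∀ e c a b, HasDerivAt (fun r => pd e (christoffel (pertMatrix A T r) c a b) x)
      (D e (linGamma T c a b) x) 0 := by
    intro e c a b
    have h := (jointSmooth_christoffel T hA c a b x).hasDerivAt_pd e
    have h' : (fun y => deriv (fun r => christoffel (pertMatrix A T r) c a b y) 0)
        = (linGamma T c a b).1 := funext fun y => (hasDerivAt_christoffel T hA c a b y).deriv
    rwa [h', pd_coe] at h
  -- The quadratic terms of the Ricci tensor have no first-order part because both factors vanish at
  -- r = 0.
  have h2 : ∀ c a b d e f, HasDerivAt (fun r => christoffel (pertMatrix A T r) c a b x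
      * christoffel (pertMatrix A T r) d e f x) 0 0 := by
    intro c a b d e f
    have h := (hasDerivAt_christoffel T hA c a b x).fun_mul (hasDerivAt_christoffel T hA d e f x)
    simpa [christoffel_zero] using h
  simp only [ricci, Matrix.of_apply, matT]
  have h3 := ((HasDerivAt.fun_sum (u := Finset.univ) fun c _ => h1 c c a b).fun_sub
    (HasDerivAt.fun_sum (u := Finset.univ) fun c _ => h1 b c a c)).fun_add
    (HasDerivAt.fun_sum (u := Finset.univ) fun c _ => HasDerivAt.fun_sum (u := Finset.univ)
      fun d _ => (h2 c c d d a b).fun_sub (h2 c b d d a c))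
  refine h3.congr_deriv (Eq.symm ?_)
  simp [linRicci]

theorem scalarCurv_zero (x : E3) : scalarCurv (pertMatrix A T 0) x = 0 := by
  simp [scalarCurv, ricci_zero]

theorem hasDerivAt_scalarCurv (hA : 0 < A) (x : E3) :
    HasDerivAt (fun r => scalarCurv (pertMatrix A T r) x) (A⁻¹ * trT (linRicci T) x) 0 := by
  have h := ((matDeriv_inv T hA x).mul (matDeriv_ricci T hA x)).trace
  refine h.congr_deriv (Eq.symm ?_)
  simp [ricci_zero, inv_pertMatrix_zero T hA, trace_matT]

/-- The functions `c + r f`. -/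
def pertFun (c : ℝ) (f : DecaySpace) (r : ℝ) (x : E3) : ℝ := c + r * f x

theorem pertFun_zero (c : ℝ) (f : DecaySpace) (x : E3) : pertFun c f 0 x = c := by
  simp [pertFun]

theorem hasDerivAt_pertFun (c : ℝ) (f : DecaySpace) (x : E3) :
    HasDerivAt (fun r => pertFun c f r x) (f x) 0 := by
  simpa [pertFun] using ((hasDerivAt_id (0 : ℝ)).mul_const (f x)).const_add c

theorem jointSmooth_pertFun (c : ℝ) (f : DecaySpace) (t : ℝ) (x : E3) :
    JointSmoothAt t x fun r y => pertFun c f r y :=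
  (JointSmoothAt.const _).add ((JointSmoothAt.param contDiffAt_id).mul
    (JointSmoothAt.space f.2.1))

theorem pd_pertFun (e : Fin 3) (c : ℝ) (f : DecaySpace) (r : ℝ) :
    pd e (pertFun c f r) = (r • D e f : DecaySpace).1 := by
  have h : pertFun c f r = (fun _ => c) + (r • f : DecaySpace).1 := rfl
  rw [h, pd_add contDiff_const (DecaySpace.contDiff _), pd_const, pd_coe, map_smul, zero_add]

theorem covHess_zero (c : ℝ) (f : DecaySpace) (x : E3) :
    covHess (pertMatrix A T 0) (pertFun c f 0) x = 0 := by
  ext i j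
  have h : pd i (0 : E3 → ℝ) = 0 := pd_const i 0
  simp [covHess, pd_pertFun, h]

theorem matDeriv_covHess (hA : 0 < A) (c : ℝ) (f : DecaySpace) (x : E3) :
    MatDeriv (fun r => covHess (pertMatrix A T r) (pertFun c f r) x)
      (matT (fun i j => D i (D j f)) x) := by
  intro i j
  simp only [covHess, Matrix.of_apply, pd_pertFun, pd_coe, map_smul, coe_smul_apply, matT]
  have h := ((hasDerivAt_id (0 : ℝ)).mul_const (D i (D j f) x)).fun_sub
    (HasDerivAt.fun_sum (u := Finset.univ) fun k _ => (hasDerivAt_christoffel T hA k i j x).fun_mul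
      ((hasDerivAt_id (0 : ℝ)).mul_const (D k f x)))
  simpa [christoffel_zero] using h

theorem gradUp_pertFun (c : ℝ) (f : DecaySpace) (r : ℝ) (x : E3) (i : Fin 3) :
    gradUp (pertMatrix A T r) (pertFun c f r) x i
      = ∑ k, (pertMatrix A T r x)⁻¹ i k * (r * D k f x) := by
  simp [gradUp, pd_pertFun]

theorem jointSmooth_gradUp (hA : 0 < A) (c : ℝ) (f : DecaySpace) (x : E3) (i : Fin 3) :
    JointSmoothAt 0 x fun r y => gradUp (pertMatrix A T r) (pertFun c f r) y i := by
  simp only [gradUp_pertFun]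
  exact JointSmoothAt.sum fun k _ => (jointSmooth_inv T hA x i k).mul
    ((JointSmoothAt.param contDiffAt_id).mul (JointSmoothAt.space (D k f).2.1))

theorem gradUp_zero (c : ℝ) (f : DecaySpace) (x : E3) (i : Fin 3) :
    gradUp (pertMatrix A T 0) (pertFun c f 0) x i = 0 := by
  simp [gradUp_pertFun]

theorem hasDerivAt_gradUp (hA : 0 < A) (c : ℝ) (f : DecaySpace) (x : E3) (i : Fin 3) :
    HasDerivAt (fun r => gradUp (pertMatrix A T r) (pertFun c f r) x i) (A⁻¹ * D i f x) 0 := by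
  simp only [gradUp_pertFun]
  have h := HasDerivAt.fun_sum (u := Finset.univ) fun k _ => (matDeriv_inv T hA x i k).fun_mul
    ((hasDerivAt_id (0 : ℝ)).mul_const (D k f x))
  refine h.congr_deriv (Eq.symm ?_)
  simp [inv_pertMatrix_zero T hA, one_apply_eq_kron, mul_assoc, ← Finset.mul_sum, sum_kron_mul]

theorem gradSq_zero (c : ℝ) (f : DecaySpace) (x : E3) :
    gradSq (pertMatrix A T 0) (pertFun c f 0) x = 0 := by
  simp [gradSq, gradUp_zero]

/-- The background field is homogeneous, so its gradient is of first order and the square of second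
order. -/
theorem hasDerivAt_gradSq (hA : 0 < A) (c : ℝ) (f : DecaySpace) (x : E3) :
    HasDerivAt (fun r => gradSq (pertMatrix A T r) (pertFun c f r) x) 0 0 := by
  simp only [gradSq, pd_pertFun, coe_smul_apply]
  have h := HasDerivAt.fun_sum (u := Finset.univ) fun k _ =>
    ((hasDerivAt_id (0 : ℝ)).mul_const (D k f x)).fun_mul (hasDerivAt_gradUp T hA c f x k)
  simpa [gradUp_zero] using h

end

/-! ### Linearization of the constraints and of the canonical vector field -/

namespace TensorModes

/-- The potential `ψ - ΔE/3` of the linearized spatial curvature. -/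
def curvPot (T : TensorModes) : DecaySpace := T.psi - (1 / 3 : ℝ) • Lap T.E

theorem trT_tensor {T : TensorModes} (hT : T.Transverse) : trT T.tensor = (3 : ℝ) • T.psi :=
  tensor_trace hT

/-- Linearized curvature at a flat metric is invariant under linearized diffeomorphisms, so F drops
out and E survives only together with ψ. The computation expands ∂_a∂_c T_bc + ∂_b∂_c T_ac - ∂_a∂_b
tr T - ΔT_ab with the divergence and trace formulas. -/
theorem linRicci_tensor {T : TensorModes} (hT : T.Transverse) (a b : Fin 3) :
    linRicci T.tensor a b = -D a (D b T.curvPot) - kron a b • Lap T.curvPot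
      - (1 / 2 : ℝ) • Lap (T.h a b) := by
  have h1 := congrArg (D a) (tensor_div hT b)
  have h2 := congrArg (D b) (tensor_div hT a)
  have h3 := congrArg (fun f => D a (D b f)) (tensor_trace hT)
  have h4 : D 0 (D 0 (T.tensor a b)) + D 1 (D 1 (T.tensor a b)) + D 2 (D 2 (T.tensor a b))
      = kron a b • Lap T.psi + (D a (D b (Lap T.E)) - ((1 / 3) * kron a b) • Lap (Lap T.E))
    + (1 / 2 : ℝ) • (D b (Lap (T.F a)) + D a (Lap (T.F b))) + (1 / 2 : ℝ) • Lap (T.h a b) := by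
    rw [← Lap_eq]
    simp only [tensor, map_add, map_sub, map_smul, D_Lap]
  simp only [map_add, map_smul] at h1 h2 h3
  simp only [linRicci, linGamma, Fin.sum_univ_three, map_add, map_sub, curvPot, map_smul]
  simp only [D_comm 0 a, D_comm 1 a, D_comm 2 a, D_comm 0 b, D_comm 1 b, D_comm 2 b, D_comm b a]
    at h1 h2 h3 h4 ⊢
  linear_combination (norm := module) h1 + h2 - h3 - h4

theorem trT_linRicci {T : TensorModes} (hT : T.Transverse) :
    trT (linRicci T.tensor) = (-4 : ℝ) • Lap T.curvPot := by
  have h := congrArg Lap hT.trace_h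
  simp only [map_add, map_zero] at h
  simp only [trT, linRicci_tensor hT, kron_self]
  rw [Lap_eq T.curvPot]
  linear_combination (norm := module) -(1 / 2 : ℝ) • h

end TensorModes

/-! ### First-order expansion of the two constraints -/

section

variable (M : Model) (b : Background) (t : ℝ) (c : Modes)

/-- The affine family of phase space points through the background in the direction of the
perturbation with modes `c`. -/
def pertFamily (r : ℝ) : ADM := b.adm t + r • assemble b t c.toSVT

/-- The shift perturbation `∂_a B + S_a`. -/
def Modes.shift (c : Modes) (a : Fin 3) : DecaySpace := D a c.B + c.S a

theorem pertFamily_q (r : ℝ) :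
    (pertFamily b t c r).q = pertMatrix (b.A t) c.q.tensor r := by
  funext x
  ext i j
  have : (pertFamily b t c r).q x i j
      = (b.A t • (1 : Mat3)) i j + r * (assemble b t c.toSVT).q x i j := rfl
  rw [this, Modes.assemble_q]
  simp [pertMatrix, one_apply_eq_kron]

theorem pertFamily_P (r : ℝ) :
    (pertFamily b t c r).P = pertMatrix (b.P t) c.p.tensor r := by
  funext x
  ext i j
  have : (pertFamily b t c r).P x i j
      = (b.P t • (1 : Mat3)) i j + r * (assemble b t c.toSVT).P x i j := rfl
  rw [this, Modes.assemble_P]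
  simp [pertMatrix, one_apply_eq_kron]

theorem pertFamily_field (r : ℝ) :
    (pertFamily b t c r).field = pertFun (b.field t) c.dfield r := rfl

theorem pertFamily_mom (r : ℝ) :
    (pertFamily b t c r).mom = pertFun (b.mom t) c.dmom r := rfl

theorem pertFamily_N (r : ℝ) :
    (pertFamily b t c r).N = pertFun (b.N t) (b.N t • c.phi) r := rfl

theorem pertFamily_Nv (r : ℝ) (x : E3) (a : Fin 3) :
    (pertFamily b t c r).Nv x a = (r • c.shift a : DecaySpace) x := by
  have : (pertFamily b t c r).Nv x a = 0 + r * c.shift a x := rfl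
  simpa using this

variable {M b t c}

theorem matDeriv_pertFamily_q (x : E3) :
    MatDeriv (fun r => (pertFamily b t c r).q x) ((2 * b.A t) • matT c.q.tensor x) := by
  simp only [pertFamily_q]; exact matDeriv_pertMatrix _ _ x

theorem matDeriv_pertFamily_P (x : E3) :
    MatDeriv (fun r => (pertFamily b t c r).P x) ((2 * b.P t) • matT c.p.tensor x) := by
  simp only [pertFamily_P]; exact matDeriv_pertMatrix _ _ x

theorem pertFamily_q_zero (x : E3) : (pertFamily b t c 0).q x = b.A t • 1 := by
  rw [pertFamily_q, pertMatrix_zero]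

theorem pertFamily_P_zero (x : E3) : (pertFamily b t c 0).P x = b.P t • 1 := by
  rw [pertFamily_P, pertMatrix_zero]

theorem trP_zero (x : E3) : trP (pertFamily b t c 0) x = 3 * b.A t * b.P t := by
  simp [trP, pertFamily_q_zero, pertFamily_P_zero]
  ring

theorem hasDerivAt_trP (hc : c.Transverse) (x : E3) :
    HasDerivAt (fun r => trP (pertFamily b t c r) x)
      (6 * b.A t * b.P t * (c.q.psi x + c.p.psi x)) 0 := by
  have h := ((matDeriv_pertFamily_q (b := b) (t := t) (c := c) x).mul
    (matDeriv_pertFamily_P (b := b) (t := t) (c := c) x)).trace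
  refine h.congr_deriv ?_
  simp [pertFamily_q_zero, pertFamily_P_zero, trace_matT, TensorModes.trT_tensor hc.q,
    TensorModes.trT_tensor hc.p]
  ring

theorem kinP_zero (x : E3) :
    kinP (pertFamily b t c 0) x = -(3 / 2) * b.A t ^ 2 * b.P t ^ 2 := by
  simp [kinP, trP_zero, pertFamily_q_zero, pertFamily_P_zero]
  ring

/-- At an isotropic point only the traces 3ψ and 3p_ψ can enter the variation of an invariant. -/
theorem hasDerivAt_kinP (hc : c.Transverse) (x : E3) :
    HasDerivAt (fun r => kinP (pertFamily b t c r) x)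
      (-6 * b.A t ^ 2 * b.P t ^ 2 * (c.q.psi x + c.p.psi x)) 0 := by
  have hq := matDeriv_pertFamily_q (b := b) (t := t) (c := c) x
  have hP := matDeriv_pertFamily_P (b := b) (t := t) (c := c) x
  have h := (((hq.mul hP).mul hq).mul hP).trace.fun_sub
    (((hasDerivAt_trP (b := b) (t := t) hc x).fun_pow 2).const_mul (1 / 2))
  refine h.congr_deriv ?_
  simp [pertFamily_q_zero, pertFamily_P_zero, trP_zero, trace_matT, TensorModes.trT_tensor hc.q,
    TensorModes.trT_tensor hc.p]
  ring

theorem pertFamily_sqrtDet_zero (hA : 0 < b.A t) (x : E3) :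
    sqrtDet (pertFamily b t c 0).q x = Real.sqrt (b.A t) ^ 3 := by
  rw [pertFamily_q, sqrtDet_zero _ hA]

theorem hasDerivAt_pertFamily_sqrtDet (hA : 0 < b.A t) (hc : c.Transverse) (x : E3) :
    HasDerivAt (fun r => sqrtDet (pertFamily b t c r).q x)
      (3 * Real.sqrt (b.A t) ^ 3 * c.q.psi x) 0 := by
  simp only [pertFamily_q]
  refine (hasDerivAt_sqrtDet _ hA x).congr_deriv ?_
  simp [TensorModes.trT_tensor hc.q]
  ring

theorem hasDerivAt_potential (hV : ContDiff ℝ ∞ M.V) (x : E3) :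
    HasDerivAt (fun r => M.V ((pertFamily b t c r).field x))
      (deriv M.V (b.field t) * c.dfield x) 0 := by
  simp only [pertFamily_field]
  have h1 : HasDerivAt M.V (deriv M.V (b.field t)) (pertFun (b.field t) c.dfield 0 x) := by
    rw [pertFun_zero]
    exact (hV.differentiable (by simp) _).hasDerivAt
  exact h1.comp 0 (hasDerivAt_pertFun (b.field t) c.dfield x)

theorem hasDerivAt_potential_deriv (hV : ContDiff ℝ ∞ M.V) (x : E3) :
    HasDerivAt (fun r => deriv M.V ((pertFamily b t c r).field x))
      (deriv (deriv M.V) (b.field t) * c.dfield x) 0 := by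
  simp only [pertFamily_field]
  have h0 : ContDiff ℝ ∞ (deriv M.V) := by
    have := hV.iterate_deriv 1
    simpa using this
  have h1 : HasDerivAt (deriv M.V) (deriv (deriv M.V) (b.field t))
      (pertFun (b.field t) c.dfield 0 x) := by
    rw [pertFun_zero]
    exact (h0.differentiable (by simp) _).hasDerivAt
  exact h1.comp 0 (hasDerivAt_pertFun (b.field t) c.dfield x)

variable (M b t c)

/-- The linearized Hamiltonian constraint in terms of the modes. -/
def hamModes : DecaySpace :=
  let a := Real.sqrt (b.A t)
  (-(3 / 2) * a * b.P t ^ 2) • (c.q.psi + (4 : ℝ) • c.p.psi) + (4 * a) • Lap c.q.curvPot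
    + (M.kappa * M.lam * b.mom t / a ^ 3) • c.dmom
    + (M.kappa * (3 / 2) * (a ^ 3 * M.V (b.field t) / M.lam - M.lam * b.mom t ^ 2 / a ^ 3))
        • c.q.psi
    + (M.kappa * a ^ 3 * deriv M.V (b.field t) / (2 * M.lam)) • c.dfield

/-- The potential of the gradient part of the linearized diffeomorphism constraint. -/
def diffScalar : DecaySpace :=
  (-4 * b.A t * b.P t) • (c.q.psi + (2 / 3 : ℝ) • Lap c.q.E + c.p.psi + (2 / 3 : ℝ) • Lap c.p.E)
    + (6 * b.A t * b.P t) • c.q.psi + (M.kappa * b.mom t) • c.dfield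

/-- The divergence-free part of the linearized diffeomorphism constraint. -/
def diffVector (a : Fin 3) : DecaySpace :=
  (-2 * b.A t * b.P t) • Lap (c.q.F a + c.p.F a)

variable {M b t c}

/-- The background curvature and the background gradient of the field vanish, so √q R contributes
only √q δR and the gradient energy contributes nothing. -/
theorem hasDerivAt_hamC (hV : ContDiff ℝ ∞ M.V) (hlam : M.lam ≠ 0) (hA : 0 < b.A t)
    (hc : c.Transverse) (x : E3) :
    HasDerivAt (fun r => hamC M (pertFamily b t c r) x) (hamModes M b t c x) 0 := by
  have ha : 0 < Real.sqrt (b.A t) := Real.sqrt_pos.2 hA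
  have hs0 := pertFamily_sqrtDet_zero (c := c) hA x
  have hs := hasDerivAt_pertFamily_sqrtDet hA hc x
  have hs0' : sqrtDet (pertFamily b t c 0).q x ≠ 0 := by rw [hs0]; positivity
  have hR : HasDerivAt (fun r => scalarCurv (pertFamily b t c r).q x)
      ((b.A t)⁻¹ * trT (linRicci c.q.tensor) x) 0 := by
    simp only [pertFamily_q]; exact hasDerivAt_scalarCurv _ hA x
  have hR0 : scalarCurv (pertFamily b t c 0).q x = 0 := by rw [pertFamily_q, scalarCurv_zero]
  have hm : HasDerivAt (fun r => (pertFamily b t c r).mom x) (c.dmom x) 0 :=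
    hasDerivAt_pertFun _ _ x
  have hm0 : (pertFamily b t c 0).mom x = b.mom t := pertFun_zero _ _ x
  have hf0 : (pertFamily b t c 0).field x = b.field t := pertFun_zero _ _ x
  have hg : HasDerivAt (fun r => gradSq (pertFamily b t c r).q (pertFamily b t c r).field x)
      0 0 := by
    simp only [pertFamily_q, pertFamily_field]; exact hasDerivAt_gradSq _ hA _ _ x
  have hg0 : gradSq (pertFamily b t c 0).q (pertFamily b t c 0).field x = 0 := by
    rw [pertFamily_q, pertFamily_field, gradSq_zero]
  have h := (((hasDerivAt_kinP (b := b) (t := t) hc x).fun_div hs hs0').fun_sub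
    (hs.fun_mul hR)).fun_add
    (((((hm.fun_pow 2).const_mul M.lam).fun_div (hs.const_mul 2) (by simpa using hs0')).fun_add
      ((hs.fun_mul (hg.fun_add (hasDerivAt_potential (b := b) (t := t) (c := c) hV x))).div_const
        (2 * M.lam))).const_mul
        M.kappa)
  refine h.congr_deriv ?_
  simp only [hs0, hR0, hm0, hf0, hg0, kinP_zero, TensorModes.trT_linRicci hc.q, hamModes,
    coe_add_apply, coe_smul_apply]
  -- With A = a² all coefficients become rational in a = √A, and clearing denominators leaves a
  -- polynomial identity. The same substitution closes most of the later computations.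
  have hAa : b.A t = Real.sqrt (b.A t) ^ 2 := (Real.sq_sqrt hA.le).symm
  set a := Real.sqrt (b.A t)
  rw [hAa]
  field_simp
  ring

/-- Up to the factor -4AP̃ the first term is the divergence of the metric and momentum tensors,
hence splits by `tensor_div`; the remaining terms are gradients, from the trace of δq and from the
field. -/
theorem hasDerivAt_diffC (hc : c.Transverse) (x : E3) (a : Fin 3) :
    HasDerivAt (fun r => diffC M (pertFamily b t c r) x a)
      ((D a (diffScalar M b t c) + diffVector b t c a) x) 0 := by
  have h1 : ∀ e, HasDerivAt (fun r => pd e (fun y => ∑ k, (pertFamily b t c r).q y a k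
      * (pertFamily b t c r).P y e k) x)
      (D e ((2 * b.A t * b.P t) • (c.q.tensor a e + c.p.tensor e a)) x) 0 := by
    intro e
    have hJ : JointSmoothAt 0 x fun r y => ∑ k, (pertFamily b t c r).q y a k
      * (pertFamily b t c r).P y e k := by
      simp only [pertFamily_q, pertFamily_P]
      exact JointSmoothAt.sum fun k _ => (jointSmooth_pertMatrix _ _ _ _ _ _).mul
        (jointSmooth_pertMatrix _ _ _ _ _ _)
    have h := hJ.hasDerivAt_pd e
    have h' : (fun y => deriv (fun r => ∑ k, (pertFamily b t c r).q y a k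
        * (pertFamily b t c r).P y e k) 0)
        = ((2 * b.A t * b.P t) • (c.q.tensor a e + c.p.tensor e a) : DecaySpace).1 := by
      funext y
      have hd := HasDerivAt.fun_sum (u := Finset.univ) fun k _ =>
        (matDeriv_pertFamily_q (b := b) (t := t) (c := c) y a k).fun_mul
          (matDeriv_pertFamily_P (b := b) (t := t) (c := c) y e k)
      refine (hd.congr_deriv ?_).deriv
      simp only [pertFamily_q_zero, pertFamily_P_zero, Matrix.smul_apply, smul_eq_mul, matT,
        Matrix.of_apply, one_apply_eq_kron, coe_smul_apply, coe_add_apply]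
      have e1 := sum_kron_mul e fun k => c.q.tensor a k y
      have e2 := sum_kron_mul a fun k => c.p.tensor e k y
      simp only [Fin.sum_univ_three] at e1 e2 ⊢
      linear_combination (2 * b.A t * b.P t) * (e1 + e2)
    rwa [h', pd_coe] at h
  have h2 : ∀ i j, HasDerivAt (fun r => (pertFamily b t c r).P x i j
      * pd a (fun y => (pertFamily b t c r).q y i j) x)
      (b.P t * kron i j * (2 * b.A t * D a (c.q.tensor i j) x)) 0 := by
    intro i j
    simp only [pertFamily_q, pd_pertMatrix]
    have h := (matDeriv_pertFamily_P (b := b) (t := t) (c := c) x i j).fun_mul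
      ((hasDerivAt_id (0 : ℝ)).mul_const (2 * b.A t * D a (c.q.tensor i j) x))
    refine h.congr_deriv ?_
    simp [pertFamily_P_zero, one_apply_eq_kron]
  have h3 : HasDerivAt (fun r => M.kappa * (pertFamily b t c r).mom x
      * pd a (pertFamily b t c r).field x) (M.kappa * b.mom t * D a c.dfield x) 0 := by
    simp only [pertFamily_mom, pertFamily_field, pd_pertFun, coe_smul_apply]
    have h := ((hasDerivAt_pertFun (b.mom t) c.dmom x).const_mul M.kappa).fun_mul
      ((hasDerivAt_id (0 : ℝ)).mul_const (D a c.dfield x))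
    refine h.congr_deriv ?_
    simp [pertFun_zero]
  have h := (((HasDerivAt.fun_sum (u := Finset.univ) fun e _ => h1 e).const_mul (-2)).fun_add
    (HasDerivAt.fun_sum (u := Finset.univ) fun i _ => HasDerivAt.fun_sum (u := Finset.univ)
      fun j _ => h2 i j)).fun_add h3
  refine h.congr_deriv ?_
  have e1 := congrArg (fun f : DecaySpace => f x) (TensorModes.tensor_div hc.q a)
  have e2 := congrArg (fun f : DecaySpace => f x) (TensorModes.tensor_div hc.p a)
  have e3 := congrArg (fun f : DecaySpace => D a f x) (TensorModes.tensor_trace hc.q)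
  simp only [TensorModes.tensor_symm hc.p _ a]
  simp only [Fin.sum_univ_three, map_add, map_smul, coe_add_apply, coe_smul_apply, diffScalar,
    diffVector]
    at e1 e2 e3 ⊢
  simp [kron]
  linear_combination (-4 * b.A t * b.P t) * (e1 + e2) + 2 * b.A t * b.P t * e3

end

/-! ### First-order expansion of the canonical vector field: metric and matter -/

section

variable (M : Model) (b : Background) (t : ℝ) (c : Modes)

/-- The metric modes of the linearized canonical vector field. -/
def linModesQ : TensorModes where
  psi := (-(b.N t * b.P t / Real.sqrt (b.A t)) / 2) • (c.q.psi + (2 : ℝ) • c.p.psi + c.phi)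
    + (1 / 3 : ℝ) • Lap c.B
  E := (b.N t * b.P t / Real.sqrt (b.A t)) • (c.q.E + (2 : ℝ) • c.p.E) + c.B
  F i := (b.N t * b.P t / Real.sqrt (b.A t)) • (c.q.F i + (2 : ℝ) • c.p.F i) + c.S i
  h i j := (b.N t * b.P t / Real.sqrt (b.A t)) • (c.q.h i j + (2 : ℝ) • c.p.h i j)

/-- The momentum modes of the linearized canonical vector field. -/
def linModesP : TensorModes where
  psi := (b.N t * b.P t / Real.sqrt (b.A t))
        • ((1 / 8 : ℝ) • c.phi - (1 / 8 : ℝ) • c.q.psi + (1 / 2 : ℝ) • c.p.psi)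
    - (b.N t / (Real.sqrt (b.A t) * b.P t) / 3) • Lap (c.q.curvPot + c.phi)
    + (M.kappa * b.N t * Real.sqrt (b.A t) * b.pressure M t / b.P t / 4)
        • (c.phi - (2 : ℝ) • c.q.psi)
    + (M.kappa * b.N t * Real.sqrt (b.A t) / (2 * b.P t))
        • ((M.lam * b.mom t / (2 * b.A t ^ 3)) • c.dmom
          - (3 / 4 * (M.lam * b.mom t ^ 2 / b.A t ^ 3 + M.V (b.field t) / M.lam)) • c.q.psi
          - (deriv M.V (b.field t) / (4 * M.lam)) • c.dfield)
    + (1 / 6 : ℝ) • Lap c.B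
  E := (-(b.N t * b.P t / Real.sqrt (b.A t))) • ((5 / 4 : ℝ) • c.q.E + c.p.E)
    + (b.N t / (Real.sqrt (b.A t) * b.P t) / 2) • (c.q.curvPot + c.phi)
    - (M.kappa * b.N t * Real.sqrt (b.A t) * b.pressure M t / b.P t / 2) • c.q.E - c.B
  F i := (-(b.N t * b.P t / Real.sqrt (b.A t))) • ((5 / 4 : ℝ) • c.q.F i + c.p.F i)
    - (M.kappa * b.N t * Real.sqrt (b.A t) * b.pressure M t / b.P t / 2) • c.q.F i - c.S i
  h i j := (-(b.N t * b.P t / Real.sqrt (b.A t))) • ((5 / 4 : ℝ) • c.q.h i j + c.p.h i j)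
    - (M.kappa * b.N t * Real.sqrt (b.A t) * b.pressure M t / b.P t / 2) • c.q.h i j
    + (b.N t / (Real.sqrt (b.A t) * b.P t) / 2) • Lap (c.q.h i j)

/-- The modes of the linearized canonical vector field with vanishing multipliers. -/
def linModes : Modes where
  q := linModesQ b t c
  p := linModesP M b t c
  phi := 0
  B := 0
  S := 0
  p_phi := (-(b.N t)⁻¹) • hamModes M b t c
  p_B := -diffScalar M b t c
  p_S i := -diffVector b t c i
  dfield := (M.lam * b.N t / Real.sqrt (b.A t) ^ 3)
    • (b.mom t • c.phi + c.dmom - (3 * b.mom t) • c.q.psi)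
  dmom := (b.N t * Real.sqrt (b.A t) / M.lam) • Lap c.dfield
    - (b.N t * Real.sqrt (b.A t) ^ 3 / (2 * M.lam))
        • (deriv M.V (b.field t) • c.phi + (3 * deriv M.V (b.field t)) • c.q.psi
          + deriv (deriv M.V) (b.field t) • c.dfield)
    + b.mom t • Lap c.B

variable {M b t c}

theorem sum_D_shift (hc : c.Transverse) :
    D 0 (c.shift 0) + D 1 (c.shift 1) + D 2 (c.shift 2) = Lap c.B := by
  have h := hc.div_S
  simp only [Modes.shift, map_add, Lap_eq]
  linear_combination (norm := module) h

theorem transverse_linModesQ (hc : c.Transverse) : (linModesQ b t c).Transverse := by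
  have h1 := hc.q.div_F
  have h2 := hc.p.div_F
  have h3 := hc.div_S
  refine ⟨?_, fun i j => ?_, ?_, fun i => ?_⟩ <;>
    simp only [linModesQ, map_add, map_smul]
  · linear_combination (norm := module) (b.N t * b.P t / Real.sqrt (b.A t)) • h1
      + (b.N t * b.P t / Real.sqrt (b.A t) * 2) • h2 + h3
  · rw [hc.q.symm_h i j, hc.p.symm_h i j]
  · linear_combination (norm := module) (b.N t * b.P t / Real.sqrt (b.A t)) • hc.q.trace_h
      + (b.N t * b.P t / Real.sqrt (b.A t) * 2) • hc.p.trace_h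
  · linear_combination (norm := module) (b.N t * b.P t / Real.sqrt (b.A t)) • hc.q.div_h i
      + (b.N t * b.P t / Real.sqrt (b.A t) * 2) • hc.p.div_h i

theorem transverse_linModesP (hc : c.Transverse) : (linModesP M b t c).Transverse := by
  have h1 := hc.q.div_F
  have h2 := hc.p.div_F
  have h3 := hc.div_S
  refine ⟨?_, fun i j => ?_, ?_, fun i => ?_⟩ <;>
    simp only [linModesP, map_add, map_smul, map_sub]
  · linear_combination (norm := module) (-(b.N t * b.P t / Real.sqrt (b.A t)) * (5 / 4)
        - M.kappa * b.N t * Real.sqrt (b.A t) * b.pressure M t / b.P t / 2) • h1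
      - (b.N t * b.P t / Real.sqrt (b.A t)) • h2 - h3
  · rw [hc.q.symm_h i j, hc.p.symm_h i j]
  · have h4 := congrArg Lap hc.q.trace_h
    simp only [map_add, map_zero] at h4
    linear_combination (norm := module) (-(b.N t * b.P t / Real.sqrt (b.A t)) * (5 / 4)
        - M.kappa * b.N t * Real.sqrt (b.A t) * b.pressure M t / b.P t / 2) • hc.q.trace_h
      - (b.N t * b.P t / Real.sqrt (b.A t)) • hc.p.trace_h
      + (b.N t / (Real.sqrt (b.A t) * b.P t) / 2) • h4
  · have h4 := congrArg Lap (hc.q.div_h i)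
    simp only [map_add, map_zero, ← D_Lap] at h4
    linear_combination (norm := module) (-(b.N t * b.P t / Real.sqrt (b.A t)) * (5 / 4)
        - M.kappa * b.N t * Real.sqrt (b.A t) * b.pressure M t / b.P t / 2) • hc.q.div_h i
      - (b.N t * b.P t / Real.sqrt (b.A t)) • hc.p.div_h i
      + (b.N t / (Real.sqrt (b.A t) * b.P t) / 2) • h4

/-- Needed before `svt` can be evaluated on the linearized vector field, as the rate of the clocks
requires. -/
theorem transverse_linModes (hc : c.Transverse) : (linModes M b t c).Transverse := by
  refine ⟨transverse_linModesQ hc, transverse_linModesP hc, by simp [linModes], ?_⟩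
  have h1 := congrArg Lap hc.q.div_F
  have h2 := congrArg Lap hc.p.div_F
  simp only [linModes, diffVector, map_add, map_zero, map_smul, map_neg, D_Lap] at h1 h2 ⊢
  linear_combination (norm := module) (2 * b.A t * b.P t) • (h1 + h2)

theorem hasDerivAt_pertFamily_N (x : E3) :
    HasDerivAt (fun r => (pertFamily b t c r).N x) (b.N t * c.phi x) 0 :=
  hasDerivAt_pertFun (b.N t) (b.N t • c.phi) x

theorem pertFamily_N_zero (x : E3) : (pertFamily b t c 0).N x = b.N t :=
  pertFun_zero (b.N t) (b.N t • c.phi) x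

theorem pd_pertFamily_Nv (e i : Fin 3) (r : ℝ) :
    pd e (fun y => (pertFamily b t c r).Nv y i) = (r • D e (c.shift i) : DecaySpace).1 := by
  simp only [pertFamily_Nv]
  exact congrArg Subtype.val ((D e).map_smul r (c.shift i))

theorem hasDerivAt_q (hA : 0 < b.A t) (hc : c.Transverse) (x : E3) (i j : Fin 3) :
    HasDerivAt (fun r => (secVF M ⟨(pertFamily b t c r).N, (pertFamily b t c r).Nv⟩
        (pertFamily b t c r)).q x i j)
      (2 * b.A t * (linModes M b t c).q.tensor i j x) 0 := by
  have ha : 0 < Real.sqrt (b.A t) := Real.sqrt_pos.2 hA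
  have hs0 := pertFamily_sqrtDet_zero (c := c) hA x
  have hs := hasDerivAt_pertFamily_sqrtDet hA hc x
  have hs0' : sqrtDet (pertFamily b t c 0).q x ≠ 0 := by rw [hs0]; positivity
  have hn := hasDerivAt_pertFamily_N (b := b) (t := t) (c := c) x
  have hq := matDeriv_pertFamily_q (b := b) (t := t) (c := c) x
  have hP := matDeriv_pertFamily_P (b := b) (t := t) (c := c) x
  have htr := hasDerivAt_trP (b := b) (t := t) hc x
  have hsh : ∀ k, HasDerivAt (fun r => (pertFamily b t c r).Nv x k
        * pd k (fun y => (pertFamily b t c r).q y i j) x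
      + (pertFamily b t c r).q x k j * pd i (fun y => (pertFamily b t c r).Nv y k) x
      + (pertFamily b t c r).q x i k * pd j (fun y => (pertFamily b t c r).Nv y k) x)
      (b.A t * kron j k * D i (c.shift k) x + b.A t * kron i k * D j (c.shift k) x) 0 := by
    intro k
    simp only [pd_pertFamily_Nv]
    simp only [pertFamily_Nv, pertFamily_q, pd_pertMatrix, coe_smul_apply]
    have hid := hasDerivAt_id (0 : ℝ)
    have h := (((hid.mul_const (c.shift k x)).fun_mul
      (hid.mul_const (2 * b.A t * D k (c.q.tensor i j) x))).fun_add
      ((matDeriv_pertMatrix (b.A t) c.q.tensor x k j).fun_mul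
        (hid.mul_const (D i (c.shift k) x)))).fun_add
      ((matDeriv_pertMatrix (b.A t) c.q.tensor x i k).fun_mul
        (hid.mul_const (D j (c.shift k) x)))
    refine h.congr_deriv ?_
    simp [pertMatrix_zero, one_apply_eq_kron, kron_comm k j]
  have h := (((hn.const_mul 2).fun_div hs hs0').fun_mul
    ((((hq.mul hP).mul hq) i j).fun_sub ((htr.const_mul (1 / 2)).fun_mul (hq i j)))).fun_add
    (HasDerivAt.fun_sum (u := Finset.univ) fun k _ => hsh k)
  refine h.congr_deriv ?_
  have e1 := sum_kron_mul j fun k => D i (c.shift k) x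
  have e2 := sum_kron_mul i fun k => D j (c.shift k) x
  simp only [Finset.sum_add_distrib, mul_assoc (b.A t) (kron _ _), ← Finset.mul_sum, e1, e2]
  simp only [pertFamily_N_zero, pertFamily_q_zero, pertFamily_P_zero, hs0, trP_zero,
    Matrix.add_apply, Matrix.smul_apply, smul_mul_assoc, mul_smul_comm, mul_one, one_mul,
    smul_eq_mul, one_apply_eq_kron, matT, Matrix.of_apply, linModes, linModesQ,
    TensorModes.tensor, map_add, map_smul, coe_add_apply, coe_sub_apply, coe_smul_apply, Modes.shift,
    D_comm j i]
  have hAa : b.A t = Real.sqrt (b.A t) ^ 2 := (Real.sq_sqrt hA.le).symm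
  set a := Real.sqrt (b.A t)
  rw [hAa]
  field_simp
  ring

theorem hasDerivAt_field (hA : 0 < b.A t) (hc : c.Transverse) (x : E3) :
    HasDerivAt (fun r => (secVF M ⟨(pertFamily b t c r).N, (pertFamily b t c r).Nv⟩
        (pertFamily b t c r)).field x)
      ((linModes M b t c).dfield x) 0 := by
  have ha : 0 < Real.sqrt (b.A t) := Real.sqrt_pos.2 hA
  have hs0 := pertFamily_sqrtDet_zero (c := c) hA x
  have hs := hasDerivAt_pertFamily_sqrtDet hA hc x
  have hs0' : sqrtDet (pertFamily b t c 0).q x ≠ 0 := by rw [hs0]; positivity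
  have hn := hasDerivAt_pertFamily_N (b := b) (t := t) (c := c) x
  have hm : HasDerivAt (fun r => (pertFamily b t c r).mom x) (c.dmom x) 0 :=
    hasDerivAt_pertFun _ _ x
  have hm0 : (pertFamily b t c 0).mom x = b.mom t := pertFun_zero _ _ x
  have hsh : ∀ k, HasDerivAt (fun r => (pertFamily b t c r).Nv x k
        * pd k (pertFamily b t c r).field x) 0 0 := by
    intro k
    simp only [pertFamily_Nv, pertFamily_field, pd_pertFun, coe_smul_apply]
    have hid := hasDerivAt_id (0 : ℝ)
    simpa using (hid.mul_const (c.shift k x)).fun_mul (hid.mul_const (D k c.dfield x))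
  have h := (((hn.mul_const M.lam).fun_mul hm).fun_div hs hs0').fun_add
    (HasDerivAt.fun_sum (u := Finset.univ) fun k _ => hsh k)
  refine h.congr_deriv ?_
  simp only [pertFamily_N_zero, hs0, hm0, linModes, coe_add_apply, coe_sub_apply, coe_smul_apply,
    Finset.sum_const_zero]
  field_simp
  ring

theorem hasDerivAt_mom (hV : ContDiff ℝ ∞ M.V) (hA : 0 < b.A t) (hc : c.Transverse) (x : E3) :
    HasDerivAt (fun r => (secVF M ⟨(pertFamily b t c r).N, (pertFamily b t c r).Nv⟩
        (pertFamily b t c r)).mom x)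
      ((linModes M b t c).dmom x) 0 := by
  have ha : 0 < Real.sqrt (b.A t) := Real.sqrt_pos.2 hA
  have hs0 := fun y => pertFamily_sqrtDet_zero (c := c) hA y
  have hs := fun y => hasDerivAt_pertFamily_sqrtDet hA hc y
  have hn := fun y => hasDerivAt_pertFamily_N (b := b) (t := t) (c := c) y
  have hgr : ∀ k, HasDerivAt (fun r => pd k (fun y => (pertFamily b t c r).N y
        * sqrtDet (pertFamily b t c r).q y
        * gradUp (pertFamily b t c r).q (pertFamily b t c r).field y k / M.lam) x)
      (b.N t * Real.sqrt (b.A t) / M.lam * D k (D k c.dfield) x) 0 := by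
    intro k
    have hJ : JointSmoothAt 0 x fun r y => (pertFamily b t c r).N y
        * sqrtDet (pertFamily b t c r).q y
        * gradUp (pertFamily b t c r).q (pertFamily b t c r).field y k / M.lam := by
      simp only [pertFamily_q, pertFamily_N, pertFamily_field]
      exact (((jointSmooth_pertFun _ _ _ _).mul (jointSmooth_sqrtDet _ hA x)).mul
        (jointSmooth_gradUp _ hA _ _ x k)).div_const _
    have h := hJ.hasDerivAt_pd k
    have h' : (fun y => deriv (fun r => (pertFamily b t c r).N y
        * sqrtDet (pertFamily b t c r).q y
        * gradUp (pertFamily b t c r).q (pertFamily b t c r).field y k / M.lam) 0)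
        = ((b.N t * Real.sqrt (b.A t) / M.lam) • D k c.dfield : DecaySpace).1 := by
      funext y
      have hg : HasDerivAt (fun r => gradUp (pertFamily b t c r).q (pertFamily b t c r).field y k)
          ((b.A t)⁻¹ * D k c.dfield y) 0 := by
        simp only [pertFamily_q, pertFamily_field]; exact hasDerivAt_gradUp _ hA _ _ y k
      -- Since the background gradient is zero, the variations of lapse and √q drop out of this
      -- divergence.
      have hg0 : gradUp (pertFamily b t c 0).q (pertFamily b t c 0).field y k = 0 := by
        rw [pertFamily_q, pertFamily_field, gradUp_zero]
      have hd := (((hn y).fun_mul (hs y)).fun_mul hg).div_const M.lam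
      refine (hd.congr_deriv ?_).deriv
      simp only [hg0, pertFamily_N_zero, hs0, coe_smul_apply]
      have hAa : b.A t = Real.sqrt (b.A t) ^ 2 := (Real.sq_sqrt hA.le).symm
      set a := Real.sqrt (b.A t)
      rw [hAa]
      field_simp
      ring
    rw [h', pd_coe, map_smul] at h
    exact h
  have hsh : ∀ k, HasDerivAt (fun r => pd k (fun y => (pertFamily b t c r).Nv y k
        * (pertFamily b t c r).mom y) x) (b.mom t * D k (c.shift k) x) 0 := by
    intro k
    simp only [pertFamily_Nv, pertFamily_mom, coe_smul_apply]
    have hJ : JointSmoothAt 0 x fun r y => r * c.shift k y * pertFun (b.mom t) c.dmom r y :=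
      ((JointSmoothAt.param contDiffAt_id).mul (JointSmoothAt.space (c.shift k).2.1)).mul
        (jointSmooth_pertFun _ _ _ _)
    have h := hJ.hasDerivAt_pd k
    have h' : (fun y => deriv (fun r => r * c.shift k y * pertFun (b.mom t) c.dmom r y) 0)
        = (b.mom t • c.shift k : DecaySpace).1 := by
      funext y
      have hd := ((hasDerivAt_id (0 : ℝ)).mul_const (c.shift k y)).fun_mul
        (hasDerivAt_pertFun (b.mom t) c.dmom y)
      refine (hd.congr_deriv ?_).deriv
      simp [pertFun_zero, mul_comm]
    rw [h', pd_coe, map_smul] at h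
    exact h
  have hf0 : (pertFamily b t c 0).field x = b.field t := pertFun_zero _ _ x
  have h := ((HasDerivAt.fun_sum (u := Finset.univ) fun k _ => hgr k).fun_sub
    ((((hn x).fun_mul (hs x)).fun_mul
      (hasDerivAt_potential_deriv (b := b) (t := t) (c := c) hV x)).div_const (2 * M.lam))).fun_add
    (HasDerivAt.fun_sum (u := Finset.univ) fun k _ => hsh k)
  refine h.congr_deriv ?_
  have e1 := congrArg (fun f : DecaySpace => f x) (sum_D_shift hc)
  have e2 := congrArg (fun f : DecaySpace => f x) (Lap_eq c.dfield)
  simp only [coe_add_apply] at e1 e2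
  simp only [Fin.sum_univ_three, pertFamily_N_zero, hs0, hf0, linModes, coe_add_apply, coe_sub_apply,
    coe_smul_apply, e2, ← e1]
  ring

end

/-! ### First-order expansion of the canonical vector field: gravitational momentum -/

section

variable {M : Model} {b : Background} {t : ℝ} {c : Modes}

theorem matDeriv_pertFamily_inv (hA : 0 < b.A t) (x : E3) :
    MatDeriv (fun r => ((pertFamily b t c r).q x)⁻¹) (-(2 / b.A t) • matT c.q.tensor x) := by
  simp only [pertFamily_q]; exact matDeriv_inv _ hA x

theorem pertFamily_inv_zero (hA : 0 < b.A t) (x : E3) :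
    ((pertFamily b t c 0).q x)⁻¹ = (b.A t)⁻¹ • 1 := by
  rw [pertFamily_q, inv_pertMatrix_zero _ hA]

theorem hasDerivAt_P_kinetic (hA : 0 < b.A t) (hc : c.Transverse) (x : E3) (i j : Fin 3) :
    HasDerivAt (fun r => (pertFamily b t c r).N x / (2 * sqrtDet (pertFamily b t c r).q x)
        * kinP (pertFamily b t c r) x * ((pertFamily b t c r).q x)⁻¹ i j
      - 2 * (pertFamily b t c r).N x / sqrtDet (pertFamily b t c r).q x
          * (((pertFamily b t c r).P x * (pertFamily b t c r).q x * (pertFamily b t c r).P x) i j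
            - (1 / 2) * trP (pertFamily b t c r) x * (pertFamily b t c r).P x i j))
      (b.N t * b.P t ^ 2 / Real.sqrt (b.A t)
        * (((1 / 4) * c.phi x + (9 / 4) * c.q.psi x + 3 * c.p.psi x) * kron i j
          - (5 / 2) * c.q.tensor i j x - 2 * c.p.tensor i j x)) 0 := by
  have ha : 0 < Real.sqrt (b.A t) := Real.sqrt_pos.2 hA
  have hs0 := pertFamily_sqrtDet_zero (c := c) hA x
  have hs := hasDerivAt_pertFamily_sqrtDet hA hc x
  have hs0' : sqrtDet (pertFamily b t c 0).q x ≠ 0 := by rw [hs0]; positivity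
  have hn := hasDerivAt_pertFamily_N (b := b) (t := t) (c := c) x
  have hq := matDeriv_pertFamily_q (b := b) (t := t) (c := c) x
  have hP := matDeriv_pertFamily_P (b := b) (t := t) (c := c) x
  have htr := hasDerivAt_trP (b := b) (t := t) hc x
  have h := (((hn.fun_div (hs.const_mul 2) (by simpa using hs0')).fun_mul
    (hasDerivAt_kinP (b := b) (t := t) hc x)).fun_mul
      (matDeriv_pertFamily_inv (c := c) hA x i j)).fun_sub
    (((hn.const_mul 2).fun_div hs hs0').fun_mul
      ((((hP.mul hq).mul hP) i j).fun_sub ((htr.const_mul (1 / 2)).fun_mul (hP i j))))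
  refine h.congr_deriv ?_
  simp only [pertFamily_N_zero, pertFamily_q_zero, pertFamily_P_zero, hs0, trP_zero, kinP_zero,
    inv_smul_one hA, Matrix.add_apply, Matrix.smul_apply, smul_mul_assoc, mul_smul_comm, mul_one,
    one_mul, smul_eq_mul, one_apply_eq_kron, matT, Matrix.of_apply]
  have hAa : b.A t = Real.sqrt (b.A t) ^ 2 := (Real.sq_sqrt hA.le).symm
  set a := Real.sqrt (b.A t)
  rw [hAa]
  field_simp
  ring

/-- The Einstein tensor vanishes at r = 0, so only its own variation counts, with n√q and q⁻¹ at
their background values. -/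
theorem hasDerivAt_P_curvature (hA : 0 < b.A t) (hc : c.Transverse) (x : E3) (i j : Fin 3) :
    HasDerivAt (fun r => (pertFamily b t c r).N x * sqrtDet (pertFamily b t c r).q x
        * ((((pertFamily b t c r).q x)⁻¹ * ricci (pertFamily b t c r).q x
              * ((pertFamily b t c r).q x)⁻¹) i j
            - (1 / 2) * scalarCurv (pertFamily b t c r).q x * ((pertFamily b t c r).q x)⁻¹ i j))
      (b.N t / Real.sqrt (b.A t)
        * (-D i (D j c.q.curvPot) x + kron i j * Lap c.q.curvPot x
          - (1 / 2) * Lap (c.q.h i j) x)) 0 := by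
  have ha : 0 < Real.sqrt (b.A t) := Real.sqrt_pos.2 hA
  have hs0 := pertFamily_sqrtDet_zero (c := c) hA x
  have hs := hasDerivAt_pertFamily_sqrtDet hA hc x
  have hn := hasDerivAt_pertFamily_N (b := b) (t := t) (c := c) x
  have hi := matDeriv_pertFamily_inv (c := c) hA x
  have hR : MatDeriv (fun r => ricci (pertFamily b t c r).q x)
      (matT (linRicci c.q.tensor) x) := by
    simp only [pertFamily_q]; exact matDeriv_ricci _ hA x
  have hR0 : ricci (pertFamily b t c 0).q x = 0 := by rw [pertFamily_q, ricci_zero]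
  have hS : HasDerivAt (fun r => scalarCurv (pertFamily b t c r).q x)
      ((b.A t)⁻¹ * trT (linRicci c.q.tensor) x) 0 := by
    simp only [pertFamily_q]; exact hasDerivAt_scalarCurv _ hA x
  have hS0 : scalarCurv (pertFamily b t c 0).q x = 0 := by rw [pertFamily_q, scalarCurv_zero]
  have h := (hn.fun_mul hs).fun_mul ((((hi.mul hR).mul hi) i j).fun_sub
    ((hS.const_mul (1 / 2)).fun_mul (hi i j)))
  refine h.congr_deriv ?_
  simp only [pertFamily_N_zero, hs0, hR0, hS0, pertFamily_inv_zero hA, Matrix.add_apply,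
    Matrix.smul_apply, smul_mul_assoc, mul_smul_comm, mul_one, mul_zero, zero_mul, one_mul,
    smul_eq_mul, one_apply_eq_kron, matT, Matrix.of_apply, Matrix.zero_apply,
    TensorModes.trT_linRicci hc.q, TensorModes.linRicci_tensor hc.q, coe_sub_apply, coe_neg_apply,
    coe_smul_apply]
  have hAa : b.A t = Real.sqrt (b.A t) ^ 2 := (Real.sq_sqrt hA.le).symm
  set a := Real.sqrt (b.A t)
  rw [hAa]
  field_simp
  ring

/-- The background lapse is constant in space: its covariant Hessian is of first order, and the
connection contributes only at second order. -/
theorem hasDerivAt_P_lapse (hA : 0 < b.A t) (hc : c.Transverse) (x : E3) (i j : Fin 3) :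
    HasDerivAt (fun r => sqrtDet (pertFamily b t c r).q x
        * ((((pertFamily b t c r).q x)⁻¹
              * covHess (pertFamily b t c r).q (pertFamily b t c r).N x
              * ((pertFamily b t c r).q x)⁻¹) i j
            - (((pertFamily b t c r).q x)⁻¹
              * covHess (pertFamily b t c r).q (pertFamily b t c r).N x).trace
              * ((pertFamily b t c r).q x)⁻¹ i j))
      (b.N t / Real.sqrt (b.A t) * (D i (D j c.phi) x - kron i j * Lap c.phi x)) 0 := by
  have ha : 0 < Real.sqrt (b.A t) := Real.sqrt_pos.2 hA
  have hs0 := pertFamily_sqrtDet_zero (c := c) hA x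
  have hs := hasDerivAt_pertFamily_sqrtDet hA hc x
  have hi := matDeriv_pertFamily_inv (c := c) hA x
  have hH : MatDeriv (fun r => covHess (pertFamily b t c r).q (pertFamily b t c r).N x)
      (matT (fun i j => D i (D j (b.N t • c.phi))) x) := by
    simp only [pertFamily_q, pertFamily_N]; exact matDeriv_covHess _ hA _ _ x
  have hH0 : covHess (pertFamily b t c 0).q (pertFamily b t c 0).N x = 0 := by
    rw [pertFamily_q, pertFamily_N, covHess_zero]
  have h := hs.fun_mul ((((hi.mul hH).mul hi) i j).fun_sub
    ((hi.mul hH).trace.fun_mul (hi i j)))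
  refine h.congr_deriv ?_
  simp only [hs0, hH0, pertFamily_inv_zero hA, Matrix.add_apply, Matrix.trace_smul,
    Matrix.smul_apply, smul_mul_assoc, mul_smul_comm, mul_one, mul_zero, zero_mul, one_mul,
    smul_eq_mul, one_apply_eq_kron, trace_matT, Matrix.zero_apply, Matrix.trace_zero, zero_add,
    add_zero]
  simp only [matT, trT, Matrix.of_apply, map_smul, coe_add_apply, coe_smul_apply, Lap_eq]
  have hAa : b.A t = Real.sqrt (b.A t) ^ 2 := (Real.sq_sqrt hA.le).symm
  set a := Real.sqrt (b.A t)
  rw [hAa]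
  field_simp
  ring

theorem hasDerivAt_P_matter (hV : ContDiff ℝ ∞ M.V) (hlam : M.lam ≠ 0) (hA : 0 < b.A t)
    (hc : c.Transverse) (x : E3) (i j : Fin 3) :
    HasDerivAt (fun r => M.kappa * (pertFamily b t c r).N x
        * (M.lam * (pertFamily b t c r).mom x ^ 2 / (4 * sqrtDet (pertFamily b t c r).q x)
              * ((pertFamily b t c r).q x)⁻¹ i j
            - sqrtDet (pertFamily b t c r).q x
                * (gradSq (pertFamily b t c r).q (pertFamily b t c r).field x
                  + M.V ((pertFamily b t c r).field x)) / (4 * M.lam)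
                * ((pertFamily b t c r).q x)⁻¹ i j
            + sqrtDet (pertFamily b t c r).q x / (2 * M.lam)
                * gradUp (pertFamily b t c r).q (pertFamily b t c r).field x i
                * gradUp (pertFamily b t c r).q (pertFamily b t c r).field x j))
      (M.kappa * b.N t * Real.sqrt (b.A t)
        * (b.pressure M t / 2 * (kron i j * c.phi x - 2 * c.q.tensor i j x)
          + kron i j * (M.lam * b.mom t / (2 * b.A t ^ 3) * c.dmom x
            - 3 / 4 * (M.lam * b.mom t ^ 2 / b.A t ^ 3 + M.V (b.field t) / M.lam) * c.q.psi x
            - deriv M.V (b.field t) / (4 * M.lam) * c.dfield x))) 0 := by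
  have ha : 0 < Real.sqrt (b.A t) := Real.sqrt_pos.2 hA
  have hs0 := pertFamily_sqrtDet_zero (c := c) hA x
  have hs := hasDerivAt_pertFamily_sqrtDet hA hc x
  have hs0' : sqrtDet (pertFamily b t c 0).q x ≠ 0 := by rw [hs0]; positivity
  have hn := hasDerivAt_pertFamily_N (b := b) (t := t) (c := c) x
  have hi := matDeriv_pertFamily_inv (c := c) hA x
  have hm : HasDerivAt (fun r => (pertFamily b t c r).mom x) (c.dmom x) 0 :=
    hasDerivAt_pertFun _ _ x
  have hm0 : (pertFamily b t c 0).mom x = b.mom t := pertFun_zero _ _ x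
  have hf0 : (pertFamily b t c 0).field x = b.field t := pertFun_zero _ _ x
  have hg : HasDerivAt (fun r => gradSq (pertFamily b t c r).q (pertFamily b t c r).field x)
      0 0 := by
    simp only [pertFamily_q, pertFamily_field]; exact hasDerivAt_gradSq _ hA _ _ x
  have hg0 : gradSq (pertFamily b t c 0).q (pertFamily b t c 0).field x = 0 := by
    rw [pertFamily_q, pertFamily_field, gradSq_zero]
  have hu : ∀ k, HasDerivAt
      (fun r => gradUp (pertFamily b t c r).q (pertFamily b t c r).field x k)
      ((b.A t)⁻¹ * D k c.dfield x) 0 := by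
    intro k; simp only [pertFamily_q, pertFamily_field]; exact hasDerivAt_gradUp _ hA _ _ x k
  have hu0 : ∀ k, gradUp (pertFamily b t c 0).q (pertFamily b t c 0).field x k = 0 := by
    intro k; rw [pertFamily_q, pertFamily_field, gradUp_zero]
  have hU := hasDerivAt_potential (b := b) (t := t) (c := c) hV x
  have h := (hn.const_mul M.kappa).fun_mul
    ((((((hm.fun_pow 2).const_mul M.lam).fun_div (hs.const_mul 4)
        (by simpa using hs0')).fun_mul (hi i j)).fun_sub
      (((hs.fun_mul (hg.fun_add hU)).div_const (4 * M.lam)).fun_mul (hi i j))).fun_add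
      (((hs.div_const (2 * M.lam)).fun_mul (hu i)).fun_mul (hu j)))
  refine h.congr_deriv ?_
  simp only [pertFamily_N_zero, hs0, hm0, hf0, hg0, hu0, pertFamily_inv_zero hA,
    Matrix.smul_apply, smul_eq_mul, one_apply_eq_kron, matT, Matrix.of_apply,
    Background.pressure]
  have hAa : b.A t = Real.sqrt (b.A t) ^ 2 := (Real.sq_sqrt hA.le).symm
  set a := Real.sqrt (b.A t)
  rw [hAa]
  field_simp
  ring

/-- The background shift is zero, so this is the Lie derivative of the background density P̃δ^{ij}
along the perturbed shift. The divergence of S vanishes, leaving ΔB in the trace. -/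
theorem hasDerivAt_P_shift (hc : c.Transverse) (x : E3) (i j : Fin 3) :
    HasDerivAt (fun r => ∑ k, (pd k (fun y => (pertFamily b t c r).Nv y k
          * (pertFamily b t c r).P y i j) x
        - (pertFamily b t c r).P x k j * pd k (fun y => (pertFamily b t c r).Nv y i) x
        - (pertFamily b t c r).P x i k * pd k (fun y => (pertFamily b t c r).Nv y j) x))
      (b.P t * (kron i j * Lap c.B x - D j (c.shift i) x - D i (c.shift j) x)) 0 := by
  have hid := hasDerivAt_id (0 : ℝ)
  have h1 : ∀ k, HasDerivAt (fun r => pd k (fun y => (pertFamily b t c r).Nv y k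
      * (pertFamily b t c r).P y i j) x) (b.P t * kron i j * D k (c.shift k) x) 0 := by
    intro k
    simp only [pertFamily_Nv, pertFamily_P, coe_smul_apply]
    have hJ : JointSmoothAt 0 x fun r y => r * c.shift k y * pertMatrix
        (b.P t) c.p.tensor r y i j :=
      ((JointSmoothAt.param contDiffAt_id).mul (JointSmoothAt.space (c.shift k).2.1)).mul
        (jointSmooth_pertMatrix _ _ _ _ _ _)
    have h := hJ.hasDerivAt_pd k
    have h' : (fun y => deriv (fun r => r * c.shift k y
        * pertMatrix (b.P t) c.p.tensor r y i j) 0)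
        = ((b.P t * kron i j) • c.shift k : DecaySpace).1 := by
      funext y
      have hd := (hid.mul_const (c.shift k y)).fun_mul
        (matDeriv_pertMatrix (b.P t) c.p.tensor y i j)
      refine (hd.congr_deriv ?_).deriv
      simp [pertMatrix_zero, one_apply_eq_kron]
      ring
    rw [h', pd_coe, map_smul] at h
    exact h
  have h2 : ∀ k l m n, HasDerivAt (fun r => (pertFamily b t c r).P x k l
      * pd m (fun y => (pertFamily b t c r).Nv y n) x)
      (b.P t * (kron k l * D m (c.shift n) x)) 0 := by
    intro k l m n
    simp only [pd_pertFamily_Nv]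
    simp only [pertFamily_P, coe_smul_apply]
    have h := (matDeriv_pertMatrix (b.P t) c.p.tensor x k l).fun_mul
      (hid.mul_const (D m (c.shift n) x))
    refine h.congr_deriv ?_
    simp [pertMatrix_zero, one_apply_eq_kron, mul_assoc]
  have h := HasDerivAt.fun_sum (u := Finset.univ) fun k _ =>
    ((h1 k).fun_sub (h2 k j k i)).fun_sub (h2 i k k j)
  refine h.congr_deriv ?_
  have e1 := congrArg (fun f : DecaySpace => f x) (sum_D_shift hc)
  have e2 := sum_kron_mul j fun k => D k (c.shift i) x
  have e3 := sum_kron_mul i fun k => D k (c.shift j) x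
  simp only [coe_add_apply] at e1
  simp only [kron_comm _ j, Fin.sum_univ_three] at e2 e3 ⊢
  rw [kron_comm j i]
  linear_combination (b.P t * kron i j) * e1 - b.P t * e2 - b.P t * e3

/-- Sum of the five contributions, divided by 2P̃ and sorted by tensor type. The terms proportional
to the full metric perturbation feed every mode, those proportional to δ^{ij} only p_ψ, and double
derivatives both p_E and, through the trace, p_ψ. -/
theorem hasDerivAt_P (hV : ContDiff ℝ ∞ M.V) (hlam : M.lam ≠ 0) (hA : 0 < b.A t)
    (hP : b.P t ≠ 0) (hc : c.Transverse) (x : E3) (i j : Fin 3) :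
    HasDerivAt (fun r => (secVF M ⟨(pertFamily b t c r).N, (pertFamily b t c r).Nv⟩
        (pertFamily b t c r)).P x i j)
      (2 * b.P t * (linModes M b t c).p.tensor i j x) 0 := by
  have h := ((((hasDerivAt_P_kinetic hA hc x i j).fun_sub
    (hasDerivAt_P_curvature hA hc x i j)).fun_add (hasDerivAt_P_lapse hA hc x i j)).fun_add
    (hasDerivAt_P_matter hV hlam hA hc x i j)).fun_add
    (hasDerivAt_P_shift (b := b) (t := t) hc x i j)
  refine h.congr_deriv ?_
  have ha : 0 < Real.sqrt (b.A t) := Real.sqrt_pos.2 hA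
  simp only [linModes, linModesP, TensorModes.tensor, map_add, map_sub, map_smul, coe_add_apply,
    coe_sub_apply, coe_smul_apply, Modes.shift, D_comm j i]
  set a := Real.sqrt (b.A t)
  generalize b.pressure M t = p
  field_simp
  ring

end

/-- The linearized canonical vector field in terms of the modes. -/
theorem linVF_assemble {M : Model} {b : Background} {t : ℝ} {c : Modes}
    (hV : ContDiff ℝ ∞ M.V) (hlam : M.lam ≠ 0) (hA : 0 < b.A t) (hP : b.P t ≠ 0)
    (hN : b.N t ≠ 0) (hc : c.Transverse) :
    linVF M b t default (assemble b t c.toSVT) = assemble b t (linModes M b t c).toSVT := by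
  have hq : (linVF M b t default (assemble b t c.toSVT)).q
      = (assemble b t (linModes M b t c).toSVT).q := by
    funext x
    ext i j
    rw [Modes.assemble_q]
    exact (hasDerivAt_q hA hc x i j).deriv
  have hp : (linVF M b t default (assemble b t c.toSVT)).P
      = (assemble b t (linModes M b t c).toSVT).P := by
    funext x
    ext i j
    rw [Modes.assemble_P]
    exact (hasDerivAt_P hV hlam hA hP hc x i j).deriv
  have hf : (linVF M b t default (assemble b t c.toSVT)).field
      = (assemble b t (linModes M b t c).toSVT).field :=
    funext fun x => (hasDerivAt_field hA hc x).deriv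
  have hm : (linVF M b t default (assemble b t c.toSVT)).mom
      = (assemble b t (linModes M b t c).toSVT).mom :=
    funext fun x => (hasDerivAt_mom hV hA hc x).deriv
  have hn : (linVF M b t default (assemble b t c.toSVT)).N
      = (assemble b t (linModes M b t c).toSVT).N := by
    funext x
    -- `default` is the zero multiplier perturbation, so the multiplier keeps its background value
    -- along the family and its variation is zero.
    have h1 : (linVF M b t default (assemble b t c.toSVT)).N x
        = deriv (fun r : ℝ => deriv b.N t + r * 0) 0 := rfl
    have h2 : (assemble b t (linModes M b t c).toSVT).N x = b.N t * 0 := rfl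
    rw [h1, h2]
    simp
  have hv : (linVF M b t default (assemble b t c.toSVT)).Nv
      = (assemble b t (linModes M b t c).toSVT).Nv := by
    funext x i
    have h1 : (linVF M b t default (assemble b t c.toSVT)).Nv x i
        = deriv (fun r : ℝ => 0 + r * 0) 0 := rfl
    have h2 : (assemble b t (linModes M b t c).toSVT).Nv x i = (D i 0 + 0 : DecaySpace) x := rfl
    rw [h1, h2]
    simp
  have hpi : (linVF M b t default (assemble b t c.toSVT)).Pi
      = (assemble b t (linModes M b t c).toSVT).Pi := by
    funext x
    have h2 : (assemble b t (linModes M b t c).toSVT).Pi x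
        = b.N t * (-(b.N t)⁻¹ * hamModes M b t c x) := rfl
    rw [h2]
    refine ((hasDerivAt_hamC hV hlam hA hc x).fun_neg.congr_deriv ?_).deriv
    field_simp
  have hpv : (linVF M b t default (assemble b t c.toSVT)).Piv
      = (assemble b t (linModes M b t c).toSVT).Piv := by
    funext x i
    have h2 : (assemble b t (linModes M b t c).toSVT).Piv x i
        = (D i (-diffScalar M b t c) + -diffVector b t c i : DecaySpace) x := rfl
    rw [h2]
    refine ((hasDerivAt_diffC hc x i).fun_neg.congr_deriv ?_).deriv
    simp
    ring
  -- Forgetting what the two points are reduces the goal to equality of records with equal fields.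
  generalize linVF M b t default (assemble b t c.toSVT) = U at *
  generalize assemble b t (linModes M b t c).toSVT = W at *
  cases U
  cases W
  simp only at hq hp hf hm hn hv hpi hpv
  subst hq hp hf hm hn hv hpi hpv
  rfl

/-! ### The constraint vector fields at the background -/

section

variable {M : Model} {b : Background} {t : ℝ}

theorem adm_q (b : Background) (t : ℝ) : (b.adm t).q = pertMatrix (b.A t) 0 0 :=
  funext fun x => (pertMatrix_zero _ _ x).symm

theorem adm_q_apply (b : Background) (t : ℝ) (x : E3) : (b.adm t).q x = b.A t • 1 := rfl

theorem adm_P_apply (b : Background) (t : ℝ) (x : E3) : (b.adm t).P x = b.P t • 1 := rfl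

theorem adm_field (b : Background) (t : ℝ) : (b.adm t).field = pertFun (b.field t) 0 0 :=
  funext fun x => (pertFun_zero _ _ x).symm

theorem adm_trP (x : E3) : trP (b.adm t) x = 3 * b.A t * b.P t := by
  simp [trP, adm_q_apply, adm_P_apply]
  ring

theorem adm_kinP (x : E3) : kinP (b.adm t) x = -(3 / 2) * b.A t ^ 2 * b.P t ^ 2 := by
  simp [kinP, adm_trP, adm_q_apply, adm_P_apply]
  ring

theorem adm_sqrtDet (hA : 0 < b.A t) (x : E3) :
    sqrtDet (b.adm t).q x = Real.sqrt (b.A t) ^ 3 := by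
  rw [adm_q, sqrtDet_zero _ hA]

theorem adm_covHess (n : E3 → ℝ) (x : E3) (i j : Fin 3) :
    covHess (b.adm t).q n x i j = pd i (pd j n) x := by
  simp [covHess, adm_q, christoffel_zero]

theorem adm_pd_q (e i j : Fin 3) : pd e (fun y => (b.adm t).q y i j) = 0 :=
  pd_const e ((b.A t • (1 : Mat3)) i j)

theorem adm_hamC (hlam : M.lam ≠ 0) (hA : 0 < b.A t) (x : E3) :
    hamC M (b.adm t) x = -(3 / 2) * Real.sqrt (b.A t) * b.P t ^ 2
      + M.kappa * (M.lam * b.mom t ^ 2 / (2 * Real.sqrt (b.A t) ^ 3)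
        + Real.sqrt (b.A t) ^ 3 * M.V (b.field t) / (2 * M.lam)) := by
  have ha : 0 < Real.sqrt (b.A t) := Real.sqrt_pos.2 hA
  have h1 : scalarCurv (b.adm t).q x = 0 := by rw [adm_q, scalarCurv_zero]
  have h2 : gradSq (b.adm t).q (b.adm t).field x = 0 := by
    rw [adm_q, adm_field, gradSq_zero]
  have h3 : (b.adm t).mom x = b.mom t := rfl
  have h4 : (b.adm t).field x = b.field t := rfl
  simp only [hamC, h1, h2, h3, h4, adm_kinP, adm_sqrtDet hA]
  have hAa : b.A t = Real.sqrt (b.A t) ^ 2 := (Real.sq_sqrt hA.le).symm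
  set a := Real.sqrt (b.A t)
  rw [hAa]
  field_simp
  ring

/-- With a spatially constant lapse and no shift this yields a background equation; with a decaying
descriptor it yields a gauge transformation. The companion formulas serve the same two purposes. -/
theorem secVF_adm_q (hA : 0 < b.A t) (d : Descriptor) (x : E3) (i j : Fin 3) :
    (secVF M d (b.adm t)).q x i j
      = -(d.n x * b.P t * Real.sqrt (b.A t)) * kron i j
        + b.A t * (pd i (fun y => d.v y j) x + pd j (fun y => d.v y i) x) := by
  have ha : 0 < Real.sqrt (b.A t) := Real.sqrt_pos.2 hA
  have e1 := sum_kron_mul j fun k => pd i (fun y => d.v y k) x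
  have e2 := sum_kron_mul i fun k => pd j (fun y => d.v y k) x
  simp only [secVF, Matrix.of_apply, adm_pd_q, Pi.zero_apply, mul_zero, zero_add]
  simp only [adm_q_apply, adm_P_apply, adm_trP, adm_sqrtDet hA, Matrix.smul_apply, mul_smul_comm,
    mul_one, smul_eq_mul, one_apply_eq_kron, Finset.sum_add_distrib, mul_assoc (b.A t) (kron _ _),
    ← Finset.mul_sum, e2, kron_comm _ j, e1]
  have hAa : b.A t = Real.sqrt (b.A t) ^ 2 := (Real.sq_sqrt hA.le).symm
  set a := Real.sqrt (b.A t)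
  rw [hAa]
  field_simp
  ring

theorem secVF_adm_P (hlam : M.lam ≠ 0) (hA : 0 < b.A t) (d : Descriptor) (x : E3)
    (i j : Fin 3) :
    (secVF M d (b.adm t)).P x i j
      = d.n x * (b.P t ^ 2 / (4 * Real.sqrt (b.A t))
          + M.kappa * Real.sqrt (b.A t) * b.pressure M t / 2) * kron i j
        + (pd i (pd j d.n) x - lap d.n x * kron i j) / Real.sqrt (b.A t)
        + (∑ k, pd k (fun y => d.v y k * (b.P t * kron i j)) x)
        - b.P t * (pd j (fun y => d.v y i) x + pd i (fun y => d.v y j) x) := by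
  have ha : 0 < Real.sqrt (b.A t) := Real.sqrt_pos.2 hA
  have e1 := sum_kron_mul j fun k => pd k (fun y => d.v y i) x
  have e2 := sum_kron_mul i fun k => pd k (fun y => d.v y j) x
  have h1 : scalarCurv (b.adm t).q x = 0 := by rw [adm_q, scalarCurv_zero]
  have h2 : gradSq (b.adm t).q (b.adm t).field x = 0 := by
    rw [adm_q, adm_field, gradSq_zero]
  have h3 : (b.adm t).mom x = b.mom t := rfl
  have h4 : (b.adm t).field x = b.field t := rfl
  have h5 : ricci (b.adm t).q x = 0 := by rw [adm_q, ricci_zero]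
  have h6 : ∀ k, gradUp (b.adm t).q (b.adm t).field x k = 0 := by
    intro k; rw [adm_q, adm_field, gradUp_zero]
  have h7 : (covHess (b.adm t).q d.n x).trace = lap d.n x := by
    simp [Matrix.trace, lap, adm_covHess]
  simp only [secVF, Matrix.of_apply, h1, h2, h3, h4, h5, h6, adm_q_apply, adm_P_apply, adm_trP,
    adm_kinP, adm_sqrtDet hA, inv_smul_one hA, Matrix.smul_apply, smul_mul_assoc, mul_smul_comm,
    mul_one, one_mul, smul_eq_mul, one_apply_eq_kron, mul_zero, zero_add,
    Matrix.zero_apply, Finset.sum_sub_distrib, Matrix.trace_smul, h7, adm_covHess,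
    mul_assoc (b.P t) (kron _ _), ← Finset.mul_sum, e2, kron_comm _ j, e1, Background.pressure,
    zero_mul, add_zero, sub_zero]
  have hAa : b.A t = Real.sqrt (b.A t) ^ 2 := (Real.sq_sqrt hA.le).symm
  set a := Real.sqrt (b.A t)
  rw [hAa]
  field_simp
  ring

theorem secVF_adm_field (hA : 0 < b.A t) (d : Descriptor) (x : E3) :
    (secVF M d (b.adm t)).field x
      = M.lam * b.mom t / Real.sqrt (b.A t) ^ 3 * d.n x := by
  have h3 : (b.adm t).mom x = b.mom t := rfl
  have h4 : ∀ e, pd e (b.adm t).field = 0 := fun e => pd_const e (b.field t)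
  simp only [secVF, h3, h4, adm_sqrtDet hA, Pi.zero_apply, mul_zero, Finset.sum_const_zero]
  ring

theorem secVF_adm_mom (hA : 0 < b.A t) (d : Descriptor) (x : E3) :
    (secVF M d (b.adm t)).mom x
      = -(Real.sqrt (b.A t) ^ 3 * deriv M.V (b.field t) / (2 * M.lam)) * d.n x
        + ∑ k, pd k (fun y => d.v y k * b.mom t) x := by
  have h3 : (b.adm t).mom = fun _ => b.mom t := rfl
  have h4 : (b.adm t).field x = b.field t := rfl
  have h6 : ∀ y k, gradUp (b.adm t).q (b.adm t).field y k = 0 := by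
    intro y k; rw [adm_q, adm_field, gradUp_zero]
  simp only [secVF, h3, h4, h6, adm_sqrtDet hA, mul_zero, zero_div, pd_const, Pi.zero_apply,
    Finset.sum_const_zero]
  ring

end

/-! ### The background equations -/

namespace Background.IsSolution

variable {M : Model} {I : Set ℝ} {b : Background} {t : ℝ}

theorem hasDerivAt_A (hb : b.IsSolution M I) (ht : t ∈ I) :
    HasDerivAt b.A (-(b.N t * b.P t * Real.sqrt (b.A t))) t := by
  -- By homogeneity and isotropy one point and one diagonal entry carry the whole equation.
  have h := (hb.evolution t ht 0).1 0 0
  have h1 : (canVF M (b.mult t) (b.adm t)).q = (secVF M ⟨(b.adm t).N, (b.adm t).Nv⟩ (b.adm t)).q :=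
    rfl
  have h2 : (fun s => (b.adm s).q 0 0 0) = b.A := by
    funext s; simp [adm_q_apply]
  rw [h1, h2, secVF_adm_q (hb.A_pos t ht)] at h
  have h3 : ∀ i j : Fin 3, pd i (fun y => (b.adm t).Nv y j) = 0 := fun i j => pd_const i 0
  refine h.congr_deriv ?_
  have h4 : (b.adm t).N 0 = b.N t := rfl
  simp [h3, h4]

theorem hasDerivAt_P (hlam : M.lam ≠ 0) (hb : b.IsSolution M I) (ht : t ∈ I) :
    HasDerivAt b.P (b.N t * (b.P t ^ 2 / (4 * Real.sqrt (b.A t))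
          + M.kappa * Real.sqrt (b.A t) * b.pressure M t / 2)) t := by
  have h := (hb.evolution t ht 0).2.1 0 0
  have h1 : (canVF M (b.mult t) (b.adm t)).P = (secVF M ⟨(b.adm t).N, (b.adm t).Nv⟩ (b.adm t)).P :=
    rfl
  have h2 : (fun s => (b.adm s).P 0 0 0) = b.P := by
    funext s; simp [adm_P_apply]
  rw [h1, h2, secVF_adm_P hlam (hb.A_pos t ht)] at h
  have h3 : ∀ i j : Fin 3, pd i (fun y => (b.adm t).Nv y j) = 0 := fun i j => pd_const i 0
  have h5 : ∀ i j : Fin 3, pd i (fun y => (b.adm t).Nv y j * b.P t) = 0 := by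
    intro i j
    have : (fun y => (b.adm t).Nv y j * b.P t) = fun _ => (0 : ℝ) :=
      funext fun y => zero_mul _
    rw [this, pd_const]
  have h6 : ∀ i : Fin 3, pd i (b.adm t).N = 0 := fun i => pd_const i (b.N t)
  have h7 : ∀ i : Fin 3, pd i (0 : E3 → ℝ) = 0 := fun i => pd_const i 0
  have h4 : (b.adm t).N 0 = b.N t := rfl
  refine h.congr_deriv ?_
  simp [h3, h5, h6, h7, h4, lap]

theorem hasDerivAt_field (hb : b.IsSolution M I) (ht : t ∈ I) :
    HasDerivAt b.field (M.lam * b.mom t / Real.sqrt (b.A t) ^ 3 * b.N t) t := by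
  have h := (hb.evolution t ht 0).2.2.1
  have h1 : (canVF M (b.mult t) (b.adm t)).field
      = (secVF M ⟨(b.adm t).N, (b.adm t).Nv⟩ (b.adm t)).field := rfl
  rw [h1, secVF_adm_field (hb.A_pos t ht)] at h
  exact h

theorem hasDerivAt_mom (hb : b.IsSolution M I) (ht : t ∈ I) :
    HasDerivAt b.mom
      (-(Real.sqrt (b.A t) ^ 3 * deriv M.V (b.field t) / (2 * M.lam)) * b.N t) t := by
  have h := (hb.evolution t ht 0).2.2.2.1
  have h1 : (canVF M (b.mult t) (b.adm t)).mom
      = (secVF M ⟨(b.adm t).N, (b.adm t).Nv⟩ (b.adm t)).mom := rfl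
  rw [h1, secVF_adm_mom (hb.A_pos t ht)] at h
  have h5 : ∀ k : Fin 3, pd k (fun y => (b.adm t).Nv y k * b.mom t) = 0 := by
    intro k
    have : (fun y => (b.adm t).Nv y k * b.mom t) = fun _ => (0 : ℝ) := funext fun y => zero_mul _
    rw [this, pd_const]
  simp only [h5, Pi.zero_apply, Finset.sum_const_zero, add_zero] at h
  exact h

theorem hasDerivAt_N (hI : IsOpen I) (hb : b.IsSolution M I) (ht : t ∈ I) :
    HasDerivAt b.N (deriv b.N t) t :=
  ((hb.smooth_N.contDiffAt (hI.mem_nhds ht)).differentiableAt (by simp)).hasDerivAt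

theorem friedmann (hlam : M.lam ≠ 0) (hb : b.IsSolution M I) (ht : t ∈ I) :
    -(3 / 2) * Real.sqrt (b.A t) * b.P t ^ 2
      + M.kappa * (M.lam * b.mom t ^ 2 / (2 * Real.sqrt (b.A t) ^ 3)
        + Real.sqrt (b.A t) ^ 3 * M.V (b.field t) / (2 * M.lam)) = 0 := by
  rw [← adm_hamC hlam (hb.A_pos t ht) 0]
  exact hb.ham t ht 0

theorem sqrt_A_pos (hb : b.IsSolution M I) (ht : t ∈ I) : 0 < Real.sqrt (b.A t) :=
  Real.sqrt_pos.2 (hb.A_pos t ht)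

/-- Ȧ is proportional to P̃, so this is the assumption of nonzero expansion rate. It is what makes
the clock δT⁰ usable. -/
theorem P_ne (hb : b.IsSolution M I) (ht : t ∈ I) : b.P t ≠ 0 := by
  intro h
  have h1 := hb.A_deriv_ne t ht
  rw [(hb.hasDerivAt_A ht).deriv, h] at h1
  simp at h1

/-- Expressing H̃ through P̃ lets it be differentiated with the momentum equation instead of a
second derivative of A. -/
theorem hubble_eq (hb : b.IsSolution M I) (ht : t ∈ I) :
    b.hubble t = -(b.N t * b.P t) / (2 * Real.sqrt (b.A t)) := by
  have ha := hb.sqrt_A_pos ht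
  rw [Background.hubble, (hb.hasDerivAt_A ht).deriv]
  have hAa : b.A t = Real.sqrt (b.A t) ^ 2 := (Real.sq_sqrt (hb.A_pos t ht).le).symm
  set a := Real.sqrt (b.A t)
  rw [hAa]
  field_simp

theorem hasDerivAt_sqrt_A (hb : b.IsSolution M I) (ht : t ∈ I) :
    HasDerivAt (fun s => Real.sqrt (b.A s)) (-(b.N t * b.P t) / 2) t := by
  have ha := hb.sqrt_A_pos ht
  refine ((hb.hasDerivAt_A ht).sqrt (hb.A_pos t ht).ne').congr_deriv ?_
  field_simp

end Background.IsSolution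

/-! ### Decaying descriptors and the action of the constraints on the modes -/

/-- The descriptor with lapse part `n` and shift part `∂_a u + w_a`. -/
def descriptor (n u : DecaySpace) (w : Fin 3 → DecaySpace) : Descriptor where
  n := n
  v x a := (D a u + w a) x

theorem Descriptor.isAdmissible_iff {d : Descriptor} :
    d.IsAdmissible ↔ ∃ n u w, D 0 (w 0) + D 1 (w 1) + D 2 (w 2) = 0 ∧ descriptor n u w = d := by
  constructor
  · rintro ⟨hn, u, w, hu, hw, hdiv, hv⟩
    refine ⟨⟨d.n, hn⟩, ⟨u, hu⟩, fun a => ⟨fun x => w x a, hw a⟩,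
      (Modes.div_apply (F := fun a => ⟨fun x => w x a, hw a⟩)).1 hdiv, ?_⟩
    obtain ⟨dn, dv⟩ := d
    have : dv = fun x a => pd a u x + w x a := funext fun x => funext fun a => hv x a
    subst this
    rfl
  · rintro ⟨n, u, w, hw, rfl⟩
    exact ⟨n.2, u, fun x a => w a x, u.2, fun a => (w a).2, Modes.div_apply.2 hw,
      fun x a => rfl⟩

/-- The modes of the bracket of the phase space variables with the constraints smeared with
`descriptor n u w`, at the background. -/
def gaugeModes (M : Model) (b : Background) (t : ℝ) (n u : DecaySpace)
    (w : Fin 3 → DecaySpace) : Modes where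
  q :=
    { psi := (-(b.P t / (2 * Real.sqrt (b.A t)))) • n + (1 / 3 : ℝ) • Lap u
      E := u
      F := w
      h := 0 }
  p :=
    { psi := (b.P t / (8 * Real.sqrt (b.A t))
          + M.kappa * Real.sqrt (b.A t) * b.pressure M t / (4 * b.P t)) • n
        - (1 / (3 * Real.sqrt (b.A t) * b.P t)) • Lap n + (1 / 6 : ℝ) • Lap u
      E := (1 / (2 * Real.sqrt (b.A t) * b.P t)) • n - u
      F := -w
      h := 0 }
  phi := 0
  B := 0
  S := 0
  p_phi := 0
  p_B := 0
  p_S := 0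
  dfield := (M.lam * b.mom t / Real.sqrt (b.A t) ^ 3) • n
  dmom := (-(Real.sqrt (b.A t) ^ 3 * deriv M.V (b.field t) / (2 * M.lam))) • n + b.mom t • Lap u

section

variable {M : Model} {b : Background} {t : ℝ} {n u : DecaySpace} {w : Fin 3 → DecaySpace}

theorem transverse_gaugeModes (hw : D 0 (w 0) + D 1 (w 1) + D 2 (w 2) = 0) :
    (gaugeModes M b t n u w).Transverse := by
  refine ⟨⟨hw, fun i j => rfl, ?_, fun i => ?_⟩, ⟨?_, fun i j => rfl, ?_, fun i => ?_⟩, ?_, ?_⟩ <;>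
    simp only [gaugeModes, Pi.zero_apply, Pi.neg_apply, map_zero, map_neg, add_zero]
  linear_combination (norm := module) (-1 : ℝ) • hw

theorem pd_mul_const (i : Fin 3) (f : DecaySpace) (r : ℝ) :
    pd i (fun y => f y * r) = (r • D i f : DecaySpace).1 := by
  have : (fun y => f y * r) = (r • f : DecaySpace).1 := funext fun y => mul_comm _ _
  rw [this, pd_coe, map_smul]

theorem ADM.ext_components {X Y : ADM} (hq : ∀ x i j, X.q x i j = Y.q x i j)
    (hP : ∀ x i j, X.P x i j = Y.P x i j) (hf : ∀ x, X.field x = Y.field x)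
    (hm : ∀ x, X.mom x = Y.mom x) (hN : ∀ x, X.N x = Y.N x) (hv : ∀ x i, X.Nv x i = Y.Nv x i)
    (hpi : ∀ x, X.Pi x = Y.Pi x) (hpv : ∀ x i, X.Piv x i = Y.Piv x i) : X = Y := by
  cases X
  cases Y
  congr 1
  · exact funext fun x => Matrix.ext (hq x)
  · exact funext fun x => Matrix.ext (hP x)
  · exact funext hf
  · exact funext hm
  · exact funext hN
  · exact funext fun x => funext (hv x)
  · exact funext hpi
  · exact funext fun x => funext (hpv x)

/-- Lie derivatives of δ_ab and δ^{ab} have opposite signs, so u and w enter metric and momentum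
oppositely and cancel in E + p_E. The double derivative of the lapse enters p_E alone: hence E + p_E
responds to n only. -/
theorem secVF_descriptor (hlam : M.lam ≠ 0) (hA : 0 < b.A t) (hP : b.P t ≠ 0)
    (hw : D 0 (w 0) + D 1 (w 1) + D 2 (w 2) = 0) :
    secVF M (descriptor n u w) (b.adm t) = assemble b t (gaugeModes M b t n u w).toSVT := by
  have ha : 0 < Real.sqrt (b.A t) := Real.sqrt_pos.2 hA
  have hAa : b.A t = Real.sqrt (b.A t) ^ 2 := (Real.sq_sqrt hA.le).symm
  have hv : ∀ i j, pd i (fun y => (descriptor n u w).v y j) = (D i (D j u + w j)).1 :=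
    fun i j => rfl
  have hv' : ∀ i j r, pd i (fun y => (descriptor n u w).v y j * r)
      = (r • D i (D j u + w j) : DecaySpace).1 :=
    fun i j r => pd_mul_const i (D j u + w j) r
  have hn : (descriptor n u w).n = n.1 := rfl
  refine ADM.ext_components (fun x i j => ?_) (fun x i j => ?_) (fun x => ?_) (fun x => ?_)
    (fun x => ?_) (fun x i => ?_) (fun x => ?_) (fun x i => ?_)
  · rw [secVF_adm_q hA, Modes.assemble_q]
    simp only [hv, hn, gaugeModes, TensorModes.tensor, map_add, coe_add_apply, coe_sub_apply,
      coe_smul_apply, D_comm j i, Pi.zero_apply, coe_zero_apply]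
    set a := Real.sqrt (b.A t)
    rw [hAa]
    field_simp
    ring
  · have e1 := congrArg (fun f : DecaySpace => f x) hw
    simp only [coe_add_apply, coe_zero_apply] at e1
    rw [secVF_adm_P hlam hA, Modes.assemble_P]
    simp only [hv, hv', hn, lap_coe, pd_coe, gaugeModes, TensorModes.tensor, map_add, map_sub, map_smul,
      map_neg, coe_add_apply, coe_sub_apply, coe_smul_apply, coe_neg_apply, D_comm j i,
      Pi.zero_apply, Pi.neg_apply, coe_zero_apply, Fin.sum_univ_three]
    have e2 := congrArg (fun f : DecaySpace => f x) (Lap_eq u)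
    simp only [coe_add_apply] at e2
    rw [e2]
    set a := Real.sqrt (b.A t)
    generalize b.pressure M t = p
    field_simp
    -- What remains is the trace term P̃δ_ij div w, which vanishes; the numerical factor comes from
    -- clearing denominators.
    linear_combination (a * b.P t * kron i j * 1152) * e1
  · exact secVF_adm_field hA _ x
  · have e1 := congrArg (fun f : DecaySpace => f x) hw
    have e2 := congrArg (fun f : DecaySpace => f x) (Lap_eq u)
    simp only [coe_add_apply, coe_zero_apply] at e1 e2
    have h : (assemble b t (gaugeModes M b t n u w).toSVT).mom x
        = -(Real.sqrt (b.A t) ^ 3 * deriv M.V (b.field t) / (2 * M.lam)) * n x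
          + b.mom t * Lap u x := rfl
    rw [secVF_adm_mom hA, h]
    simp only [hv', hn, coe_add_apply, map_add, coe_smul_apply, Fin.sum_univ_three, e2]
    linear_combination (b.mom t) * e1
  · exact (mul_zero (b.N t)).symm
  · have h : (assemble b t (gaugeModes M b t n u w).toSVT).Nv x i
      = (D i 0 + 0 : DecaySpace) x := rfl
    rw [h, map_zero]
    simp [secVF]
  · exact (mul_zero (b.N t)).symm
  · have h : (assemble b t (gaugeModes M b t n u w).toSVT).Piv x i
      = (D i 0 + 0 : DecaySpace) x := rfl
    rw [h, map_zero]
    simp [secVF]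

/-! ### Clocks -/

theorem clock_assemble {c : Modes} (hA : b.A t ≠ 0) (hP : b.P t ≠ 0) (hN : b.N t ≠ 0)
    (hc : c.Transverse) :
    clock b t (assemble b t c.toSVT)
      = descriptor ((2 * b.P t * Real.sqrt (b.A t)) • (c.q.E + c.p.E)) c.q.E c.q.F := by
  have h := Modes.svt_assemble hA hP hN hc
  simp only [clock, h]
  rfl

/-- The weight 2P̃√A of the clock is the reciprocal of the coefficient with which n shifts E + p_E,
and u, w are returned unchanged by E and F. -/
theorem clockMatrix_descriptor (hlam : M.lam ≠ 0) (hA : 0 < b.A t) (hP : b.P t ≠ 0)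
    (hN : b.N t ≠ 0) (hw : D 0 (w 0) + D 1 (w 1) + D 2 (w 2) = 0) :
    clockMatrix M b t (descriptor n u w) = descriptor n u w := by
  have ha : 0 < Real.sqrt (b.A t) := Real.sqrt_pos.2 hA
  rw [clockMatrix, secVF_descriptor hlam hA hP hw,
    clock_assemble hA.ne' hP hN (transverse_gaugeModes hw)]
  congr 1
  simp only [gaugeModes, add_sub_cancel, smul_smul]
  have : 2 * b.P t * Real.sqrt (b.A t) * (1 / (2 * Real.sqrt (b.A t) * b.P t)) = 1 := by
    field_simp
  rw [this, one_smul]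

/-- The clocks are canonically conjugate to the constraints at the background, so that the matrix
`A` and its inverse are the identity on decaying descriptors. -/
theorem clockMatrixInv_descriptor (hlam : M.lam ≠ 0) (hA : 0 < b.A t) (hP : b.P t ≠ 0)
    (hN : b.N t ≠ 0) (hw : D 0 (w 0) + D 1 (w 1) + D 2 (w 2) = 0) :
    clockMatrixInv M b t (descriptor n u w) = descriptor n u w := by
  have h := Classical.epsilon_spec
    (p := fun β : Descriptor => β.IsAdmissible ∧ clockMatrix M b t β = descriptor n u w)
    ⟨descriptor n u w, Descriptor.isAdmissible_iff.2 ⟨n, u, w, hw, rfl⟩,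
      clockMatrix_descriptor hlam hA hP hN hw⟩
  obtain ⟨h1, h2⟩ := h
  -- Whatever admissible preimage is chosen, it is fixed by 𝒜 and therefore equals the target.
  obtain ⟨n', u', w', hw', h3⟩ := Descriptor.isAdmissible_iff.1 h1
  rw [← h3, clockMatrix_descriptor hlam hA hP hN hw', h3] at h2
  exact h2

end

/-- The modes at time `s` of a perturbation that has the modes `c` at time `t`. -/
def Modes.rescale (b : Background) (t s : ℝ) (c : Modes) : Modes where
  q := ⟨(b.A t / b.A s) • c.q.psi, (b.A t / b.A s) • c.q.E, (b.A t / b.A s) • c.q.F,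
    (b.A t / b.A s) • c.q.h⟩
  p := ⟨(b.P t / b.P s) • c.p.psi, (b.P t / b.P s) • c.p.E, (b.P t / b.P s) • c.p.F,
    (b.P t / b.P s) • c.p.h⟩
  phi := (b.N t / b.N s) • c.phi
  B := c.B
  S := c.S
  p_phi := (b.N t / b.N s) • c.p_phi
  p_B := c.p_B
  p_S := c.p_S
  dfield := c.dfield
  dmom := c.dmom

theorem TensorModes.Transverse.smul {T : TensorModes} (hT : T.Transverse) (r : ℝ) :
    (⟨r • T.psi, r • T.E, r • T.F, r • T.h⟩ : TensorModes).Transverse := by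
  refine ⟨?_, fun i j => ?_, ?_, fun i => ?_⟩ <;> simp only [Pi.smul_apply, map_smul, ← smul_add]
  · rw [hT.div_F, smul_zero]
  · rw [hT.symm_h]
  · rw [hT.trace_h, smul_zero]
  · rw [hT.div_h, smul_zero]

theorem TensorModes.tensor_smul (T : TensorModes) (r : ℝ) (i j : Fin 3) (x : E3) :
    (⟨r • T.psi, r • T.E, r • T.F, r • T.h⟩ : TensorModes).tensor i j x
      = r * T.tensor i j x := by
  simp only [tensor, Pi.smul_apply, map_smul, coe_add_apply, coe_sub_apply, coe_smul_apply]
  ring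

theorem Modes.Transverse.rescale {b : Background} {t s : ℝ} {c : Modes} (hc : c.Transverse) :
    (c.rescale b t s).Transverse :=
  ⟨hc.q.smul _, hc.p.smul _, hc.div_S, hc.div_p_S⟩

/-- The components of a fixed perturbation depend on time through the prefactors A, P̃ and N̄; the
ratios compensate this. -/
theorem assemble_rescale {b : Background} {t s : ℝ} (c : Modes) (hA : b.A s ≠ 0)
    (hP : b.P s ≠ 0) (hN : b.N s ≠ 0) :
    assemble b s (c.rescale b t s).toSVT = assemble b t c.toSVT := by
  refine ADM.ext_components (fun x i j => ?_) (fun x i j => ?_) (fun x => rfl) (fun x => rfl)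
    (fun x => ?_) (fun x i => rfl) (fun x => ?_) (fun x i => rfl)
  · rw [Modes.assemble_q, Modes.assemble_q, Modes.rescale, TensorModes.tensor_smul]
    field_simp
  · rw [Modes.assemble_P, Modes.assemble_P, Modes.rescale, TensorModes.tensor_smul]
    field_simp
  · have h1 : (assemble b s (c.rescale b t s).toSVT).N x
        = b.N s * (b.N t / b.N s * c.phi x) := rfl
    have h2 : (assemble b t c.toSVT).N x = b.N t * c.phi x := rfl
    rw [h1, h2]
    field_simp
  · have h1 : (assemble b s (c.rescale b t s).toSVT).Pi x
        = b.N s * (b.N t / b.N s * c.p_phi x) := rfl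
    have h2 : (assemble b t c.toSVT).Pi x = b.N t * c.p_phi x := rfl
    rw [h1, h2]
    field_simp

/-! ### Explicit time dependence and rates of the clocks -/

section

variable {M : Model} {I : Set ℝ} {b : Background} {t : ℝ} {c : Modes}

/-- At a fixed phase space point the clocks still move, both through the weight 2P̃√A and through
the rescaled components. This gives the partial time derivative in `clockDot`. -/
theorem clock_eventually (hI : IsOpen I) (hb : b.IsSolution M I) (ht : t ∈ I)
    (hc : c.Transverse) : ∀ᶠ s in 𝓝 t, clock b s (assemble b t c.toSVT)
      = descriptor ((2 * b.P s * Real.sqrt (b.A s))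
          • ((b.A t / b.A s) • c.q.E + (b.P t / b.P s) • c.p.E))
        ((b.A t / b.A s) • c.q.E) ((b.A t / b.A s) • c.q.F) := by
  filter_upwards [hI.mem_nhds ht] with s hs
  have hA := (hb.A_pos s hs).ne'
  have hP := hb.P_ne hs
  have hN := (hb.N_pos s hs).ne'
  rw [← assemble_rescale (s := s) c hA hP hN, clock_assemble hA hP hN hc.rescale]
  rfl

theorem descriptor_add (n n' u u' : DecaySpace) (w w' : Fin 3 → DecaySpace) :
    descriptor n u w + descriptor n' u' w' = descriptor (n + n') (u + u') (w + w') := by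
  have h : (fun x a => (D a u + w a) x + (D a u' + w' a) x : E3 → Fin 3 → ℝ)
      = fun x a => (D a (u + u') + (w + w') a) x := by
    funext x a
    simp only [map_add, Pi.add_apply, coe_add_apply]
    ring
  exact congrArg (Descriptor.mk (n + n').1) h

theorem descriptor_smul (r : ℝ) (n u : DecaySpace) (w : Fin 3 → DecaySpace) :
    r • descriptor n u w = descriptor (r • n) (r • u) (r • w) := by
  have h : (fun x a => r * (D a u + w a) x : E3 → Fin 3 → ℝ)
      = fun x a => (D a (r • u) + (r • w) a) x := by
    funext x a
    simp only [map_smul, Pi.smul_apply, coe_add_apply, coe_smul_apply]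
    ring
  exact congrArg (Descriptor.mk (r • n).1) h

/-- The time derivative of the clocks in terms of the modes. -/
theorem clockDot_assemble (hV : ContDiff ℝ ∞ M.V) (hlam : M.lam ≠ 0) (hI : IsOpen I)
    (hb : b.IsSolution M I) (ht : t ∈ I) (hc : c.Transverse) :
    clockDot M b t (assemble b t c.toSVT)
      = descriptor ((b.N t * b.P t ^ 2) • (c.q.E + c.p.E) + b.N t • (c.q.curvPot + c.phi))
          ((2 * b.N t * b.P t / Real.sqrt (b.A t)) • (c.q.E + c.p.E) + c.B)
          ((2 * b.N t * b.P t / Real.sqrt (b.A t)) • (c.q.F + c.p.F) + c.S) := by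
  have hA := hb.A_pos t ht
  have hP := hb.P_ne ht
  have hN := hb.N_pos t ht
  have ha := hb.sqrt_A_pos ht
  have hdA := hb.hasDerivAt_A ht
  have hdP := hb.hasDerivAt_P hlam ht
  have hda := hb.hasDerivAt_sqrt_A ht
  have hAa : b.A t = Real.sqrt (b.A t) ^ 2 := (Real.sq_sqrt hA.le).symm
  have hev := clock_eventually hI hb ht hc
  -- The dynamical part of the rate; the explicit part is obtained below from `hev` and the
  -- background equations.
  have hcl : clock b t (linVF M b t default (assemble b t c.toSVT))
      = descriptor ((2 * b.P t * Real.sqrt (b.A t)) • ((linModes M b t c).q.E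
          + (linModes M b t c).p.E)) (linModes M b t c).q.E (linModes M b t c).q.F := by
    rw [linVF_assemble hV hlam hA hP hN.ne' hc,
      clock_assemble hA.ne' hP hN.ne' (transverse_linModes hc)]
  have hn : (clockDot M b t (assemble b t c.toSVT)).n
      = ((b.N t * b.P t ^ 2) • (c.q.E + c.p.E) + b.N t • (c.q.curvPot + c.phi)
          : DecaySpace).1 := by
    funext x
    have h1 : HasDerivAt (fun s => 2 * b.P s * Real.sqrt (b.A s)
        * (b.A t / b.A s * c.q.E x + b.P t / b.P s * c.p.E x)) _ t :=
      ((hdP.const_mul 2).fun_mul hda).fun_mul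
        ((((hasDerivAt_const t (b.A t)).fun_div hdA hA.ne').mul_const (c.q.E x)).fun_add
          (((hasDerivAt_const t (b.P t)).fun_div hdP hP).mul_const (c.p.E x)))
    have h2 : (fun s => (clock b s (assemble b t c.toSVT)).n x) =ᶠ[𝓝 t] fun s =>
        2 * b.P s * Real.sqrt (b.A s) * (b.A t / b.A s * c.q.E x + b.P t / b.P s * c.p.E x) := by
      filter_upwards [hev] with s hs
      rw [hs]
      rfl
    have h3 := (h1.congr_of_eventuallyEq h2).deriv
    simp only [clockDot, hcl]
    rw [h3]
    simp only [descriptor, linModes, linModesQ, linModesP, coe_add_apply, coe_sub_apply,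
      coe_smul_apply]
    set a := Real.sqrt (b.A t)
    generalize b.pressure M t = p
    generalize c.q.curvPot = e
    rw [hAa]
    field_simp
    ring
  have hv : (clockDot M b t (assemble b t c.toSVT)).v
      = fun x a => (D a ((2 * b.N t * b.P t / Real.sqrt (b.A t)) • (c.q.E + c.p.E) + c.B)
        + ((2 * b.N t * b.P t / Real.sqrt (b.A t)) • (c.q.F + c.p.F) + c.S) a) x := by
    funext x i
    have h1 : HasDerivAt (fun s => b.A t / b.A s * D i c.q.E x + b.A t / b.A s * c.q.F i x) _ t :=
      (((hasDerivAt_const t (b.A t)).fun_div hdA hA.ne').mul_const (D i c.q.E x)).fun_add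
          (((hasDerivAt_const t (b.A t)).fun_div hdA hA.ne').mul_const (c.q.F i x))
    have h2 : (fun s => (clock b s (assemble b t c.toSVT)).v x i) =ᶠ[𝓝 t] fun s =>
        b.A t / b.A s * D i c.q.E x + b.A t / b.A s * c.q.F i x := by
      filter_upwards [hev] with s hs
      rw [hs]
      simp only [descriptor, map_smul, Pi.smul_apply, coe_add_apply, coe_smul_apply]
    have h3 := (h1.congr_of_eventuallyEq h2).deriv
    simp only [clockDot, hcl]
    rw [h3]
    simp only [descriptor, linModes, linModesQ, map_add, map_smul, coe_add_apply,
      coe_smul_apply, Pi.add_apply, Pi.smul_apply]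
    set a := Real.sqrt (b.A t)
    rw [hAa]
    field_simp
    ring
  generalize clockDot M b t (assemble b t c.toSVT) = U at *
  cases U
  simp only at hn hv
  subst hn hv
  rfl

end

/-! ### The observables -/

/-- The modes of the observables of the longitudinal clocks. -/
def obsModes (M : Model) (b : Background) (t : ℝ) (c : Modes) : Modes where
  q :=
    { psi := c.q.curvPot + b.P t ^ 2 • (c.q.E + c.p.E)
      E := 0
      F := 0
      h := c.q.h }
  p :=
    { psi := c.p.psi + (1 / 2 : ℝ) • Lap c.q.E + (2 / 3 : ℝ) • Lap c.p.E
        - (b.P t ^ 2 / 4 + M.kappa * b.A t / 2 * b.pressure M t) • (c.q.E + c.p.E)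
      E := 0
      F := c.p.F + c.q.F
      h := c.p.h }
  phi := -(c.q.curvPot + b.P t ^ 2 • (c.q.E + c.p.E))
  B := 0
  S := (-(2 * b.N t * b.P t / Real.sqrt (b.A t))) • (c.p.F + c.q.F)
  p_phi := c.p_phi
  p_B := c.p_B
  p_S := c.p_S
  dfield := c.dfield - (2 * b.P t * M.lam * b.mom t / b.A t) • (c.q.E + c.p.E)
  dmom := c.dmom + (b.A t ^ 2 * b.P t * deriv M.V (b.field t) / M.lam) • (c.q.E + c.p.E)
    - b.mom t • Lap c.q.E

section

variable {M : Model} {I : Set ℝ} {b : Background} {t : ℝ} {c : Modes}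

theorem transverse_obsModes (hc : c.Transverse) : (obsModes M b t c).Transverse := by
  have h1 := hc.q.div_F
  have h2 := hc.p.div_F
  refine ⟨⟨by simp [obsModes], hc.q.symm_h, hc.q.trace_h, hc.q.div_h⟩,
    ⟨?_, hc.p.symm_h, hc.p.trace_h, hc.p.div_h⟩, ?_, hc.div_p_S⟩ <;>
    simp only [obsModes, Pi.add_apply, Pi.smul_apply, map_add, map_smul]
  · linear_combination (norm := module) h1 + h2
  · linear_combination (norm := module) (-(2 * b.N t * b.P t / Real.sqrt (b.A t))) • (h1 + h2)

/-- As ℬ is the identity, β is minus the clocks and μ is minus the clock rates after that gauge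
transformation. No linearized equation is needed. -/
theorem observable_assemble (hV : ContDiff ℝ ∞ M.V) (hlam : M.lam ≠ 0) (hI : IsOpen I)
    (hb : b.IsSolution M I) (ht : t ∈ I) (hc : c.Transverse) :
    observable M b t (assemble b t c.toSVT) = assemble b t (obsModes M b t c).toSVT := by
  have hA := hb.A_pos t ht
  have hP := hb.P_ne ht
  have hN := hb.N_pos t ht
  have ha := hb.sqrt_A_pos ht
  have hAa : b.A t = Real.sqrt (b.A t) ^ 2 := (Real.sq_sqrt hA.le).symm
  set n : DecaySpace := (-1 : ℝ) • (2 * b.P t * Real.sqrt (b.A t)) • (c.q.E + c.p.E) with hn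
  set u : DecaySpace := (-1 : ℝ) • c.q.E with hu
  set w : Fin 3 → DecaySpace := (-1 : ℝ) • c.q.F with hw
  have hdw : D 0 (w 0) + D 1 (w 1) + D 2 (w 2) = 0 := by
    have := hc.q.div_F
    simp only [hw, Pi.smul_apply, map_smul]
    linear_combination (norm := module) (-1 : ℝ) • this
  have hβ : clockMatrixInv M b t ((-1 : ℝ) • clock b t (assemble b t c.toSVT))
      = descriptor n u w := by
    rw [clock_assemble hA.ne' hP hN.ne' hc, descriptor_smul,
      clockMatrixInv_descriptor hlam hA hP hN.ne' hdw]
  -- After the gauge transformation E + p_E = 0 and ψ - ΔE/3 has become Ψ, so the rates are N̄(Ψ +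
  -- φ), B and (2N̄P̃/√A)ν + S. Adding their negatives to lapse and shift leaves φ = -Ψ, B = 0 and S
  -- = -(2N̄P̃/√A)ν.
  have hμ : clockMatrixInv M b t ((-1 : ℝ) • clockDot M b t (assemble b t c.toSVT)
      + (-1 : ℝ) • clockDot M b t (secVF M (descriptor n u w) (b.adm t)))
      = descriptor ((-b.N t) • (c.q.curvPot + b.P t ^ 2 • (c.q.E + c.p.E) + c.phi)) (-c.B)
        ((-(2 * b.N t * b.P t / Real.sqrt (b.A t))) • (c.p.F + c.q.F) - c.S) := by
    have e : (-1 : ℝ) • clockDot M b t (assemble b t c.toSVT)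
        + (-1 : ℝ) • clockDot M b t (secVF M (descriptor n u w) (b.adm t))
        = descriptor ((-b.N t) • (c.q.curvPot + b.P t ^ 2 • (c.q.E + c.p.E) + c.phi)) (-c.B)
          ((-(2 * b.N t * b.P t / Real.sqrt (b.A t))) • (c.p.F + c.q.F) - c.S) := by
      rw [secVF_descriptor hlam hA hP hdw, clockDot_assemble hV hlam hI hb ht hc,
        clockDot_assemble hV hlam hI hb ht (transverse_gaugeModes hdw), descriptor_smul,
        descriptor_smul, descriptor_add]
      congr 1
      · refine ext_apply fun x => ?_
        simp only [gaugeModes, TensorModes.curvPot, hn, hu, map_smul, coe_add_apply,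
          coe_sub_apply, coe_smul_apply, coe_zero_apply]
        field_simp
        ring
      · refine ext_apply fun x => ?_
        simp only [gaugeModes, hn, hu, coe_add_apply,
          coe_sub_apply, coe_smul_apply, coe_zero_apply, coe_neg_apply]
        field_simp
        ring
      · simp only [gaugeModes]
        module
    rw [e, clockMatrixInv_descriptor hlam hA hP hN.ne']
    have h1 := hc.q.div_F
    have h2 := hc.p.div_F
    have h3 := hc.div_S
    simp only [Pi.add_apply, Pi.sub_apply, Pi.smul_apply, map_add, map_sub, map_smul]
    linear_combination (norm := module)
      (-(2 * b.N t * b.P t / Real.sqrt (b.A t))) • (h1 + h2) - h3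
  simp only [observable, hβ, hμ]
  rw [secVF_descriptor hlam hA hP hdw]
  refine ADM.ext_components (fun x i j => ?_) (fun x i j => ?_) (fun x => ?_) (fun x => ?_)
    (fun x => ?_) (fun x i => ?_) (fun x => ?_) (fun x i => ?_)
  · have h : ∀ X Y Z : ADM, (X + Y + Z).q x i j = X.q x i j + Y.q x i j + Z.q x i j :=
      fun _ _ _ => rfl
    rw [h, Modes.assemble_q, Modes.assemble_q, Modes.assemble_q]
    simp only [obsModes, gaugeModes, primVF, TensorModes.tensor, TensorModes.curvPot, hn, hu, hw,
      Pi.zero_apply, Pi.smul_apply, map_smul, map_zero, coe_add_apply, coe_sub_apply,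
      coe_smul_apply, coe_zero_apply, Matrix.zero_apply]
    field_simp
    ring
  · have h : ∀ X Y Z : ADM, (X + Y + Z).P x i j = X.P x i j + Y.P x i j + Z.P x i j :=
      fun _ _ _ => rfl
    rw [h, Modes.assemble_P, Modes.assemble_P, Modes.assemble_P]
    simp only [obsModes, gaugeModes, primVF, TensorModes.tensor, hn, hu, hw,
      Pi.zero_apply, Pi.smul_apply, Pi.add_apply, Pi.neg_apply, map_smul, map_zero, map_add,
      map_sub, map_neg, coe_add_apply, coe_sub_apply, coe_neg_apply,
      coe_smul_apply, coe_zero_apply, Matrix.zero_apply]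
    set a := Real.sqrt (b.A t)
    generalize b.pressure M t = p
    rw [hAa]
    field_simp
    ring
  · have h : ∀ X Y Z : ADM, (X + Y + Z).field x = X.field x + Y.field x + Z.field x :=
      fun _ _ _ => rfl
    rw [h]
    simp only [assemble, Modes.toSVT, obsModes, gaugeModes, primVF, hn, Pi.zero_apply,
      coe_add_apply, coe_sub_apply, coe_smul_apply]
    set a := Real.sqrt (b.A t)
    rw [hAa]
    field_simp
    ring
  · have h : ∀ X Y Z : ADM, (X + Y + Z).mom x = X.mom x + Y.mom x + Z.mom x :=
      fun _ _ _ => rfl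
    rw [h]
    simp only [assemble, Modes.toSVT, obsModes, gaugeModes, primVF, hn, hu, Pi.zero_apply,
      map_smul, coe_add_apply, coe_sub_apply, coe_smul_apply]
    set a := Real.sqrt (b.A t)
    rw [hAa]
    field_simp
    ring
  · have h : ∀ X Y Z : ADM, (X + Y + Z).N x = X.N x + Y.N x + Z.N x := fun _ _ _ => rfl
    rw [h]
    simp only [assemble, Modes.toSVT, obsModes, gaugeModes, primVF, descriptor,
      coe_add_apply, coe_smul_apply, coe_zero_apply, coe_neg_apply]
    ring
  · have h : ∀ X Y Z : ADM, (X + Y + Z).Nv x i = X.Nv x i + Y.Nv x i + Z.Nv x i :=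
      fun _ _ _ => rfl
    rw [h]
    simp only [assemble, Modes.toSVT, obsModes, gaugeModes, primVF, descriptor, pd_coe, map_neg,
      map_zero, Pi.zero_apply, Pi.sub_apply, Pi.add_apply, Pi.smul_apply,
      coe_add_apply, coe_sub_apply, coe_smul_apply, coe_zero_apply, coe_neg_apply]
    ring
  · have h : ∀ X Y Z : ADM, (X + Y + Z).Pi x = X.Pi x + Y.Pi x + Z.Pi x := fun _ _ _ => rfl
    rw [h]
    simp [assemble, Modes.toSVT, obsModes, gaugeModes, primVF]
  · have h : ∀ X Y Z : ADM, (X + Y + Z).Piv x i = X.Piv x i + Y.Piv x i + Z.Piv x i :=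
      fun _ _ _ => rfl
    rw [h]
    have h0 : pd i (0 : E3 → ℝ) = 0 := pd_const i 0
    simp [assemble, Modes.toSVT, obsModes, gaugeModes, primVF, h0]

end

/-! ### Curves of modes -/

/-- The curve `f` of decaying functions is jointly smooth near time `t` and has the time
derivative `f'` at `t`. -/
structure HasModeDeriv (f : ℝ → DecaySpace) (f' : DecaySpace) (t : ℝ) : Prop where
  smooth : ∀ x, JointSmoothAt t x fun s => (f s).1
  hasDerivAt : ∀ x, HasDerivAt (fun s => f s x) (f' x) t

namespace HasModeDeriv

variable {f : ℝ → DecaySpace} {f' : DecaySpace} {t : ℝ}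

theorem D (h : HasModeDeriv f f' t) (i : Fin 3) :
    HasModeDeriv (fun s => DecaySpace.D i (f s)) (DecaySpace.D i f') t := by
  refine ⟨fun x => (h.smooth x).pd i, fun x => ?_⟩
  have h1 := (h.smooth x).hasDerivAt_pd i
  have h2 : (fun y => deriv (fun s => f s y) t) = f'.1 := funext fun y => (h.hasDerivAt y).deriv
  rw [h2] at h1
  exact h1

theorem Lap (h : HasModeDeriv f f' t) (x : E3) :
    HasDerivAt (fun s => DecaySpace.Lap (f s) x) (DecaySpace.Lap f' x) t := by
  simp only [Lap_eq, coe_add_apply]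
  exact ((((h.D 0).D 0).hasDerivAt x).fun_add (((h.D 1).D 1).hasDerivAt x)).fun_add
    (((h.D 2).D 2).hasDerivAt x)

theorem of_component {I : Set ℝ} (hI : IsOpen I) (ht : t ∈ I) {X : ℝ → SVT}
    (comp : SVT → E3 → ℝ)
    (hX : ContDiffOn ℝ ∞ (fun p : ℝ × E3 => comp (X p.1) p.2) (I ×ˢ Set.univ))
    (hf : ∀ s ∈ I, (f s).1 = comp (X s)) (hf' : f'.1 = fun x => deriv (fun s => comp (X s) x) t) :
    HasModeDeriv f f' t := by
  have h1 : ∀ x, JointSmoothAt t x fun s => comp (X s) := fun x =>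
    hX.contDiffAt ((hI.prod isOpen_univ).mem_nhds ⟨ht, Set.mem_univ x⟩)
  refine ⟨fun x => ?_, fun x => ?_⟩
  · refine ContDiffAt.congr_of_eventuallyEq (h1 x) ?_
    filter_upwards [(hI.prod isOpen_univ).mem_nhds (⟨ht, Set.mem_univ x⟩ :
      (t, x) ∈ I ×ˢ (Set.univ : Set E3))] with p hp
    rw [hf p.1 hp.1]
  · have h2 := (h1 x).hasDerivAt
    rw [hf']
    refine h2.congr_of_eventuallyEq ?_
    filter_upwards [hI.mem_nhds ht] with s hs
    rw [hf s hs]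

end HasModeDeriv

/-- Componentwise time derivative of a curve of tensor modes. -/
structure HasTensorDeriv (T : ℝ → TensorModes) (T' : TensorModes) (t : ℝ) : Prop where
  psi : HasModeDeriv (fun s => (T s).psi) T'.psi t
  E : HasModeDeriv (fun s => (T s).E) T'.E t
  F : ∀ i, HasModeDeriv (fun s => (T s).F i) (T'.F i) t
  h : ∀ i j, HasModeDeriv (fun s => (T s).h i j) (T'.h i j) t

namespace HasTensorDeriv

variable {T : ℝ → TensorModes} {T' : TensorModes} {t : ℝ}

/-- The conditions are linear and commute with the time derivative. Transversality of the derivative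
is needed to compare it mode by mode with the equations of motion. -/
theorem transverse (hT : HasTensorDeriv T T' t) (h : ∀ᶠ s in 𝓝 t, (T s).Transverse) :
    T'.Transverse := by
  have key : ∀ {g : ℝ → DecaySpace} {g' : DecaySpace},
      (∀ x, HasDerivAt (fun s => g s x) (g' x) t) → (∀ᶠ s in 𝓝 t, g s = 0) → g' = 0 := by
    intro g g' hg h0
    refine ext_apply fun x => ?_
    refine (hg x).unique ((hasDerivAt_const t (0 : ℝ)).congr_of_eventuallyEq ?_)
    filter_upwards [h0] with s hs
    rw [hs]
    rfl
  refine ⟨?_, fun i j => ?_, ?_, fun i => ?_⟩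
  · refine key (g := fun s => D 0 ((T s).F 0) + D 1 ((T s).F 1) + D 2 ((T s).F 2))
      (fun x => ?_) (h.mono fun s hs => hs.div_F)
    exact ((((hT.F 0).D 0).hasDerivAt x).fun_add (((hT.F 1).D 1).hasDerivAt x)).fun_add
      (((hT.F 2).D 2).hasDerivAt x)
  · refine sub_eq_zero.1 (key (g := fun s => (T s).h i j - (T s).h j i) (fun x => ?_)
      (h.mono fun s hs => sub_eq_zero.2 (hs.symm_h i j)))
    exact ((hT.h i j).hasDerivAt x).fun_sub ((hT.h j i).hasDerivAt x)
  · refine key (g := fun s => (T s).h 0 0 + (T s).h 1 1 + (T s).h 2 2)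
      (fun x => ?_) (h.mono fun s hs => hs.trace_h)
    exact (((hT.h 0 0).hasDerivAt x).fun_add ((hT.h 1 1).hasDerivAt x)).fun_add
      ((hT.h 2 2).hasDerivAt x)
  · refine key (g := fun s => D 0 ((T s).h 0 i) + D 1 ((T s).h 1 i) + D 2 ((T s).h 2 i))
      (fun x => ?_) (h.mono fun s hs => hs.div_h i)
    exact ((((hT.h 0 i).D 0).hasDerivAt x).fun_add (((hT.h 1 i).D 1).hasDerivAt x)).fun_add
      (((hT.h 2 i).D 2).hasDerivAt x)

theorem hasDerivAt_tensor (hT : HasTensorDeriv T T' t) (i j : Fin 3) (x : E3) :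
    HasDerivAt (fun s => (T s).tensor i j x) (T'.tensor i j x) t := by
  simp only [TensorModes.tensor, coe_add_apply, coe_sub_apply, coe_smul_apply]
  exact ((((hT.psi.hasDerivAt x).const_mul _).fun_add
    ((((hT.E.D j).D i).hasDerivAt x).fun_sub ((hT.E.Lap x).const_mul _))).fun_add
    (((((hT.F i).D j).hasDerivAt x).fun_add (((hT.F j).D i).hasDerivAt x)).const_mul _)).fun_add
    (((hT.h i j).hasDerivAt x).const_mul _)

/-- If `r(t)` times the tensor has time derivative `r` times the tensor of the modes `L`, then the
modes evolve by `L - (r'/r) T`. -/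
theorem eq_of_hasDerivAt (hT : HasTensorDeriv T T' t) (h : ∀ᶠ s in 𝓝 t, (T s).Transverse)
    {L : TensorModes} (hL : L.Transverse) {r : ℝ → ℝ} {r' k : ℝ} (hr : HasDerivAt r r' t)
    (hr0 : r t ≠ 0) (hk : r' = k * r t)
    (hev : ∀ i j x, HasDerivAt (fun s => 2 * r s * (T s).tensor i j x)
      (2 * r t * L.tensor i j x) t) :
    T' = ⟨L.psi - k • (T t).psi, L.E - k • (T t).E, L.F - k • (T t).F, L.h - k • (T t).h⟩ := by
  have hTt := h.self_of_nhds
  refine TensorModes.tensor_injective (hT.transverse h) ?_ fun i j => ext_apply fun x => ?_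
  · refine ⟨?_, fun i j => ?_, ?_, fun i => ?_⟩ <;>
      simp only [Pi.sub_apply, Pi.smul_apply, map_sub, map_smul]
    · linear_combination (norm := module) hL.div_F - k • hTt.div_F
    · rw [hL.symm_h i j, hTt.symm_h i j]
    · linear_combination (norm := module) hL.trace_h - k • hTt.trace_h
    · linear_combination (norm := module) hL.div_h i - k • hTt.div_h i
  -- The product rule for 2r·T against the given evolution; cancelling 2r leaves the extra term with
  -- the logarithmic derivative k = r'/r.
  · have h1 := ((hr.const_mul 2).fun_mul (hT.hasDerivAt_tensor i j x)).unique (hev i j x)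
    rw [hk] at h1
    have h2 : T'.tensor i j x = L.tensor i j x - k * (T t).tensor i j x := by
      have : 2 * r t * (T'.tensor i j x - (L.tensor i j x - k * (T t).tensor i j x)) = 0 := by
        linear_combination h1
      have h3 : (2 * r t) ≠ 0 := by simpa using hr0
      exact sub_eq_zero.1 ((mul_eq_zero.1 this).resolve_left h3)
    rw [h2]
    simp only [TensorModes.tensor, Pi.sub_apply, Pi.smul_apply, map_sub, map_smul, coe_add_apply,
      coe_sub_apply, coe_smul_apply]
    ring

end HasTensorDeriv

/-- The curve of modes `c` with the time derivatives, on `I`, of the metric, momentum and matter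
components given by `c'`. -/
structure IsModeCurve (I : Set ℝ) (X : ℝ → SVT) (c c' : ℝ → Modes) : Prop where
  toSVT : ∀ t ∈ I, (c t).toSVT = X t
  transverse : ∀ t ∈ I, (c t).Transverse
  q : ∀ t ∈ I, HasTensorDeriv (fun s => (c s).q) (c' t).q t
  p : ∀ t ∈ I, HasTensorDeriv (fun s => (c s).p) (c' t).p t
  dfield : ∀ t ∈ I, HasModeDeriv (fun s => (c s).dfield) (c' t).dfield t
  dmom : ∀ t ∈ I, HasModeDeriv (fun s => (c s).dmom) (c' t).dmom t

instance : Inhabited Modes :=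
  ⟨⟨⟨0, 0, 0, 0⟩, ⟨0, 0, 0, 0⟩, 0, 0, 0, 0, 0, 0, 0, 0⟩⟩

/-- The time derivative of a curve of components. -/
def SVT.timeDeriv (X : ℝ → SVT) (t : ℝ) : SVT where
  psi x := deriv (fun s => (X s).psi x) t
  E x := deriv (fun s => (X s).E x) t
  F x i := deriv (fun s => (X s).F x i) t
  h x := Matrix.of fun i j => deriv (fun s => (X s).h x i j) t
  p_psi x := deriv (fun s => (X s).p_psi x) t
  p_E x := deriv (fun s => (X s).p_E x) t
  p_F x i := deriv (fun s => (X s).p_F x i) t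
  p_h x := Matrix.of fun i j => deriv (fun s => (X s).p_h x i j) t
  phi x := deriv (fun s => (X s).phi x) t
  B x := deriv (fun s => (X s).B x) t
  S x i := deriv (fun s => (X s).S x i) t
  p_phi x := deriv (fun s => (X s).p_phi x) t
  p_B x := deriv (fun s => (X s).p_B x) t
  p_S x i := deriv (fun s => (X s).p_S x i) t
  dfield x := deriv (fun s => (X s).dfield x) t
  dmom x := deriv (fun s => (X s).dmom x) t

/-- Decay of the time derivatives places them in `DecaySpace`, where uniqueness of modes applies. -/
theorem exists_isModeCurve {I : Set ℝ} (hI : IsOpen I) {X : ℝ → SVT}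
    (hX : SVT.IsRegularCurve I X) : ∃ c c' : ℝ → Modes, IsModeCurve I X c c' := by
  obtain ⟨hT, ⟨h1, h2, h3, h4⟩, ⟨h5, h6, h7, h8⟩, ⟨h9, h10, h11⟩, ⟨h12, h13, h14⟩, h15, h16⟩ := hX
  have hc : ∀ t, ∃ c : Modes, t ∈ I → c.toSVT = X t := by
    intro t
    by_cases ht : t ∈ I
    · obtain ⟨c, hc⟩ := Modes.exists_toSVT (X := X t)
        ⟨⟨(h1.2 t ht).1, (h2.2 t ht).1, fun a => ((h3 a).2 t ht).1, fun a b => ((h4 a b).2 t ht).1⟩,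
          ⟨(h5.2 t ht).1, (h6.2 t ht).1, fun a => ((h7 a).2 t ht).1,
            fun a b => ((h8 a b).2 t ht).1⟩,
          ⟨(h9.2 t ht).1, (h10.2 t ht).1, fun a => ((h11 a).2 t ht).1⟩,
          ⟨(h12.2 t ht).1, (h13.2 t ht).1, fun a => ((h14 a).2 t ht).1⟩,
          (h15.2 t ht).1, (h16.2 t ht).1⟩
      exact ⟨c, fun _ => hc⟩
    -- Outside `I` the value is irrelevant: every later statement is at a point of the open set `I`.
    · exact ⟨default, fun h => absurd h ht⟩
  have hc' : ∀ t, ∃ c : Modes, t ∈ I → c.toSVT = SVT.timeDeriv X t := by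
    intro t
    by_cases ht : t ∈ I
    · obtain ⟨c, hc⟩ := Modes.exists_toSVT (X := SVT.timeDeriv X t)
        ⟨⟨(h1.2 t ht).2, (h2.2 t ht).2, fun a => ((h3 a).2 t ht).2, fun a b => ((h4 a b).2 t ht).2⟩,
          ⟨(h5.2 t ht).2, (h6.2 t ht).2, fun a => ((h7 a).2 t ht).2,
            fun a b => ((h8 a b).2 t ht).2⟩,
          ⟨(h9.2 t ht).2, (h10.2 t ht).2, fun a => ((h11 a).2 t ht).2⟩,
          ⟨(h12.2 t ht).2, (h13.2 t ht).2, fun a => ((h14 a).2 t ht).2⟩,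
          (h15.2 t ht).2, (h16.2 t ht).2⟩
      exact ⟨c, fun _ => hc⟩
    · exact ⟨default, fun h => absurd h ht⟩
  choose c hc using hc
  choose c' hc' using hc'
  have key : ∀ t ∈ I, ∀ (comp : SVT → E3 → ℝ) (f : Modes → DecaySpace),
      (∀ m : Modes, (f m).1 = comp m.toSVT) →
      (comp (SVT.timeDeriv X t) = fun x => deriv (fun s => comp (X s) x) t) →
      ContDiffOn ℝ ∞ (fun p : ℝ × E3 => comp (X p.1) p.2) (I ×ˢ Set.univ) →
      HasModeDeriv (fun s => f (c s)) (f (c' t)) t := by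
    intro t ht comp f hf hd hs
    refine HasModeDeriv.of_component hI ht comp hs (fun s hs => ?_) ?_
    · rw [hf, hc s hs]
    · rw [hf, hc' t ht, hd]
  refine ⟨c, c', hc, fun t ht => ?_, fun t ht => ⟨?_, ?_, fun i => ?_, fun i j => ?_⟩,
    fun t ht => ⟨?_, ?_, fun i => ?_, fun i j => ?_⟩, fun t ht => ?_, fun t ht => ?_⟩
  · rw [← Modes.isTransverse_toSVT, hc t ht]
    exact hT t ht
  · exact key t ht _ (fun m => m.q.psi) (fun _ => rfl) rfl h1.1
  · exact key t ht _ (fun m => m.q.E) (fun _ => rfl) rfl h2.1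
  · exact key t ht (fun Y x => Y.F x i) (fun m => m.q.F i) (fun _ => rfl) rfl (h3 i).1
  · exact key t ht (fun Y x => Y.h x i j) (fun m => m.q.h i j) (fun _ => rfl) rfl (h4 i j).1
  · exact key t ht _ (fun m => m.p.psi) (fun _ => rfl) rfl h5.1
  · exact key t ht _ (fun m => m.p.E) (fun _ => rfl) rfl h6.1
  · exact key t ht (fun Y x => Y.p_F x i) (fun m => m.p.F i) (fun _ => rfl) rfl (h7 i).1
  · exact key t ht (fun Y x => Y.p_h x i j) (fun m => m.p.h i j) (fun _ => rfl) rfl (h8 i j).1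
  · exact key t ht _ (fun m => m.dfield) (fun _ => rfl) rfl h15.1
  · exact key t ht _ (fun m => m.dmom) (fun _ => rfl) rfl h16.1

/-! ### The linearized equations in terms of the modes -/

section

variable {M : Model} {I : Set ℝ} {b : Background} {X : ℝ → SVT} {m : ℝ → Descriptor}
  {c c' : ℝ → Modes} {t : ℝ}

/-- The added term is minus Ȧ/A times the mode, coming from the time dependent factor 2A in δq. -/
theorem evolution_q (hlam : M.lam ≠ 0) (hV : ContDiff ℝ ∞ M.V) (hI : IsOpen I)
    (hb : b.IsSolution M I) (hc : IsModeCurve I X c c')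
    (hsol : IsLinearSolution M b I m fun t => assemble b t (X t)) (ht : t ∈ I) :
    (c' t).q = ⟨(linModesQ b t (c t)).psi + (b.N t * b.P t / Real.sqrt (b.A t)) • (c t).q.psi,
      (linModesQ b t (c t)).E + (b.N t * b.P t / Real.sqrt (b.A t)) • (c t).q.E,
      (linModesQ b t (c t)).F + (b.N t * b.P t / Real.sqrt (b.A t)) • (c t).q.F,
      (linModesQ b t (c t)).h + (b.N t * b.P t / Real.sqrt (b.A t)) • (c t).q.h⟩ := by
  have hA := hb.A_pos t ht
  have ha := hb.sqrt_A_pos ht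
  have hAa : b.A t = Real.sqrt (b.A t) ^ 2 := (Real.sq_sqrt hA.le).symm
  have hI' := hI.mem_nhds ht
  have h := (hc.q t ht).eq_of_hasDerivAt
    (k := -(b.N t * b.P t / Real.sqrt (b.A t)))
    (by filter_upwards [hI'] with s hs using (hc.transverse s hs).q)
    (transverse_linModesQ (b := b) (t := t) (hc.transverse t ht)) (hb.hasDerivAt_A ht) hA.ne'
    (by
      set a := Real.sqrt (b.A t)
      rw [hAa]
      field_simp) ?_
  · rw [h]
    congr 1 <;> module
  · intro i j x
    have h1 := (hsol.evolution t ht x).1 i j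
    -- Multipliers enter only the lapse and shift components, so the arbitrary ones may be replaced
    -- by zero.
    have h2 : (linVF M b t (m t) (assemble b t (X t))).q
        = (linVF M b t default (assemble b t (X t))).q := rfl
    rw [h2, ← hc.toSVT t ht, linVF_assemble hV hlam hA (hb.P_ne ht) (hb.N_pos t ht).ne'
      (hc.transverse t ht), Modes.assemble_q] at h1
    refine h1.congr_of_eventuallyEq ?_
    filter_upwards [hI'] with s hs
    rw [← hc.toSVT s hs, Modes.assemble_q]

/-- Here k is the logarithmic derivative of P̃ along the background equation. -/
theorem evolution_p (hlam : M.lam ≠ 0) (hV : ContDiff ℝ ∞ M.V) (hI : IsOpen I)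
    (hb : b.IsSolution M I) (hc : IsModeCurve I X c c')
    (hsol : IsLinearSolution M b I m fun t => assemble b t (X t)) (ht : t ∈ I) {k : ℝ}
    (hk : k = b.N t * b.P t / Real.sqrt (b.A t) / 4
      + M.kappa * b.N t * Real.sqrt (b.A t) * b.pressure M t / b.P t / 2) :
    (c' t).p = ⟨(linModesP M b t (c t)).psi - k • (c t).p.psi,
      (linModesP M b t (c t)).E - k • (c t).p.E,
      (linModesP M b t (c t)).F - k • (c t).p.F,
      (linModesP M b t (c t)).h - k • (c t).p.h⟩ := by
  have hA := hb.A_pos t ht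
  have ha := hb.sqrt_A_pos ht
  have hP := hb.P_ne ht
  have hI' := hI.mem_nhds ht
  refine (hc.p t ht).eq_of_hasDerivAt
    (by filter_upwards [hI'] with s hs using (hc.transverse s hs).p)
    (transverse_linModesP (M := M) (b := b) (t := t) (hc.transverse t ht))
    (hb.hasDerivAt_P hlam ht) hP
    (by
      rw [hk]
      field_simp) ?_
  intro i j x
  have h1 := (hsol.evolution t ht x).2.1 i j
  have h2 : (linVF M b t (m t) (assemble b t (X t))).P
      = (linVF M b t default (assemble b t (X t))).P := rfl
  rw [h2, ← hc.toSVT t ht, linVF_assemble hV hlam hA hP (hb.N_pos t ht).ne'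
    (hc.transverse t ht), Modes.assemble_P] at h1
  refine h1.congr_of_eventuallyEq ?_
  filter_upwards [hI'] with s hs
  rw [← hc.toSVT s hs, Modes.assemble_P]

theorem evolution_dfield (hlam : M.lam ≠ 0) (hV : ContDiff ℝ ∞ M.V) (hI : IsOpen I)
    (hb : b.IsSolution M I) (hc : IsModeCurve I X c c')
    (hsol : IsLinearSolution M b I m fun t => assemble b t (X t)) (ht : t ∈ I) :
    (c' t).dfield = (linModes M b t (c t)).dfield := by
  refine ext_apply fun x => ?_
  have h1 := (hsol.evolution t ht x).2.2.1
  have h2 : (linVF M b t (m t) (assemble b t (X t))).field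
      = (linVF M b t default (assemble b t (X t))).field := rfl
  rw [h2, ← hc.toSVT t ht, linVF_assemble hV hlam (hb.A_pos t ht) (hb.P_ne ht)
    (hb.N_pos t ht).ne' (hc.transverse t ht)] at h1
  refine ((hc.dfield t ht).hasDerivAt x).unique (h1.congr_of_eventuallyEq ?_)
  filter_upwards [hI.mem_nhds ht] with s hs
  rw [← hc.toSVT s hs]
  rfl

theorem evolution_dmom (hlam : M.lam ≠ 0) (hV : ContDiff ℝ ∞ M.V) (hI : IsOpen I)
    (hb : b.IsSolution M I) (hc : IsModeCurve I X c c')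
    (hsol : IsLinearSolution M b I m fun t => assemble b t (X t)) (ht : t ∈ I) :
    (c' t).dmom = (linModes M b t (c t)).dmom := by
  refine ext_apply fun x => ?_
  have h1 := (hsol.evolution t ht x).2.2.2.1
  have h2 : (linVF M b t (m t) (assemble b t (X t))).mom
      = (linVF M b t default (assemble b t (X t))).mom := rfl
  rw [h2, ← hc.toSVT t ht, linVF_assemble hV hlam (hb.A_pos t ht) (hb.P_ne ht)
    (hb.N_pos t ht).ne' (hc.transverse t ht)] at h1
  refine ((hc.dmom t ht).hasDerivAt x).unique (h1.congr_of_eventuallyEq ?_)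
  filter_upwards [hI.mem_nhds ht] with s hs
  rw [← hc.toSVT s hs]
  rfl

theorem hamModes_eq_zero (hlam : M.lam ≠ 0) (hV : ContDiff ℝ ∞ M.V)
    (hb : b.IsSolution M I) (hc : IsModeCurve I X c c')
    (hsol : IsLinearSolution M b I m fun t => assemble b t (X t)) (ht : t ∈ I) :
    hamModes M b t (c t) = 0 := by
  refine ext_apply fun x => ?_
  have h1 := hsol.ham t ht x
  rw [← hc.toSVT t ht] at h1
  rw [coe_zero_apply, ← h1]
  exact (hasDerivAt_hamC hV hlam (hb.A_pos t ht) (hc.transverse t ht) x).deriv.symm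

/-- The constraint is a decaying gradient plus a decaying divergence-free field, so the two parts
vanish separately. -/
theorem diffScalar_eq_zero (hc : IsModeCurve I X c c')
    (hsol : IsLinearSolution M b I m fun t => assemble b t (X t)) (ht : t ∈ I) :
    diffScalar M b t (c t) = 0 := by
  refine (eq_zero_of_grad_add (w := diffVector b t (c t)) ?_ fun a => ext_apply fun x => ?_).1
  · have h1 := congrArg Lap (hc.transverse t ht).q.div_F
    have h2 := congrArg Lap (hc.transverse t ht).p.div_F
    simp only [diffVector, map_add, map_zero, map_smul, D_Lap] at h1 h2 ⊢
    linear_combination (norm := module) (-2 * b.A t * b.P t) • (h1 + h2)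
  · have h1 := hsol.diff t ht x a
    rw [← hc.toSVT t ht] at h1
    rw [coe_zero_apply, ← h1]
    exact (hasDerivAt_diffC (hc.transverse t ht) x a).deriv.symm

theorem primary_eq_zero (hb : b.IsSolution M I) (hc : IsModeCurve I X c c')
    (hsol : IsLinearSolution M b I m fun t => assemble b t (X t)) (ht : t ∈ I) :
    (c t).p_phi = 0 ∧ (c t).p_B = 0 ∧ (c t).p_S = 0 := by
  refine ⟨ext_apply fun x => ?_, eq_zero_of_grad_add (hc.transverse t ht).div_p_S
    fun a => ext_apply fun x => ?_⟩
  · have h1 := hsol.prim t ht x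
    rw [← hc.toSVT t ht] at h1
    exact (mul_eq_zero.1 h1).resolve_left (hb.N_pos t ht).ne'
  · have h1 := hsol.primv t ht x a
    rw [← hc.toSVT t ht] at h1
    exact h1

end

/-! ### Derivatives of background quantities -/

namespace Background.IsSolution

variable {M : Model} {I : Set ℝ} {b : Background} {t : ℝ}

theorem hasDerivAt_V (hV : ContDiff ℝ ∞ M.V) (hb : b.IsSolution M I) (ht : t ∈ I) :
    HasDerivAt (fun s => M.V (b.field s))
      (deriv M.V (b.field t) * (M.lam * b.mom t / Real.sqrt (b.A t) ^ 3 * b.N t)) t :=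
  (hV.differentiable (by simp) (b.field t)).hasDerivAt.comp t (hb.hasDerivAt_field ht)

theorem hasDerivAt_deriv_V (hV : ContDiff ℝ ∞ M.V) (hb : b.IsSolution M I) (ht : t ∈ I) :
    HasDerivAt (fun s => deriv M.V (b.field s))
      (deriv (deriv M.V) (b.field t) * (M.lam * b.mom t / Real.sqrt (b.A t) ^ 3 * b.N t)) t := by
  have h1 : ContDiff ℝ ∞ (deriv M.V) := (contDiff_infty_iff_deriv.1 hV).2
  exact (h1.differentiable (by simp) (b.field t)).hasDerivAt.comp t (hb.hasDerivAt_field ht)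

theorem hasDerivAt_pressure (hlam : M.lam ≠ 0) (hV : ContDiff ℝ ∞ M.V) (hb : b.IsSolution M I)
    (ht : t ∈ I) :
    HasDerivAt (b.pressure M)
      (-(b.N t * b.mom t * deriv M.V (b.field t)) / Real.sqrt (b.A t) ^ 3
        + 3 / 2 * M.lam * b.N t * b.P t * b.mom t ^ 2 / Real.sqrt (b.A t) ^ 7) t := by
  have hA := hb.A_pos t ht
  have ha := hb.sqrt_A_pos ht
  have hAa : b.A t = Real.sqrt (b.A t) ^ 2 := (Real.sq_sqrt hA.le).symm
  have h := ((((hasDerivAt_const t M.lam).fun_div ((hb.hasDerivAt_A ht).fun_pow 3)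
    (pow_ne_zero 3 hA.ne')).fun_mul ((hb.hasDerivAt_mom ht).fun_pow 2)).fun_sub
    ((hb.hasDerivAt_V hV ht).const_mul (1 / M.lam))).const_mul (1 / 2)
  refine h.congr_deriv ?_
  set a := Real.sqrt (b.A t)
  rw [hAa]
  field_simp
  ring

theorem hasDerivAt_hubble (hlam : M.lam ≠ 0) (hI : IsOpen I) (hb : b.IsSolution M I)
    (ht : t ∈ I) :
    HasDerivAt b.hubble (-(deriv b.N t * b.P t) / (2 * Real.sqrt (b.A t))
      - 3 / 8 * b.N t ^ 2 * b.P t ^ 2 / Real.sqrt (b.A t) ^ 2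
      - M.kappa * b.N t ^ 2 * b.pressure M t / 4) t := by
  have hA := hb.A_pos t ht
  have ha := hb.sqrt_A_pos ht
  have h := ((((hb.hasDerivAt_N hI ht).fun_mul (hb.hasDerivAt_P hlam ht)).fun_neg).fun_div
    ((hb.hasDerivAt_sqrt_A ht).const_mul 2) (by positivity))
  refine (h.congr_of_eventuallyEq ?_).congr_deriv ?_
  · filter_upwards [hI.mem_nhds ht] with s hs using hb.hubble_eq hs
  · field_simp
    ring

end Background.IsSolution

/-! ### Evolution of the observables -/

section

variable {M : Model} {I : Set ℝ} {b : Background} {X : ℝ → SVT} {m : ℝ → Descriptor}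
  {c c' : ℝ → Modes} {t : ℝ}

/-- φ and B cancel: φ between ψ' and P̃²p_E', B between ψ' and ΔE'/3 and inside E' + p_E'. Only the
evolution equations enter, no constraint. -/
theorem hasDerivAt_obsModes_psi (hlam : M.lam ≠ 0) (hV : ContDiff ℝ ∞ M.V) (hI : IsOpen I)
    (hb : b.IsSolution M I) (hc : IsModeCurve I X c c')
    (hsol : IsLinearSolution M b I m fun t => assemble b t (X t)) (ht : t ∈ I) (x : E3) :
    HasDerivAt (fun s => (obsModes M b s (c s)).q.psi x)
      (2 * b.hubble t * ((obsModes M b t (c t)).p.psi x - (obsModes M b t (c t)).q.psi x)) t := by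
  have hA := hb.A_pos t ht
  have ha := hb.sqrt_A_pos ht
  have hP := hb.P_ne ht
  have hAa : b.A t = Real.sqrt (b.A t) ^ 2 := (Real.sq_sqrt hA.le).symm
  have h := (((hc.q t ht).psi.hasDerivAt x).fun_sub
    (((hc.q t ht).E.Lap x).const_mul (1 / 3))).fun_add
    (((hb.hasDerivAt_P hlam ht).fun_pow 2).fun_mul
      (((hc.q t ht).E.hasDerivAt x).fun_add ((hc.p t ht).E.hasDerivAt x)))
  refine h.congr_deriv ?_
  rw [evolution_q hlam hV hI hb hc hsol ht, evolution_p hlam hV hI hb hc hsol ht rfl,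
    hb.hubble_eq ht]
  simp only [obsModes, linModesQ, linModesP, TensorModes.curvPot, map_add, map_sub, map_smul,
    coe_add_apply, coe_sub_apply, coe_smul_apply]
  set a := Real.sqrt (b.A t)
  generalize b.pressure M t = p
  rw [hAa]
  field_simp
  ring

/-- The pressure cannot stay a free symbol here, because δT̃ and the source of p_ψ weigh kinetic and
potential energy differently. -/
theorem hasDerivAt_obsModes_p_psi (hlam : M.lam ≠ 0) (hV : ContDiff ℝ ∞ M.V) (hI : IsOpen I)
    (hb : b.IsSolution M I) (hc : IsModeCurve I X c c')
    (hsol : IsLinearSolution M b I m fun t => assemble b t (X t)) (ht : t ∈ I) (x : E3) :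
    HasDerivAt (fun s => (obsModes M b s (c s)).p.psi x)
      ((- b.hubble t / 2 + M.kappa / 4 * (b.N t ^ 2 * b.pressure M t / b.hubble t))
          * (obsModes M b t (c t)).p.psi x
        + b.hubble t / 2 * (obsModes M b t (c t)).q.psi x
        - M.kappa / 8 * (b.N t ^ 2 / b.hubble t)
          * deltaT M b t (obsModes M b t (c t)).toSVT x) t := by
  have hA := hb.A_pos t ht
  have ha := hb.sqrt_A_pos ht
  have hP := hb.P_ne ht
  have hN := (hb.N_pos t ht).ne'
  have hAa : b.A t = Real.sqrt (b.A t) ^ 2 := (Real.sq_sqrt hA.le).symm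
  have h := ((((hc.p t ht).psi.hasDerivAt x).fun_add
    (((hc.q t ht).E.Lap x).const_mul (1 / 2))).fun_add
    (((hc.p t ht).E.Lap x).const_mul (2 / 3))).fun_sub
    (((((hb.hasDerivAt_P hlam ht).fun_pow 2).div_const 4).fun_add
      ((((hb.hasDerivAt_A ht).const_mul M.kappa).div_const 2).fun_mul
        (hb.hasDerivAt_pressure hlam hV ht))).fun_mul
      (((hc.q t ht).E.hasDerivAt x).fun_add ((hc.p t ht).E.hasDerivAt x)))
  refine h.congr_deriv ?_
  rw [evolution_q hlam hV hI hb hc hsol ht, evolution_p hlam hV hI hb hc hsol ht rfl,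
    hb.hubble_eq ht]
  simp only [obsModes, Modes.toSVT, deltaT, linModesQ, linModesP, TensorModes.curvPot, map_add,
    map_sub, map_smul, coe_add_apply, coe_sub_apply, coe_smul_apply, Background.pressure]
  set a := Real.sqrt (b.A t)
  rw [hAa]
  field_simp
  ring

/-- S enters F' and p_F' with opposite signs, so the sum evolves by itself. -/
theorem hasDerivAt_obsModes_p_F (hlam : M.lam ≠ 0) (hV : ContDiff ℝ ∞ M.V) (hI : IsOpen I)
    (hb : b.IsSolution M I) (hc : IsModeCurve I X c c')
    (hsol : IsLinearSolution M b I m fun t => assemble b t (X t)) (ht : t ∈ I) (x : E3)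
    (i : Fin 3) :
    HasDerivAt (fun s => (obsModes M b s (c s)).p.F i x)
      ((digamma M b t - 4 * b.hubble t) * (obsModes M b t (c t)).p.F i x) t := by
  have ha := hb.sqrt_A_pos ht
  have hP := hb.P_ne ht
  have hN := (hb.N_pos t ht).ne'
  have h := (((hc.p t ht).F i).hasDerivAt x).fun_add (((hc.q t ht).F i).hasDerivAt x)
  refine h.congr_deriv ?_
  rw [evolution_q hlam hV hI hb hc hsol ht, evolution_p hlam hV hI hb hc hsol ht rfl,
    digamma, hb.hubble_eq ht]
  simp only [obsModes, linModesQ, linModesP, Pi.add_apply, Pi.sub_apply, Pi.smul_apply,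
    coe_add_apply, coe_sub_apply, coe_smul_apply]
  field_simp
  ring

theorem hasDerivAt_obsModes_dfield (hlam : M.lam ≠ 0) (hV : ContDiff ℝ ∞ M.V) (hI : IsOpen I)
    (hb : b.IsSolution M I) (hc : IsModeCurve I X c c')
    (hsol : IsLinearSolution M b I m fun t => assemble b t (X t)) (ht : t ∈ I) (x : E3) :
    HasDerivAt (fun s => (obsModes M b s (c s)).dfield x)
      (b.N t * (M.lam / Real.sqrt (b.A t) ^ 3)
        * (-4 * b.mom t * (obsModes M b t (c t)).q.psi x + (obsModes M b t (c t)).dmom x)) t := by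
  have hA := hb.A_pos t ht
  have ha := hb.sqrt_A_pos ht
  have hP := hb.P_ne ht
  have hAa : b.A t = Real.sqrt (b.A t) ^ 2 := (Real.sq_sqrt hA.le).symm
  have h := ((hc.dfield t ht).hasDerivAt x).fun_sub
    ((((((hb.hasDerivAt_P hlam ht).const_mul 2).mul_const M.lam).fun_mul
      (hb.hasDerivAt_mom ht)).fun_div (hb.hasDerivAt_A ht) hA.ne').fun_mul
      (((hc.q t ht).E.hasDerivAt x).fun_add ((hc.p t ht).E.hasDerivAt x)))
  refine h.congr_deriv ?_
  rw [evolution_q hlam hV hI hb hc hsol ht, evolution_p hlam hV hI hb hc hsol ht rfl,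
    evolution_dfield hlam hV hI hb hc hsol ht]
  simp only [obsModes, linModes, linModesQ, linModesP, TensorModes.curvPot, map_add,
    map_sub, map_smul, coe_add_apply, coe_sub_apply, coe_smul_apply]
  set a := Real.sqrt (b.A t)
  generalize b.pressure M t = p
  rw [hAa]
  field_simp
  ring

theorem hasDerivAt_obsModes_dmom (hlam : M.lam ≠ 0) (hV : ContDiff ℝ ∞ M.V) (hI : IsOpen I)
    (hb : b.IsSolution M I) (hc : IsModeCurve I X c c')
    (hsol : IsLinearSolution M b I m fun t => assemble b t (X t)) (ht : t ∈ I) (x : E3) :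
    HasDerivAt (fun s => (obsModes M b s (c s)).dmom x)
      (- (b.N t * (Real.sqrt (b.A t) ^ 3 / M.lam))
        * (deriv M.V (b.field t) * (obsModes M b t (c t)).q.psi x
          - 1 / b.A t * Lap (obsModes M b t (c t)).dfield x
          + (1 / 2) * deriv (deriv M.V) (b.field t) * (obsModes M b t (c t)).dfield x)) t := by
  have hA := hb.A_pos t ht
  have ha := hb.sqrt_A_pos ht
  have hP := hb.P_ne ht
  have hAa : b.A t = Real.sqrt (b.A t) ^ 2 := (Real.sq_sqrt hA.le).symm
  have h := (((hc.dmom t ht).hasDerivAt x).fun_add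
    ((((((hb.hasDerivAt_A ht).fun_pow 2).fun_mul (hb.hasDerivAt_P hlam ht)).fun_mul
      (hb.hasDerivAt_deriv_V hV ht)).div_const M.lam).fun_mul
      (((hc.q t ht).E.hasDerivAt x).fun_add ((hc.p t ht).E.hasDerivAt x)))).fun_sub
    ((hb.hasDerivAt_mom ht).fun_mul ((hc.q t ht).E.Lap x))
  refine h.congr_deriv ?_
  rw [evolution_q hlam hV hI hb hc hsol ht, evolution_p hlam hV hI hb hc hsol ht rfl,
    evolution_dmom hlam hV hI hb hc hsol ht]
  simp only [obsModes, linModes, linModesQ, linModesP, TensorModes.curvPot, map_add,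
    map_sub, map_smul, coe_add_apply, coe_sub_apply, coe_smul_apply]
  set a := Real.sqrt (b.A t)
  generalize b.pressure M t = p
  rw [hAa]
  field_simp
  ring

/-! ### The linearized constraints in terms of the observables -/

/-- The bracket of the constraints closes on the constraints, so the gauge transformation with lapse
-2P̃√A(E + p_E) changes this one by a multiple of the background Hamiltonian constraint, which is
zero. -/
theorem diffScalar_obsModes (hlam : M.lam ≠ 0) (hb : b.IsSolution M I)
    (hc : IsModeCurve I X c c')
    (hsol : IsLinearSolution M b I m fun t => assemble b t (X t)) (ht : t ∈ I) :
    diffScalar M b t (obsModes M b t (c t)) = 0 := by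
  have hA := hb.A_pos t ht
  have ha := hb.sqrt_A_pos ht
  have hAa : b.A t = Real.sqrt (b.A t) ^ 2 := (Real.sq_sqrt hA.le).symm
  refine ext_apply fun x => ?_
  have h0 := congrArg (fun f : DecaySpace => f x) (diffScalar_eq_zero hc hsol ht)
  have hF := hb.friedmann hlam ht
  simp only [diffScalar, obsModes, TensorModes.curvPot, map_zero,
    coe_add_apply, coe_sub_apply, coe_smul_apply, coe_zero_apply, Background.pressure] at h0 ⊢
  set a := Real.sqrt (b.A t)
  rw [hAa] at h0 ⊢
  linear_combination (norm := skip) h0 - 2 * a * b.P t * ((c t).q.E x + (c t).p.E x) * hF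
  field_simp
  ring

/-- C is a scalar density: moving along -∂E changes it by -ΔE times its background value, the
Friedmann constraint. -/
theorem hamModes_obsModes (hlam : M.lam ≠ 0) (hV : ContDiff ℝ ∞ M.V) (hb : b.IsSolution M I)
    (hc : IsModeCurve I X c c')
    (hsol : IsLinearSolution M b I m fun t => assemble b t (X t)) (ht : t ∈ I) :
    hamModes M b t (obsModes M b t (c t)) = 0 := by
  have hA := hb.A_pos t ht
  have ha := hb.sqrt_A_pos ht
  have hAa : b.A t = Real.sqrt (b.A t) ^ 2 := (Real.sq_sqrt hA.le).symm
  refine ext_apply fun x => ?_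
  have h0 := congrArg (fun f : DecaySpace => f x) (hamModes_eq_zero hlam hV hb hc hsol ht)
  have hF := hb.friedmann hlam ht
  simp only [hamModes, obsModes, TensorModes.curvPot, map_add, map_sub, map_smul, map_zero,
    coe_add_apply, coe_sub_apply, coe_smul_apply, coe_zero_apply, Background.pressure] at h0 ⊢
  set a := Real.sqrt (b.A t)
  rw [hAa]
  linear_combination (norm := skip) h0 - Lap (c t).q.E x * hF
  field_simp
  ring

end

/-! ### From modes back to the observables -/

section

variable {M : Model} {I : Set ℝ} {b : Background} {X : ℝ → SVT} {m : ℝ → Descriptor}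
  {c c' : ℝ → Modes} {t : ℝ}

theorem obs_eq (hlam : M.lam ≠ 0) (hV : ContDiff ℝ ∞ M.V) (hI : IsOpen I)
    (hb : b.IsSolution M I) (hc : IsModeCurve I X c c') (ht : t ∈ I) :
    obs M b X t = (obsModes M b t (c t)).toSVT := by
  rw [obs, ← hc.toSVT t ht, observable_assemble hV hlam hI hb ht (hc.transverse t ht),
    Modes.svt_assemble (hb.A_pos t ht).ne' (hb.P_ne ht) (hb.N_pos t ht).ne'
      (transverse_obsModes (hc.transverse t ht))]

/-- The coefficient 4H̃²A/N̄² equals P̃². The model is an explicit argument because the left side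
does not determine it. -/
theorem bardeen_eq (M : Model) (hb : b.IsSolution M I) (hc : IsModeCurve I X c c')
    (ht : t ∈ I) : bardeen b X t = (obsModes M b t (c t)).q.psi.1 := by
  have hA := hb.A_pos t ht
  have ha := hb.sqrt_A_pos ht
  have hN := (hb.N_pos t ht).ne'
  have hAa : b.A t = Real.sqrt (b.A t) ^ 2 := (Real.sq_sqrt hA.le).symm
  funext x
  rw [bardeen, ← hc.toSVT t ht, hb.hubble_eq ht]
  simp only [Modes.toSVT, lap_coe, obsModes, TensorModes.curvPot, coe_add_apply, coe_sub_apply,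
    coe_smul_apply]
  set a := Real.sqrt (b.A t)
  rw [hAa]
  field_simp
  ring

theorem upsilon_eq (hb : b.IsSolution M I) (hc : IsModeCurve I X c c')
    (ht : t ∈ I) (x : E3) : upsilon M b X t x = (obsModes M b t (c t)).p.psi x := by
  have hA := hb.A_pos t ht
  have ha := hb.sqrt_A_pos ht
  have hN := (hb.N_pos t ht).ne'
  have hAa : b.A t = Real.sqrt (b.A t) ^ 2 := (Real.sq_sqrt hA.le).symm
  rw [upsilon, ← hc.toSVT t ht, hb.hubble_eq ht]
  simp only [Modes.toSVT, lap_coe, obsModes, coe_add_apply, coe_sub_apply, coe_smul_apply]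
  generalize b.pressure M t = p
  set a := Real.sqrt (b.A t)
  rw [hAa]
  field_simp
  ring

theorem nu_eq (M : Model) (b : Background) (hc : IsModeCurve I X c c') (ht : t ∈ I) (x : E3)
    (i : Fin 3) : nu X t x i = (obsModes M b t (c t)).p.F i x := by
  rw [nu, ← hc.toSVT t ht]
  rfl

theorem obsModes_S (hb : b.IsSolution M I) (ht : t ∈ I) (d : Modes) (x : E3) (i : Fin 3) :
    (obsModes M b t d).S i x = 4 * b.hubble t * (obsModes M b t d).p.F i x := by
  have ha := hb.sqrt_A_pos ht
  rw [hb.hubble_eq ht]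
  simp only [obsModes, Pi.smul_apply, Pi.add_apply, coe_smul_apply, coe_add_apply]
  field_simp
  ring

/-- These identities hold for every regular curve of perturbations; neither the linearized equations
nor the constraints are used. -/
theorem longitudinalObservables (hlam : M.lam ≠ 0) (hV : ContDiff ℝ ∞ M.V) (hI : IsOpen I)
    (hb : b.IsSolution M I) (hc : IsModeCurve I X c c') (ht : t ∈ I) :
    LongitudinalObservables M b X t := by
  have ho := obs_eq hlam hV hI hb hc ht
  have hX := hc.toSVT t ht
  constructor <;> intro x <;> rw [ho]
  · rw [bardeen_eq M hb hc ht]; rfl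
  · rfl
  · exact fun _ => rfl
  · rw [upsilon_eq hb hc ht]; rfl
  · rfl
  · intro i; rw [nu_eq M b hc ht]; rfl
  · rw [bardeen_eq M hb hc ht]; rfl
  · rfl
  · intro i; rw [nu_eq M b hc ht]; exact obsModes_S hb ht _ x i
  · rw [← hX]; rfl
  · rw [← hX]; rfl
  · rw [← hX]; exact fun _ => rfl

theorem longitudinalHamilton (hlam : M.lam ≠ 0) (hV : ContDiff ℝ ∞ M.V) (hI : IsOpen I)
    (hb : b.IsSolution M I) (hc : IsModeCurve I X c c')
    (hsol : IsLinearSolution M b I m fun t => assemble b t (X t)) (ht : t ∈ I) :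
    LongitudinalHamilton M b X t := by
  have key : ∀ (comp : SVT → ℝ) {r : ℝ},
      HasDerivAt (fun s => comp (obsModes M b s (c s)).toSVT) r t →
      HasDerivAt (fun s => comp (obs M b X s)) r t := by
    intro comp r h
    refine h.congr_of_eventuallyEq ?_
    filter_upwards [hI.mem_nhds ht] with s hs
    rw [obs_eq hlam hV hI hb hc hs]
  have hzero : ∀ (comp : SVT → ℝ), (∀ s ∈ I, comp (obsModes M b s (c s)).toSVT = 0) →
      HasDerivAt (fun s => comp (obs M b X s)) 0 t := by
    intro comp h
    refine key comp ((hasDerivAt_const t (0 : ℝ)).congr_of_eventuallyEq ?_)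
    filter_upwards [hI.mem_nhds ht] with s hs using h s hs
  have hF := hasDerivAt_obsModes_p_F hlam hV hI hb hc hsol ht
  have hpsi := hasDerivAt_obsModes_psi hlam hV hI hb hc hsol ht
  constructor <;> intro x
  · rw [bardeen_eq M hb hc ht, upsilon_eq hb hc ht]
    exact key (fun Y => Y.psi x) (hpsi x)
  · exact hzero (fun Y => Y.E x) fun _ _ => rfl
  · rw [bardeen_eq M hb hc ht, upsilon_eq hb hc ht, obs_eq hlam hV hI hb hc ht]
    exact key (fun Y => Y.p_psi x) (hasDerivAt_obsModes_p_psi hlam hV hI hb hc hsol ht x)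
  · exact hzero (fun Y => Y.p_E x) fun _ _ => rfl
  · exact fun i => hzero (fun Y => Y.F x i) fun _ _ => rfl
  · intro i
    rw [nu_eq M b hc ht]
    exact key (fun Y => Y.p_F x i) (hF x i)
  · rw [bardeen_eq M hb hc ht, upsilon_eq hb hc ht]
    refine key (fun Y => Y.phi x) ((hpsi x).fun_neg.congr_deriv ?_)
    change -(2 * b.hubble t * ((obsModes M b t (c t)).p.psi x - (obsModes M b t (c t)).q.psi x))
      = 2 * b.hubble t * ((obsModes M b t (c t)).q.psi x - (obsModes M b t (c t)).p.psi x)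
    ring
  · exact hzero (fun Y => Y.B x) fun _ _ => rfl
  · intro i
    rw [nu_eq M b hc ht]
    refine key (fun Y => Y.S x i) ?_
    have hH := hb.hasDerivAt_hubble hlam hI ht
    -- Product rule on S = 4H̃ν, with the derivative of H̃ left unevaluated as in the claimed
    -- equation.
    have h := (hH.differentiableAt.hasDerivAt.const_mul 4).fun_mul (hF x i)
    refine (h.congr_of_eventuallyEq ?_).congr_deriv ?_
    · filter_upwards [hI.mem_nhds ht] with s hs using obsModes_S hb hs _ x i
    · ring
  · refine hzero (fun Y => Y.p_phi x) fun s hs => ?_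
    change (c s).p_phi x = 0
    rw [(primary_eq_zero hb hc hsol hs).1]
    rfl
  · refine hzero (fun Y => Y.p_B x) fun s hs => ?_
    change (c s).p_B x = 0
    rw [(primary_eq_zero hb hc hsol hs).2.1]
    rfl
  · refine fun i => hzero (fun Y => Y.p_S x i) fun s hs => ?_
    change (c s).p_S i x = 0
    rw [(primary_eq_zero hb hc hsol hs).2.2]
    rfl
  · rw [bardeen_eq M hb hc ht, obs_eq hlam hV hI hb hc ht]
    exact key (fun Y => Y.dfield x) (hasDerivAt_obsModes_dfield hlam hV hI hb hc hsol ht x)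
  · rw [bardeen_eq M hb hc ht, obs_eq hlam hV hI hb hc ht]
    refine key (fun Y => Y.dmom x) ?_
    simp only [Modes.toSVT, lap_coe]
    exact hasDerivAt_obsModes_dmom hlam hV hI hb hc hsol ht x

/-! ### The closed equation for the Bardeen potential -/

theorem hasDerivAt_bardeen (hlam : M.lam ≠ 0) (hV : ContDiff ℝ ∞ M.V) (hI : IsOpen I)
    (hb : b.IsSolution M I) (hc : IsModeCurve I X c c')
    (hsol : IsLinearSolution M b I m fun t => assemble b t (X t)) (ht : t ∈ I) (x : E3) :
    HasDerivAt (fun s => bardeen b X s x)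
      (2 * b.hubble t * ((obsModes M b t (c t)).p.psi x - (obsModes M b t (c t)).q.psi x)) t := by
  refine (hasDerivAt_obsModes_psi hlam hV hI hb hc hsol ht x).congr_of_eventuallyEq ?_
  filter_upwards [hI.mem_nhds ht] with s hs
  rw [bardeen_eq M hb hc hs]

/-- Differentiating Ψ̇ = 2H̃(Υ - Ψ) produces Υ, δφ and δπ. The first is expressed by Ψ̇ and Ψ, the
other two are removed by the linearized constraints. -/
theorem hasDerivAt_deriv_bardeen (hlam : M.lam ≠ 0) (hV : ContDiff ℝ ∞ M.V) (hI : IsOpen I)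
    (hb : b.IsSolution M I) (hc : IsModeCurve I X c c')
    (hsol : IsLinearSolution M b I m fun t => assemble b t (X t)) (ht : t ∈ I)
    (hfield : deriv b.field t ≠ 0) (x : E3) :
    HasDerivAt (deriv (fun s => bardeen b X s x))
      (b.N t ^ 2 / b.A t * lap (bardeen b X t) x
        + (M.kappa / 2 * b.N t ^ 2 * b.pressure M t
            - b.N t ^ 2 * b.hubble t / deriv b.field t * deriv M.V (b.field t)
            - 3 * b.hubble t ^ 2) * bardeen b X t x
        + (deriv b.N t / b.N t - 7 * b.hubble t
            - b.N t ^ 2 / deriv b.field t * deriv M.V (b.field t))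
          * deriv (fun s => bardeen b X s x) t) t := by
  have hA := hb.A_pos t ht
  have ha := hb.sqrt_A_pos ht
  have hP := hb.P_ne ht
  have hN := (hb.N_pos t ht).ne'
  have hAa : b.A t = Real.sqrt (b.A t) ^ 2 := (Real.sq_sqrt hA.le).symm
  -- φ̄' is proportional to π̄, the coefficient of δφ in the diffeomorphism constraint.
  have hmom : b.mom t ≠ 0 := by
    rintro h
    rw [(hb.hasDerivAt_field ht).deriv, h] at hfield
    simp at hfield
  have h := ((hb.hasDerivAt_hubble hlam hI ht).const_mul 2).fun_mul
    ((hasDerivAt_obsModes_p_psi hlam hV hI hb hc hsol ht x).fun_sub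
      (hasDerivAt_obsModes_psi hlam hV hI hb hc hsol ht x))
  refine (h.congr_of_eventuallyEq ?_).congr_deriv ?_
  · filter_upwards [hI.mem_nhds ht] with s hs
      using (hasDerivAt_bardeen hlam hV hI hb hc hsol hs x).deriv
  have h1 := congrArg (fun f : DecaySpace => f x) (diffScalar_obsModes hlam hb hc hsol ht)
  have h2 := congrArg (fun f : DecaySpace => f x) (hamModes_obsModes hlam hV hb hc hsol ht)
  have hF := hb.friedmann hlam ht
  rw [(hasDerivAt_bardeen hlam hV hI hb hc hsol ht x).deriv, bardeen_eq M hb hc ht, lap_coe,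
    (hb.hasDerivAt_field ht).deriv, hb.hubble_eq ht]
  have hE : (obsModes M b t (c t)).q.E = 0 := rfl
  have hpE : (obsModes M b t (c t)).p.E = 0 := rfl
  change _ = _ * Lap (obsModes M b t (c t)).q.psi x + _ * (obsModes M b t (c t)).q.psi x + _
  generalize obsModes M b t (c t) = d at *
  simp only [diffScalar, hamModes, TensorModes.curvPot, hE, hpE, map_zero, smul_zero, sub_zero,
    add_zero, coe_add_apply, coe_smul_apply, coe_zero_apply] at h1 h2
  simp only [deltaT, Modes.toSVT, Background.pressure]
  set a := Real.sqrt (b.A t)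
  rw [hAa] at h1 ⊢
  -- The multiple of `h2` matches δπ in δT̃ and supplies (N̄²/A)ΔΨ. It leaves twice the δφ term,
  -- which the multiple of `h1` cancels, and `hF` adjusts the coefficient of Ψ.
  linear_combination (norm := skip) (-(b.N t ^ 2) / (4 * a ^ 3)) * h2
    + (b.N t ^ 2 * deriv M.V (b.field t) / (4 * M.lam * b.mom t)) * h1
    + 3 / 4 * b.N t ^ 2 / a ^ 3 * d.q.psi x * hF
  field_simp
  ring

theorem bardeen_conformal (hlam : M.lam ≠ 0) (hV : ContDiff ℝ ∞ M.V) (hI : IsOpen I)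
    (hb : b.IsSolution M I) (hc : IsModeCurve I X c c')
    (hsol : IsLinearSolution M b I m fun t => assemble b t (X t))
    (hconf : ∀ t ∈ I, b.N t = Real.sqrt (b.A t)) (ht : t ∈ I)
    (hfield : deriv b.field t ≠ 0) (x : E3) :
    deriv (deriv (fun s => bardeen b X s x)) t
      + 2 * (b.hubble t - deriv (deriv b.field) t / deriv b.field t)
        * deriv (fun s => bardeen b X s x) t
      - lap (bardeen b X t) x
      + 2 * (deriv b.hubble t
          - b.hubble t * deriv (deriv b.field) t / deriv b.field t)
        * bardeen b X t x = 0 := by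
  have hA := hb.A_pos t ht
  have ha := hb.sqrt_A_pos ht
  have hP := hb.P_ne ht
  have hAa : b.A t = Real.sqrt (b.A t) ^ 2 := (Real.sq_sqrt hA.le).symm
  have hmom : b.mom t ≠ 0 := by
    rintro h
    rw [(hb.hasDerivAt_field ht).deriv, h] at hfield
    simp at hfield
  have hI' := hI.mem_nhds ht
  have hN' : deriv b.N t = -(b.N t * b.P t) / 2 := by
    refine ((hb.hasDerivAt_sqrt_A ht).congr_of_eventuallyEq ?_).deriv
    filter_upwards [hI'] with s hs using hconf s hs
  -- The background Klein-Gordon equation in conformal time; it trades V' in the coefficients for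
  -- φ̄''/φ̄'.
  have hf : deriv (deriv b.field) t
      = M.lam * b.mom t * b.P t / Real.sqrt (b.A t) ^ 2
        - Real.sqrt (b.A t) ^ 2 * deriv M.V (b.field t) / 2 := by
    have h := (((hb.hasDerivAt_mom ht).const_mul M.lam).fun_div
      ((hb.hasDerivAt_sqrt_A ht).fun_pow 3) (by positivity)).fun_mul (hb.hasDerivAt_N hI ht)
    refine ((h.congr_of_eventuallyEq ?_).deriv).trans ?_
    · filter_upwards [hI'] with s hs using (hb.hasDerivAt_field hs).deriv
    · rw [hN', hconf t ht]
      field_simp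
      ring
  rw [(hasDerivAt_deriv_bardeen hlam hV hI hb hc hsol ht hfield x).deriv, hf,
    (hb.hasDerivAt_field ht).deriv, (hb.hasDerivAt_hubble hlam hI ht).deriv, hb.hubble_eq ht,
    hN', hconf t ht]
  generalize deriv (fun s => bardeen b X s x) t = u
  generalize b.pressure M t = p
  set a := Real.sqrt (b.A t)
  rw [hAa]
  field_simp
  ring

end

end Cosmo

end

theorem mainTheorem3 (M : Cosmo.Model) (hκ : 0 < M.kappa) (hlam : M.lam ≠ 0)
    (hV : ContDiff ℝ ∞ M.V)
    (I : Set ℝ) (hI : IsOpen I)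
    (b : Cosmo.Background) (hb : b.IsSolution M I)
    (X : ℝ → Cosmo.SVT) (hX : Cosmo.SVT.IsRegularCurve I X)
    (m : ℝ → Cosmo.Descriptor)
    (hsol : Cosmo.IsLinearSolution M b I m (fun t => Cosmo.assemble b t (X t))) :
    (∀ t ∈ I, Cosmo.LongitudinalObservables M b X t) ∧
    (∀ t ∈ I, Cosmo.LongitudinalHamilton M b X t) ∧
    (∀ t ∈ I, deriv b.field t ≠ 0 → ∀ x : Cosmo.E3,
      HasDerivAt (deriv (fun s => Cosmo.bardeen b X s x))
        (b.N t ^ 2 / b.A t * Cosmo.lap (Cosmo.bardeen b X t) x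
          + (M.kappa / 2 * b.N t ^ 2 * b.pressure M t
              - b.N t ^ 2 * b.hubble t / deriv b.field t * deriv M.V (b.field t)
              - 3 * b.hubble t ^ 2) * Cosmo.bardeen b X t x
          + (deriv b.N t / b.N t - 7 * b.hubble t
              - b.N t ^ 2 / deriv b.field t * deriv M.V (b.field t))
            * deriv (fun s => Cosmo.bardeen b X s x) t) t) ∧
    ((∀ t ∈ I, b.N t = Real.sqrt (b.A t)) →
      ∀ t ∈ I, deriv b.field t ≠ 0 → ∀ x : Cosmo.E3,
        deriv (deriv (fun s => Cosmo.bardeen b X s x)) t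
          + 2 * (b.hubble t - deriv (deriv b.field) t / deriv b.field t)
            * deriv (fun s => Cosmo.bardeen b X s x) t
          - Cosmo.lap (Cosmo.bardeen b X t) x
          + 2 * (deriv b.hubble t
              - b.hubble t * deriv (deriv b.field) t / deriv b.field t)
            * Cosmo.bardeen b X t x = 0) := by
  -- One choice of decaying modes along the curve serves all four claims.
  obtain ⟨c, c', hc⟩ := Cosmo.exists_isModeCurve hI hX
  exact ⟨fun t ht => Cosmo.longitudinalObservables hlam hV hI hb hc ht,
    fun t ht => Cosmo.longitudinalHamilton hlam hV hI hb hc hsol ht,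
    fun t ht hf x => Cosmo.hasDerivAt_deriv_bardeen hlam hV hI hb hc hsol ht hf x,
    fun hconf t ht hf x => Cosmo.bardeen_conformal hlam hV hI hb hc hsol hconf ht hf x⟩
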